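/- **Conventions.** The language is $\{\in\}$ with equality. For $N\ge 2$, $\mathrm{KP}\Pi_N$ is the first-order theory with the axioms Extensionality, Pairing, Union, Infinity, $\Delta_0$-Separation, $\Delta_0$-Collection, the full schema of Foundation, and $\Pi_N$-reflection: for each $\Pi_N$-formula $\varphi$, $\varphi(\vec p)\to\exists z\,[z$ transitive, $\omega\in z$, $\vec p\in z$, $(z,\in)\models\varphi(\vec p)]$. $\mathrm L$ denotes the universe of discourse, and $P,Q$ range over transitive sets with $\omega$ as an element ("universes"). Let $\Pi_2(b)$ be a universal $\Pi_2$-formula. For a class $\mathcal X$ of universes, $$P\in M_2(\mathcal X)\iff\forall b\in P\,[P\models\Pi_2(b)\to\exists Q\in\mathcal X\cap P\,(b\in Q\models\Pi_2(b))],$$ and likewise for $\mathrm L$ in place of $P$. For a definable relation $\prec$ (with $a\in P$), by recursion on $\in$, $$P\in M_2(a;\prec)\iff P\in\bigcap\{M_2(M_2(b;\prec)): P\models b\prec a\},$$ and likewise for $\mathrm L$. For a relation $\prec$ on $\omega$, $TI(a,\prec,\Pi_n)$ is the schema $\forall x\in\omega[\forall y\prec x\,\varphi(y)\to\varphi(x)]\to\forall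 x\prec a\,\varphi(x)$ for $\Pi_n$-formulas $\varphi$ (with parameters), and $W(\prec)$ is the set of $a\in\omega$ such that every $f:\omega\to\omega$ with $f(0)=a$ has an $n$ with $f(n+1)\not\prec f(n)$. For relations $<_1,<_0$, the relation $E(<_1,<_0)$ is defined on finite sequences $\sum_{n<\ell}\pi^{u_n}x_n:=\langle(u_n,x_n):n<\ell\rangle$ with $u_{n+1}<_1u_n$, $u_n\in dom(<_1)$, $x_n\in\omega$: $s$ is smaller than $t$ iff either for some $k$ they agree below $k$ and their $k$-th entries $(u,x)$, $(u',x')$ satisfy $u<_1u'$, or $u=u'$ and $x<_0x'$; or $s$ is a proper initial segment of $t$. Let $N\ge 3$, and for $2\le i\le N-1$ let $<_i$ be a relation on $\omega$ defined by a $\Sigma_1$-formula and transitive, provably in $\mathrm{KP}\Pi_N$. Put $<_{E_{N-1}}=<_{N-1}$ (with domain $\omega$) and $<_{E_i}=E(<_{E_{i+1}},<_i)$ for $2\le i\le N-2$, $<_T=<_{E_2}$. Put $dom(<_{E_{N-1}W})=\omega$; for $2\le i\le N-2$ let $dom(<_{E_iW})$ be the set of all $\sum_{n<\ell}\pi^{\alpha_n}x_n$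 with $\alpha_n\in dom(<_{E_{i+1}W})$, $\alpha_{n+1}<_{E_{i+1}W}\alpha_n$ and $x_n\in W(<_i)$; let $<_{E_iW}$ be the restriction of $<_{E_i}$ to $dom(<_{E_iW})$, and $<_{TW}=<_{E_2W}$. For $a\in\omega$ and $\alpha\in dom(<_T)$ write $\alpha<a$ if all exponents of $\alpha$ are $<a$, inductively, where for $n\in\omega=dom(<_{E_{N-1}})$, $n<a$ means $n<_{N-1}a$. **Theorem.** $\mathrm{KP}\Pi_N$ proves $$\forall a\in\omega\,\forall\alpha<a\,[TI(a,<_{N-1},\Pi_N)\to \mathrm L\in M_2(\alpha;<_{TW})]$$ and also $$\forall a\in\omega\,\forall\alpha<a\,[TI(a,<_{N-1},\Pi_N)\to \mathrm L\in M_2(M_2(\alpha;<_{TW}))].$$ -/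

import Mathlib

namespace PiRefl

/-! ## The language of set theory and the Lévy hierarchy -/

/-- The only non-logical symbol of the language of set theory: the binary relation `∈`. -/
inductive SetRel : ℕ → Type
  | mem : SetRel 2

/-- The language `{∈}` of set theory (equality is a logical symbol). -/
def setLang : FirstOrder.Language.{0, 0} := ⟨fun _ => Empty, SetRel⟩

/-- The symbol `∈`. -/
def memSym : setLang.Relations 2 := SetRel.mem

/-- `Δ₀`-formulas: built from atomic formulas by propositional connectives and the bounded
quantifier `∀ x ∈ z`, where `z` is a variable different from `x`. -/
inductive IsDelta0 {α : Type} : ∀ {n : ℕ}, setLang.BoundedFormula α n → Prop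
  | falsum {n : ℕ} : IsDelta0 (FirstOrder.Language.BoundedFormula.falsum : setLang.BoundedFormula α n)
  | equal {n : ℕ} (s t : setLang.Term (α ⊕ Fin n)) :
      IsDelta0 (FirstOrder.Language.BoundedFormula.equal s t)
  | rel {n l : ℕ} (R : setLang.Relations l) (ts : Fin l → setLang.Term (α ⊕ Fin n)) :
      IsDelta0 (FirstOrder.Language.BoundedFormula.rel R ts)
  | imp {n : ℕ} {φ ψ : setLang.BoundedFormula α n} :
      IsDelta0 φ → IsDelta0 ψ → IsDelta0 (φ.imp ψ)
  | ball {n : ℕ} (z : α ⊕ Fin n) {φ : setLang.BoundedFormula α (n + 1)} :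
      IsDelta0 φ →
      IsDelta0 ((memSym.boundedFormula₂ (FirstOrder.Language.Term.var (Sum.inr (Fin.last n)))
        (FirstOrder.Language.Term.var (Sum.map id Fin.castSucc z))).imp φ).all

/-- The two sides of the Lévy hierarchy. -/
inductive Side : Type
  | sigma
  | pi

/-- The other side. -/
def Side.dual : Side → Side
  | .sigma => .pi
  | .pi => .sigma

/-- `Σ_k`- and `Π_k`-formulas: `k` alternating blocks of unbounded quantifiers, the first one
existential (for `Σ_k`) or universal (for `Π_k`), in front of a `Δ₀`-formula; blocks may have any
finite length, including `0`. -/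
inductive IsLevy {α : Type} : Side → ℕ → ∀ {n : ℕ}, setLang.BoundedFormula α n → Prop
  | delta0 (s : Side) {n : ℕ} {φ : setLang.BoundedFormula α n} : IsDelta0 φ → IsLevy s 0 φ
  | raise {s : Side} {k n : ℕ} {φ : setLang.BoundedFormula α n} :
      IsLevy s k φ → IsLevy s.dual (k + 1) φ
  | ex {k n : ℕ} {φ : setLang.BoundedFormula α (n + 1)} :
      IsLevy .sigma (k + 1) φ → IsLevy .sigma (k + 1) φ.ex
  | all {k n : ℕ} {φ : setLang.BoundedFormula α (n + 1)} :
      IsLevy .pi (k + 1) φ → IsLevy .pi (k + 1) φ.all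

/-- `Σ_k`-formulas. -/
def IsSigma {α : Type} (k : ℕ) {n : ℕ} (φ : setLang.BoundedFormula α n) : Prop :=
  IsLevy .sigma k φ

/-- `Π_k`-formulas. -/
def IsPi {α : Type} (k : ℕ) {n : ℕ} (φ : setLang.BoundedFormula α n) : Prop :=
  IsLevy .pi k φ

/-! ## Writing formulas

An `Fml` is a formula given in every context: at `n` it is a formula in the variables
`0, …, n - 1`.  A quantifier in context `n` binds the variable with the name `n` and passes this
name to its body, so that formulas can be written with Lean binders.  In the closed formulas below
every variable is in scope; an atomic formula with a variable out of scope would read `⊥`. -/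

/-- Formulas in every context. -/
abbrev Fml : Type := (n : ℕ) → setLang.BoundedFormula Empty n

/-- `x ∈ y`. -/
def Mem (x y : ℕ) : Fml := fun n =>
  if h : x < n ∧ y < n then
    memSym.boundedFormula₂ (FirstOrder.Language.Term.var (Sum.inr ⟨x, h.1⟩))
      (FirstOrder.Language.Term.var (Sum.inr ⟨y, h.2⟩))
  else ⊥

/-- `x = y`. -/
def Eqv (x y : ℕ) : Fml := fun n =>
  if h : x < n ∧ y < n then
    (FirstOrder.Language.Term.var (Sum.inr ⟨x, h.1⟩)).bdEqual (FirstOrder.Language.Term.var (Sum.inr ⟨y, h.2⟩))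
  else ⊥

def FBot : Fml := fun _ => ⊥

def FImp (F G : Fml) : Fml := fun n => (F n).imp (G n)

def FNeg (F : Fml) : Fml := fun n => (F n).not

def FAnd (F G : Fml) : Fml := fun n => F n ⊓ G n

def FOr (F G : Fml) : Fml := fun n => F n ⊔ G n

def FIff (F G : Fml) : Fml := fun n => (F n).iff (G n)

def FAll (F : ℕ → Fml) : Fml := fun n => (F n (n + 1)).all

def FEx (F : ℕ → Fml) : Fml := fun n => (F n (n + 1)).ex

local infix:60 " ∊ " => Mem
local infix:60 " ≐ " => Eqv
local infixr:50 " ⋏ " => FAnd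
local infixr:45 " ⋎ " => FOr
local infixr:40 " ⟶ᶠ " => FImp
local infix:35 " ⟷ᶠ " => FIff

/-- `∀ x ∈ y, F x`. -/
def AllIn (y : ℕ) (F : ℕ → Fml) : Fml := FAll fun x => x ∊ y ⟶ᶠ F x

/-- `∃ x ∈ y, F x`. -/
def ExIn (y : ℕ) (F : ℕ → Fml) : Fml := FNeg (AllIn y fun x => FNeg (F x))

/-- A block `∀ p₀ … ∀ p_{k-1}` of universal quantifiers. -/
def Alls : (k : ℕ) → ((Fin k → ℕ) → Fml) → Fml
  | 0, F => F Fin.elim0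
  | k + 1, F => FAll fun x => Alls k fun p => F (Fin.cons x p)

/-- Conjunction of a finite list. -/
def Conj (l : List Fml) : Fml := l.foldr FAnd (FNeg FBot)

/-- The formula `φ` with the variables `p` in place of its free variables. -/
def Inst {k : ℕ} (φ : setLang.Formula (Fin k)) (p : Fin k → ℕ) : Fml := fun n =>
  if h : ∀ i, p i < n then
    (FirstOrder.Language.BoundedFormula.relabel (fun i => (Sum.inr ⟨p i, h i⟩ : Empty ⊕ Fin n)) φ :
      setLang.BoundedFormula Empty (n + 0))
  else ⊥

/-- Relativization of a formula to the elements of (the value of) the variable `P`. -/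
def relativize (P : ℕ) : {n : ℕ} → setLang.BoundedFormula Empty n → setLang.BoundedFormula Empty n
  | _, .falsum => .falsum
  | _, .equal s t => .equal s t
  | _, .rel R ts => .rel R ts
  | _, .imp φ ψ => .imp (relativize P φ) (relativize P ψ)
  | n, .all φ => .all (.imp (Mem n P (n + 1)) (relativize P φ))

/-- `P ⊨ F`, i.e. `(P, ∈) ⊨ F`. -/
def Sat (P : ℕ) (F : Fml) : Fml := fun n => relativize P (F n)

/-! ## Basic set-theoretic notions -/

/-- `x = ∅`. -/
def IsEmp (x : ℕ) : Fml := AllIn x fun _ => FBot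

/-- `y = x ∪ {x}`. -/
def IsSucc (y x : ℕ) : Fml :=
  x ∊ y ⋏ (AllIn x fun z => z ∊ y) ⋏ AllIn y fun z => z ∊ x ⋎ z ≐ x

/-- `x` is a transitive set. -/
def IsTrans (x : ℕ) : Fml := AllIn x fun y => AllIn y fun z => z ∊ x

/-- `x` is empty or a successor. -/
def IsZeroOrSucc (x : ℕ) : Fml := IsEmp x ⋎ ExIn x fun y => IsSucc x y

/-- `x ∈ ω`: a transitive set of transitive sets such that it and all of its elements are empty or
successors (in the presence of Foundation these are the natural numbers). -/
def IsNat (x : ℕ) : Fml :=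
  IsTrans x ⋏ (AllIn x fun y => IsTrans y) ⋏ IsZeroOrSucc x ⋏ AllIn x fun y => IsZeroOrSucc y

/-- `w = ω`. -/
def IsOmega (w : ℕ) : Fml :=
  (ExIn w fun x => IsEmp x) ⋏ (AllIn w fun x => ExIn w fun y => IsSucc y x) ⋏
    AllIn w fun x => IsNat x

/-- `x` is the numeral `k`. -/
def IsNum : ℕ → ℕ → Fml
  | 0, x => IsEmp x
  | k + 1, x => ExIn x fun y => IsNum k y ⋏ IsSucc x y

/-- `z = {x, y}`. -/
def IsUPair (z x y : ℕ) : Fml := x ∊ z ⋏ y ∊ z ⋏ AllIn z fun w => w ≐ x ⋎ w ≐ y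

/-- `p = ⟨x, y⟩` (Kuratowski pair). -/
def IsPair (p x y : ℕ) : Fml :=
  (ExIn p fun u => IsUPair u x x) ⋏ (ExIn p fun v => IsUPair v x y) ⋏
    AllIn p fun w => IsUPair w x x ⋎ IsUPair w x y

/-- `⟨x, y⟩ ∈ r`. -/
def PairIn (r x y : ℕ) : Fml := ExIn r fun p => IsPair p x y

/-- `p = ⟨x, y⟩` for some `x`, `y` with `F x y`, with bounded quantifiers. -/
def ExPair (p : ℕ) (F : ℕ → ℕ → Fml) : Fml :=
  ExIn p fun u => ExIn u fun x => ExIn p fun v => ExIn v fun y => IsPair p x y ⋏ F x y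

/-- `⟨i, x⟩ ∈ g` for some `x` with `F x`, with bounded quantifiers. -/
def ExVal (g i : ℕ) (F : ℕ → Fml) : Fml :=
  ExIn g fun q => ExPair q fun j x => j ≐ i ⋏ F x

/-- Universes: transitive sets that contain `ω` as an element. -/
def IsUniverse (P : ℕ) : Fml := IsTrans P ⋏ ExIn P fun w => IsOmega w

/-! ## The theory `KPΠ_N` -/

def axExt : setLang.Sentence :=
  (FAll fun x => FAll fun y => (FAll fun z => z ∊ x ⟷ᶠ z ∊ y) ⟶ᶠ x ≐ y) 0

def axPair : setLang.Sentence :=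
  (FAll fun x => FAll fun y => FEx fun z => x ∊ z ⋏ y ∊ z) 0

def axUnion : setLang.Sentence :=
  (FAll fun x => FEx fun u => AllIn x fun y => AllIn y fun z => z ∊ u) 0

def axInf : setLang.Sentence :=
  (FEx fun w => (ExIn w fun x => IsEmp x) ⋏ AllIn w fun x => ExIn w fun y => IsSucc y x) 0

/-- Separation for `φ(x, p⃗)`. -/
def axSep {k : ℕ} (φ : setLang.Formula (Fin (k + 1))) : setLang.Sentence :=
  (Alls k fun p => FAll fun u => FEx fun z => FAll fun x =>
    x ∊ z ⟷ᶠ x ∊ u ⋏ Inst φ (Fin.cons x p)) 0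

/-- Collection for `φ(x, y, p⃗)`. -/
def axColl {k : ℕ} (φ : setLang.Formula (Fin (k + 2))) : setLang.Sentence :=
  (Alls k fun p => FAll fun u =>
    (AllIn u fun x => FEx fun y => Inst φ (Fin.cons x (Fin.cons y p))) ⟶ᶠ
      FEx fun z => AllIn u fun x => ExIn z fun y => Inst φ (Fin.cons x (Fin.cons y p))) 0

/-- Foundation (`∈`-induction) for `φ(x, p⃗)`. -/
def axFound {k : ℕ} (φ : setLang.Formula (Fin (k + 1))) : setLang.Sentence :=
  (Alls k fun p =>
    (FAll fun x => (AllIn x fun y => Inst φ (Fin.cons y p)) ⟶ᶠ Inst φ (Fin.cons x p)) ⟶ᶠ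
      FAll fun x => Inst φ (Fin.cons x p)) 0

/-- Reflection for `φ(p⃗)`: if it holds, then it holds in some universe containing `p⃗`. -/
def axRefl {k : ℕ} (φ : setLang.Formula (Fin k)) : setLang.Sentence :=
  (Alls k fun p => Inst φ p ⟶ᶠ
    FEx fun z => IsUniverse z ⋏ Conj (List.ofFn fun i => p i ∊ z) ⋏ Sat z (Inst φ p)) 0

/-- `KPΠ_N`: Kripke–Platek set theory with Infinity and the full schema of Foundation, together
with the schema of `Π_N`-reflection. -/
inductive KPPi (N : ℕ) : setLang.Sentence → Prop
  | ext : KPPi N axExt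
  | pair : KPPi N axPair
  | union : KPPi N axUnion
  | inf : KPPi N axInf
  | sep {k : ℕ} (φ : setLang.Formula (Fin (k + 1))) : IsDelta0 φ → KPPi N (axSep φ)
  | coll {k : ℕ} (φ : setLang.Formula (Fin (k + 2))) : IsDelta0 φ → KPPi N (axColl φ)
  | found {k : ℕ} (φ : setLang.Formula (Fin (k + 1))) : KPPi N (axFound φ)
  | refl {k : ℕ} (φ : setLang.Formula (Fin k)) : IsPi N φ → KPPi N (axRefl φ)

/-- The set of axioms of `KPΠ_N` as a first-order theory. -/
def KPPiTheory (N : ℕ) : setLang.Theory := {φ | KPPi N φ}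

/-! ## The universal `Π₂`-formula

Codes of `Δ₀`-formulas (the variables `v_i` are named by sets `i`):
`⟨0, ⟨i, j⟩⟩` for `v_i ∈ v_j`, `⟨1, ⟨i, j⟩⟩` for `v_i = v_j`, `⟨2, ⟨e, e'⟩⟩` for `¬ (e ∧ e')`,
`⟨3, ⟨k, ⟨i, e⟩⟩⟩` for `∃ v_k ∈ v_i, e`.  An assignment is a finite function from names of
variables to sets. -/

/-- `g'` is the assignment `g` with the value at `k` changed to `x`. -/
def IsUpdate (g' g k x : ℕ) : Fml :=
  PairIn g' k x ⋏
    (AllIn g' fun q => IsPair q k x ⋎ (q ∊ g ⋏ ExPair q fun j _ => FNeg (j ≐ k))) ⋏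
    AllIn g fun q => (ExPair q fun j _ => j ≐ k) ⋎ q ∊ g'

/-- `p = ⟨e, g⟩`, where the truth of `e` under `g` follows in one step from the truths in `T` and
the falsities in `F`. -/
def TrueStep (T F p : ℕ) : Fml :=
  ExPair p fun e g => ExPair e fun t d =>
    (IsNum 0 t ⋏ ExPair d fun i j => ExVal g i fun x => ExVal g j fun y => x ∊ y) ⋎
    (IsNum 1 t ⋏ ExPair d fun i j => ExVal g i fun x => ExVal g j fun y => x ≐ y) ⋎
    (IsNum 2 t ⋏ ExPair d fun e₁ e₂ => PairIn F e₁ g ⋎ PairIn F e₂ g) ⋎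
    (IsNum 3 t ⋏ ExPair d fun k d' => ExPair d' fun i e₁ => ExVal g i fun y =>
      ExIn y fun x => ExIn T fun q => ExPair q fun e' g' => e' ≐ e₁ ⋏ IsUpdate g' g k x)

/-- `p = ⟨e, g⟩`, where the falsity of `e` under `g` follows in one step from the truths in `T` and
the falsities in `F`. -/
def FalseStep (T F p : ℕ) : Fml :=
  ExPair p fun e g => ExPair e fun t d =>
    (IsNum 0 t ⋏ ExPair d fun i j => ExVal g i fun x => ExVal g j fun y => FNeg (x ∊ y)) ⋎
    (IsNum 1 t ⋏ ExPair d fun i j => ExVal g i fun x => ExVal g j fun y => FNeg (x ≐ y)) ⋎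
    (IsNum 2 t ⋏ ExPair d fun e₁ e₂ => PairIn T e₁ g ⋏ PairIn T e₂ g) ⋎
    (IsNum 3 t ⋏ ExPair d fun k d' => ExPair d' fun i e₁ => ExVal g i fun y =>
      AllIn y fun x => ExIn F fun q => ExPair q fun e' g' => e' ≐ e₁ ⋏ IsUpdate g' g k x)

/-- `g` is the assignment `{⟨0, c⟩, ⟨1, x⟩, ⟨2, y⟩}`. -/
def IsAssign (g c x y : ℕ) : Fml :=
  (AllIn g fun q => ExPair q fun i z =>
    (IsNum 0 i ⋏ z ≐ c) ⋎ (IsNum 1 i ⋏ z ≐ x) ⋎ (IsNum 2 i ⋏ z ≐ y)) ⋏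
  (ExIn g fun q => ExPair q fun i z => IsNum 0 i ⋏ z ≐ c) ⋏
  (ExIn g fun q => ExPair q fun i z => IsNum 1 i ⋏ z ≐ x) ⋏
  (ExIn g fun q => ExPair q fun i z => IsNum 2 i ⋏ z ≐ y)

/-- The universal `Π₂`-formula `Π₂(b)`: `b = ⟨e, c⟩`, and for all `x` there is `y` such that the
`Δ₀`-formula with code `e` is true at `v₀ = c`, `v₁ = x`, `v₂ = y`.  (Truth: there are sets `T` of
truths and `F` of falsities, all of whose elements are justified in one step.) -/
def UnivPi2 (b : ℕ) : Fml :=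
  FAll fun x => FEx fun y => FEx fun T => FEx fun F => FEx fun g => FEx fun e => FEx fun c =>
    IsPair b e c ⋏ IsAssign g c x y ⋏ PairIn T e g ⋏
      (AllIn T fun p => TrueStep T F p) ⋏ AllIn F fun p => FalseStep T F p

/-! ## The operation `M₂` and its iterations along a relation -/

/-- `P ∈ M₂(𝒳)` for a set `P`: for all `b ∈ P` with `P ⊨ Π₂(b)` there is a universe `Q ∈ 𝒳 ∩ P`
with `b ∈ Q ⊨ Π₂(b)`. -/
def InM2 (X : ℕ → Fml) (P : ℕ) : Fml :=
  AllIn P fun b => Sat P (UnivPi2 b) ⟶ᶠ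
    ExIn P fun Q => IsUniverse Q ⋏ b ∊ Q ⋏ Sat Q (UnivPi2 b) ⋏ X Q

/-- `L ∈ M₂(𝒳)` for the universe of discourse `L`. -/
def LInM2 (X : ℕ → Fml) : Fml :=
  FAll fun b => UnivPi2 b ⟶ᶠ FEx fun Q => IsUniverse Q ⋏ b ∊ Q ⋏ Sat Q (UnivPi2 b) ⋏ X Q

/-- `D` is transitive, and on the universes `P ∈ D` and the `a ∈ P` the relation `H` satisfies the
recursion `⟨P, a⟩ ∈ H ↔ P ∈ ⋂ {M₂({Q | ⟨Q, b⟩ ∈ H}) | b ≺^P a}`. -/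
def IsM2Hierarchy (R : ℕ → ℕ → Fml) (D H : ℕ) : Fml :=
  IsTrans D ⋏ AllIn D fun P => IsUniverse P ⟶ᶠ AllIn P fun a =>
    (PairIn H P a ⟷ᶠ AllIn P fun b => Sat P (R b a) ⟶ᶠ
      InM2 (fun Q => b ∊ Q ⋏ PairIn H Q b) P)

/-- `P ∈ M₂(a; ≺)` for a universe `P` with `a ∈ P`, by `∈`-recursion on `P`:
`P ∈ M₂(a; ≺) ↔ P ∈ ⋂ {M₂(M₂(b; ≺)) | b ≺^P a}`. -/
def InM2Iter (R : ℕ → ℕ → Fml) (a P : ℕ) : Fml :=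
  IsUniverse P ⋏ a ∊ P ⋏
    FEx fun D => FEx fun H => IsM2Hierarchy R D H ⋏ P ∊ D ⋏ PairIn H P a

/-- `L ∈ M₂(a; ≺)`. -/
def LInM2Iter (R : ℕ → ℕ → Fml) (a : ℕ) : Fml :=
  FAll fun b => R b a ⟶ᶠ LInM2 (InM2Iter R b)

/-! ## Relations on `ω`, transfinite induction, wellfounded parts -/

/-- The relation on `ω` defined by the formula `σ(v₀, v₁)`. -/
def Rel (σ : setLang.Formula (Fin 2)) (x y : ℕ) : Fml :=
  IsNat x ⋏ IsNat y ⋏ Inst σ ![x, y]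

/-- The relation `R` is transitive. -/
def Transitivity (R : ℕ → ℕ → Fml) : Fml :=
  FAll fun x => FAll fun y => FAll fun z => R x y ⟶ᶠ R y z ⟶ᶠ R x z

/-- The instance of transfinite induction along `R` up to `a` for the formula `φ(x, p⃗)`:
`∀ p⃗ [∀ x ∈ ω (∀ y ≺ x φ(y) → φ(x)) → ∀ x ≺ a φ(x)]`. -/
def TI {k : ℕ} (R : ℕ → ℕ → Fml) (φ : setLang.Formula (Fin (k + 1))) (a : ℕ) : Fml :=
  Alls k fun p =>
    (FAll fun x => IsNat x ⟶ᶠ (FAll fun y => R y x ⟶ᶠ Inst φ (Fin.cons y p)) ⟶ᶠ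
      Inst φ (Fin.cons x p)) ⟶ᶠ
    FAll fun x => R x a ⟶ᶠ Inst φ (Fin.cons x p)

/-- `f` is a function from `ω` to `ω`. -/
def IsFunOmega (f : ℕ) : Fml :=
  (AllIn f fun p => ExPair p fun n m => IsNat n ⋏ IsNat m) ⋏
    FAll fun n => IsNat n ⟶ᶠ (FEx fun m => PairIn f n m ⋏ FAll fun m' => PairIn f n m' ⟶ᶠ m' ≐ m)

/-- `a ∈ W(R)`, the wellfounded part of the relation `R` on `ω`: for every `f : ω → ω` with
`f(0) = a` there is `n` such that not `R (f (n + 1)) (f n)`. -/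
def InWf (R : ℕ → ℕ → Fml) (a : ℕ) : Fml :=
  IsNat a ⋏ FAll fun f => IsFunOmega f ⋏ (FEx fun z => IsEmp z ⋏ PairIn f z a) ⟶ᶠ
    FEx fun n => FEx fun m => FEx fun u => FEx fun v =>
      IsNat n ⋏ IsSucc m n ⋏ PairIn f n u ⋏ PairIn f m v ⋏ FNeg (R v u)

/-! ## Exponential orderings and towers -/

/-- `s` is a finite sequence of length `l`, i.e. a function with domain `l ∈ ω`. -/
def IsSeq (s l : ℕ) : Fml :=
  IsNat l ⋏ (AllIn s fun p => ExPair p fun n _ => n ∊ l) ⋏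
    AllIn l fun n => FEx fun v => PairIn s n v ⋏ FAll fun v' => PairIn s n v' ⟶ᶠ v' ≐ v

/-- The `n`-th entry of the sequence `s` is the pair `(u, x)`, i.e. the `n`-th summand of `s` is
`π^u x`. -/
def Entry (s n u x : ℕ) : Fml := FEx fun v => IsPair v u x ⋏ PairIn s n v

/-- `s` is a finite sequence of pairs with first components in `D₁`, decreasing with respect to
`R₁`, and with second components in `D₀`. -/
def ExpDom (D₁ : ℕ → Fml) (R₁ : ℕ → ℕ → Fml) (D₀ : ℕ → Fml) (s : ℕ) : Fml :=
  (FEx fun l => IsSeq s l ⋏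
    AllIn l fun n => FEx fun u => FEx fun x => Entry s n u x ⋏ D₁ u ⋏ D₀ x) ⋏
  FAll fun n => FAll fun m => FAll fun u => FAll fun x => FAll fun u' => FAll fun x' =>
    IsSucc m n ⋏ Entry s n u x ⋏ Entry s m u' x' ⟶ᶠ R₁ u' u

/-- The sequences `s` and `t` agree below `k`. -/
def Agree (s t k : ℕ) : Fml :=
  AllIn k fun i => FAll fun v => PairIn s i v ⟷ᶠ PairIn t i v

/-- The exponential ordering `E(R₁, R₀)` of the sequences in `D`: lexicographic with respect to
the lexicographic ordering of pairs, a proper initial segment being smaller. -/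
def ExpLt (D : ℕ → Fml) (R₁ R₀ : ℕ → ℕ → Fml) (s t : ℕ) : Fml :=
  D s ⋏ D t ⋏
    ((FEx fun k => IsNat k ⋏ Agree s t k ⋏
        FEx fun u => FEx fun x => FEx fun u' => FEx fun x' =>
          Entry s k u x ⋏ Entry t k u' x' ⋏ (R₁ u u' ⋎ (u ≐ u' ⋏ R₀ x x'))) ⋎
      FEx fun l => FEx fun l' => IsSeq s l ⋏ IsSeq t l' ⋏ l ∊ l' ⋏ Agree s t l)

/-- The domain of `<_{E_i}` and the relation `<_{E_i}` for `i = N - 1 - h`, where `<_i` is the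
relation on `ω` defined by `σ i`. -/
def Tower (N : ℕ) (σ : ℕ → setLang.Formula (Fin 2)) : ℕ → (ℕ → Fml) × (ℕ → ℕ → Fml)
  | 0 => (IsNat, Rel (σ (N - 1)))
  | h + 1 =>
    (ExpDom (Tower N σ h).1 (Tower N σ h).2 IsNat,
      ExpLt (ExpDom (Tower N σ h).1 (Tower N σ h).2 IsNat) (Tower N σ h).2
        (Rel (σ (N - 1 - (h + 1)))))

/-- The domain of `<_{E_i W}` for `i = N - 1 - h`: second components lie in the wellfounded
parts, hereditarily. -/
def TowerDomW (N : ℕ) (σ : ℕ → setLang.Formula (Fin 2)) : ℕ → ℕ → Fml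
  | 0 => IsNat
  | h + 1 =>
    ExpDom (TowerDomW N σ h)
      (fun s t => (Tower N σ h).2 s t ⋏ TowerDomW N σ h s ⋏ TowerDomW N σ h t)
      (InWf (Rel (σ (N - 1 - (h + 1)))))

/-- The relation `<_{E_i W}` for `i = N - 1 - h`: the restriction of `<_{E_i}` to the domain of
`<_{E_i W}`. -/
def TowerLtW (N : ℕ) (σ : ℕ → setLang.Formula (Fin 2)) (h : ℕ) (s t : ℕ) : Fml :=
  (Tower N σ h).2 s t ⋏ TowerDomW N σ h s ⋏ TowerDomW N σ h t

/-- `α < a` for `a ∈ ω` and `α` in the domain of `<_{E_i}`, `i = N - 1 - h`: all the exponents are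
`< a`, hereditarily, where exponents in `ω` are compared with `a` by `<_{N-1}`. -/
def TowerBelow (N : ℕ) (σ : ℕ → setLang.Formula (Fin 2)) : ℕ → ℕ → ℕ → Fml
  | 0, α, a => Rel (σ (N - 1)) α a
  | h + 1, α, a =>
    (Tower N σ (h + 1)).1 α ⋏
      FAll fun n => FAll fun u => FAll fun x => Entry α n u x ⟶ᶠ TowerBelow N σ h u a

/-- `<_{TW} = <_{E_2 W}`. -/
def LtTW (N : ℕ) (σ : ℕ → setLang.Formula (Fin 2)) : ℕ → ℕ → Fml := TowerLtW N σ (N - 3)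

/-- `α ∈ dom(<_T)` and `α < a`, where `<_T = <_{E_2}`. -/
def BelowT (N : ℕ) (σ : ℕ → setLang.Formula (Fin 2)) : ℕ → ℕ → Fml := TowerBelow N σ (N - 3)

/-- The theory `KPΠ_N` proves `∀ a ∈ ω ∀ α < a [TI(a, <_{N-1}, Π_N) → C(α)]`.  As
`TI(a, <_{N-1}, Π_N)` is a schema, this means that finitely many of its instances suffice. -/
def ProvesFromTI (N : ℕ) (σ : ℕ → setLang.Formula (Fin 2)) (C : ℕ → Fml) : Prop :=
  ∃ Γ : List (Σ k : ℕ, setLang.Formula (Fin (k + 1))),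
    (∀ φ ∈ Γ, IsPi N φ.2) ∧
    KPPiTheory N ⊨ᵇ
      (FAll fun a => IsNat a ⟶ᶠ FAll fun α => BelowT N σ α a ⟶ᶠ
        Conj (Γ.map fun φ => TI (Rel (σ (N - 1))) φ.2 a) ⟶ᶠ C α) 0

end PiRefl

open FirstOrder FirstOrder.Language Set

set_option linter.unusedSimpArgs false
set_option linter.unnecessarySeqFocus false
set_option linter.unusedSectionVars false

namespace PiRefl

/-! ## Realization with quantifiers restricted to a class -/

/-! The argument is carried out inside an arbitrary model of the theory. It trades height of the
ordering against strength of reflection. Keep `h + j = N - 3`. Level `j` consists of a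
`Π_{j+2}`-property `psi` that is to be reflected and a property `base` required of universes.
Reflection of `psi` is iterated along the ordering of height `h`, that is `<_{E_i}` with `i = N - 1
- h`, and `InIter` is membership in an iterate. For `j = 0` this is essentially the iteration of
`M₂` along the whole tower. For `j = N - 3` the ordering is `<_{N-1}` itself, and the statement that
the universe of discourse lies in the iterate with index `u` is `Π_N` (`TopF`). `Π_N`-reflection
makes that statement progressive in `u` (`refl_of_top`, `top_progressive`), so one instance of
transfinite induction yields it for all `u` below `a`. It remains to pass from level `j + 1` at
height `h` to level `j` at height `h + 1`, which is `refl_inIter`.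

For that step, say that `D` handles a sequence `v` below the place `m` if `D` reflects the lower
`psi` into the iterate of every `w` that is smaller than `v` through a difference at a place below
`m`. The property reflected on level `j + 1` contains handledness. Hence, if `D` handles `v` below
`m` and reflects the higher level into the iterate of the exponent `u` of `v` at `m`, then a given
lower `psi` is reflected to some `Q ∈ D` which lies in the higher iterate of `u` and still handles
`v` below `m`. Such a `Q` lies in the lower iterate of `v` (`inIter_of_handled`), because
handledness climbs through the remaining places. Each climb is `handled_succ`. If `Q` did not handle
`v` below `m + 1`, form the coefficients at `m` of all sequences which begin like `v`, have exponent
`u` at `m`, and are not handled by `Q` below `m + 1`. By `progress` they have no minimal element;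
being definable over `Q` they form a set in `D`; and the coefficient of `v` is among them, against
its wellfoundedness in `D`. The next exponent is smaller than `u`, so `Q` lies in its iterate as
well, and the climb continues.

`progress` is an `∈`-induction on `Q`. An unhandled sequence has a smaller `w`, differing at `m`,
into whose iterate `Q` does not reflect. If `w` ends at `m` or has a smaller exponent there, then
`refl_inIter` with `Q` in the role of `D` gives that reflection after all; it needs `progress` only
for elements of `Q`. So `w` has the same exponent and a smaller coefficient. If `w` were handled
below `m + 1`, its next exponent would be smaller than `u` and the same contradiction would arise.
Hence `w` is unhandled and supplies the smaller coefficient.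

To keep complexities low, the argument runs with bounded variants of the towers (`Core`, `DomB`) and
with wellfoundedness expressed by sets without minimal elements. Only one inclusion is needed: the
literal ordering is contained in the bounded one (`ltDom_of_sTowerLtW`), and iterating along a
larger ordering is the stronger requirement (`inM2Tower_of_inIter`). Indices outside the restricted
domain have no predecessors, and this is reflected too (`refl_inM2Tower`). Finally, predecessors of
`α < a` in the bounded ordering again have all exponents below `a` (`expBelow_of_lt`), so the second
assertion yields the first. -/

/-- The assignment `e` changed at `n`. -/
def up {M : Type} (e : ℕ → M) (n : ℕ) (x : M) : ℕ → M := Function.update e n x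

theorem up_self {M : Type} (e : ℕ → M) (n : ℕ) (x : M) : up e n x n = x := by simp [up]

theorem up_lt {M : Type} (e : ℕ → M) {n m : ℕ} (x : M) (h : m < n) : up e n x m = e m := by
  simp [up, h.ne]

section Semantics

variable {M : Type} [setLang.Structure M] {α β : Type}

/-- The membership relation of a structure. -/
def El (x y : M) : Prop := Structure.RelMap memSym ![x, y]

local infix:60 " ε " => El

/-- The class of elements of `P`. -/
def elts (P : M) : Set M := {x | x ε P}

@[simp]
theorem mem_elts {x P : M} : x ∈ elts P ↔ x ε P := Iff.rfl

/-- Realization of a formula with all quantifiers restricted to `D`. -/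
def Rlz (D : Set M) : {n : ℕ} → setLang.BoundedFormula α n → (α → M) → (Fin n → M) → Prop
  | _, .falsum, _, _ => False
  | _, .equal s t, v, xs => s.realize (Sum.elim v xs) = t.realize (Sum.elim v xs)
  | _, .rel R ts, v, xs => Structure.RelMap R fun i => (ts i).realize (Sum.elim v xs)
  | _, .imp φ ψ, v, xs => Rlz D φ v xs → Rlz D ψ v xs
  | _, .all φ, v, xs => ∀ x ∈ D, Rlz D φ v (Fin.snoc xs x)

theorem rlz_univ {n : ℕ} (φ : setLang.BoundedFormula α n) (v : α → M) (xs : Fin n → M) :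
    Rlz univ φ v xs ↔ φ.Realize v xs := by
  induction φ with
  | falsum => rfl
  | equal => rfl
  | rel => rfl
  | imp _ _ ih1 ih2 => simp [Rlz, BoundedFormula.Realize, ih1, ih2]
  | all _ ih => simp [Rlz, BoundedFormula.Realize, ih]

theorem rlz_castLE_of_eq (D : Set M) {m n : ℕ} (h : m = n) (h' : m ≤ n)
    (φ : setLang.BoundedFormula α m) (v : α → M) (xs : Fin n → M) :
    Rlz D (φ.castLE h') v xs ↔ Rlz D φ v (xs ∘ Fin.cast h) := by
  subst h
  simp

theorem rlz_relabel (D : Set M) {m n : ℕ} (φ : setLang.BoundedFormula α n) (g : α → β ⊕ (Fin m))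
    (v : β → M) (xs : Fin (m + n) → M) :
    Rlz D (φ.relabel g) v xs ↔
      Rlz D φ (Sum.elim v (xs ∘ Fin.castAdd n) ∘ g) (xs ∘ Fin.natAdd m) := by
  unfold BoundedFormula.relabel
  induction φ with
  | falsum => rfl
  | equal =>
    simp [BoundedFormula.mapTermRel, Rlz]
  | rel => simp [BoundedFormula.mapTermRel, Rlz]
  | imp _ _ ih1 ih2 => simp only [BoundedFormula.mapTermRel, Rlz, ih1, ih2]
  | @all k φ ih =>
    simp only [BoundedFormula.mapTermRel, Rlz]
    refine forall₂_congr fun x _ => ?_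
    rw [rlz_castLE_of_eq D (add_assoc m k 1).symm, ih]
    refine iff_of_eq (congrArg₂ _ ?_ ?_)
    · refine congrArg₂ _ (congrArg _ ?_) rfl
      funext i
      simp only [Function.comp_apply]
      have : Fin.cast (add_assoc m k 1).symm (Fin.castAdd (k + 1) i) =
        (Fin.castAdd k i).castSucc := rfl
      rw [this, Fin.snoc_castSucc]
    · funext i
      refine Fin.lastCases ?_ (fun i => ?_) i
      · simp
      · have : Fin.cast (add_assoc m k 1).symm (Fin.natAdd m i.castSucc) =
          (Fin.natAdd m i).castSucc := rfl
        simp only [Function.comp_apply, this, Fin.snoc_castSucc]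

/-! ## Evaluation of formulas in every context -/

/-- The truth of `F` in context `n` under the assignment `e`, with quantifiers restricted
to `D`. -/
def Ev (D : Set M) (F : Fml) (n : ℕ) (e : ℕ → M) : Prop :=
  Rlz D (F n) Empty.elim fun i : Fin n => e i

variable (D : Set M) {n : ℕ} (e : ℕ → M)

theorem snoc_env (x : M) :
    (Fin.snoc (fun i : Fin n => e i) x : Fin (n + 1) → M) = fun i : Fin (n + 1) => up e n x i := by
  funext i
  refine Fin.lastCases ?_ (fun i => ?_) i
  · simp [up_self]
  · simp [up_lt]

theorem ev_Mem {x y : ℕ} (hx : x < n) (hy : y < n) : Ev D (Mem x y) n e ↔ e x ε e y := by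
  simp only [Ev, Mem, hx, hy, and_self, dif_pos]
  unfold Relations.boundedFormula₂ Relations.boundedFormula
  simp only [Rlz, El]
  refine iff_of_eq (congrArg _ ?_)
  funext i
  fin_cases i <;> simp

theorem ev_Eqv {x y : ℕ} (hx : x < n) (hy : y < n) : Ev D (Eqv x y) n e ↔ e x = e y := by
  simp only [Ev, Eqv, hx, hy, and_self, dif_pos]
  unfold Term.bdEqual
  simp [Rlz]

theorem ev_Bot : Ev D FBot n e ↔ False := Iff.rfl

theorem ev_Imp (F G : Fml) : Ev D (FImp F G) n e ↔ (Ev D F n e → Ev D G n e) := Iff.rfl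

theorem ev_Neg (F : Fml) : Ev D (FNeg F) n e ↔ ¬ Ev D F n e := Iff.rfl

theorem ev_And (F G : Fml) : Ev D (FAnd F G) n e ↔ (Ev D F n e ∧ Ev D G n e) := by
  change ¬ (Ev D F n e → ¬ Ev D G n e) ↔ _
  tauto

theorem ev_Or (F G : Fml) : Ev D (FOr F G) n e ↔ (Ev D F n e ∨ Ev D G n e) := by
  change (¬ Ev D F n e → Ev D G n e) ↔ _
  tauto

theorem ev_Iff (F G : Fml) : Ev D (FIff F G) n e ↔ (Ev D F n e ↔ Ev D G n e) := by
  change Ev D (FAnd (FImp F G) (FImp G F)) n e ↔ _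
  rw [ev_And, ev_Imp, ev_Imp]
  tauto

theorem ev_All (F : ℕ → Fml) :
    Ev D (FAll F) n e ↔ ∀ x ∈ D, Ev D (F n) (n + 1) (up e n x) := by
  simp only [Ev, FAll, Rlz, snoc_env]

theorem ev_Ex (F : ℕ → Fml) :
    Ev D (FEx F) n e ↔ ∃ x ∈ D, Ev D (F n) (n + 1) (up e n x) := by
  change ¬ Ev D (FAll fun x => FNeg (F x)) n e ↔ _
  rw [ev_All]
  simp only [ev_Neg]
  push Not
  rfl

theorem ev_AllIn {y : ℕ} (hy : y < n) (F : ℕ → Fml) :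
    Ev D (AllIn y F) n e ↔ ∀ x ∈ D, x ε e y → Ev D (F n) (n + 1) (up e n x) := by
  rw [AllIn, ev_All]
  refine forall₂_congr fun x _ => ?_
  rw [ev_Imp, ev_Mem _ _ (by omega) (by omega), up_self, up_lt _ _ hy]

theorem ev_ExIn {y : ℕ} (hy : y < n) (F : ℕ → Fml) :
    Ev D (ExIn y F) n e ↔ ∃ x ∈ D, x ε e y ∧ Ev D (F n) (n + 1) (up e n x) := by
  rw [ExIn, ev_Neg, ev_AllIn _ _ hy]
  simp only [ev_Neg]
  push Not
  rfl

/-- Allowing an arbitrary class `D` as the range of quantifiers makes this an induction on the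
formula and lets satisfaction be nested: satisfaction in `P` inside `D` is truth in the
intersection. -/
theorem rlz_relativize (P : ℕ) {n : ℕ} (hP : P < n) (φ : setLang.BoundedFormula Empty n)
    (xs : Fin n → M) :
    Rlz D (relativize P φ) Empty.elim xs ↔ Rlz (D ∩ elts (xs ⟨P, hP⟩)) φ Empty.elim xs := by
  induction φ with
  | falsum => rfl
  | equal => rfl
  | rel => rfl
  | imp _ _ ih1 ih2 => simp only [relativize, Rlz, ih1 hP, ih2 hP]
  | @all k φ ih =>
    simp only [relativize, Rlz, mem_inter_iff, mem_elts, and_imp]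
    refine forall₂_congr fun x _ => ?_
    rw [ih (by omega)]
    have h1 : (Fin.snoc xs x : Fin (k + 1) → M) ⟨P, by omega⟩ = xs ⟨P, hP⟩ :=
      Fin.snoc_castSucc (α := fun _ => M) (x := x) (p := xs) (i := ⟨P, hP⟩)
    have h2 : (Fin.snoc xs x : Fin (k + 1) → M) ⟨k, by omega⟩ = x :=
      Fin.snoc_last (α := fun _ => M) _ _
    have := ev_Mem D (fun i => if h : i < k + 1 then (Fin.snoc xs x : Fin (k + 1) → M) ⟨i,
      h⟩ else x)
      (n := k + 1) (x := k) (y := P) (by omega) (by omega)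
    simp only [Ev, Fin.is_lt, dite_true, Nat.lt_succ_self, show P < k + 1 by omega, h1, h2] at this
    rw [h1]
    exact imp_congr this Iff.rfl

theorem ev_Sat {P : ℕ} (hP : P < n) (F : Fml) :
    Ev D (Sat P F) n e ↔ Ev (D ∩ elts (e P)) F n e :=
  rlz_relativize D P hP _ _

theorem ev_Inst {k : ℕ} (φ : setLang.Formula (Fin k)) (p : Fin k → ℕ) (hp : ∀ i, p i < n) :
    Ev D (Inst φ p) n e ↔ Rlz D φ (fun i => e (p i)) Fin.elim0 := by
  simp only [Ev, Inst, hp, implies_true, dif_pos]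
  rw [show (Rlz D (BoundedFormula.relabel (n := n)
    (fun i => (Sum.inr ⟨p i, hp i⟩ : Empty ⊕ Fin n)) φ) Empty.elim fun i : Fin n => e i) ↔ _
    from rlz_relabel D φ _ _ _]
  refine iff_of_eq (congrArg₂ _ ?_ ?_)
  · funext i; rfl
  · funext i; exact i.elim0

/-- The assignment with the values `a` at `n, n + 1, …`. -/
def ups (e : ℕ → M) (n k : ℕ) (a : Fin k → M) : ℕ → M := fun i =>
  if h : n ≤ i ∧ i < n + k then a ⟨i - n, by omega⟩ else e i

theorem ev_Alls (k : ℕ) (F : (Fin k → ℕ) → Fml) :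
    Ev D (Alls k F) n e ↔ ∀ a : Fin k → M, (∀ i, a i ∈ D) →
      Ev D (F fun i => n + i) (n + k) (ups e n k a) := by
  induction k generalizing n e with
  | zero =>
    have h1 : ∀ a : Fin 0 → M, ups e n 0 a = e := by
      intro a; funext i; simp only [ups]; rw [dif_neg (by omega)]
    have h2 : (fun i : Fin 0 => n + (i : ℕ)) = Fin.elim0 := by funext i; exact i.elim0
    simp [Alls, h1, h2]
  | succ k ih =>
    simp only [Alls, ev_All, ih]
    constructor
    · intro h a ha
      have := h (a 0) (ha 0) (fun i => a i.succ) (fun i => ha _)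
      convert this using 1
      · congr 1
        funext i
        refine Fin.cases ?_ (fun i => ?_) i
        · simp
        · simp; omega
      · omega
      · funext i
        simp only [ups]
        by_cases h1 : i = n
        · subst h1
          rw [dif_pos (by omega), dif_neg (by omega), up_self]
          congr 1
          exact Fin.ext (by simp)
        · by_cases h2 : n ≤ i ∧ i < n + (k + 1)
          · rw [dif_pos h2, dif_pos (by omega)]
            congr 1
            exact Fin.ext (by simp; omega)
          · rw [dif_neg h2, dif_neg (by omega)]
            simp [up, h1]
    · intro h x hx a ha
      have := h (Fin.cons x a) (by
        intro i
        refine Fin.cases ?_ (fun i => ?_) i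
        · simpa using hx
        · simpa using ha i)
      convert this using 1
      · congr 1
        funext i
        refine Fin.cases ?_ (fun i => ?_) i
        · simp
        · simp; omega
      · omega
      · funext i
        simp only [ups]
        by_cases h1 : i = n
        · subst h1
          rw [dif_neg (by omega), dif_pos (by omega), up_self]
          have : (⟨i - i, by omega⟩ : Fin (k + 1)) = 0 := Fin.ext (by simp)
          rw [this]; simp
        · by_cases h2 : n ≤ i ∧ i < n + (k + 1)
          · rw [dif_pos (by omega), dif_pos h2]
            have : (⟨i - n, by omega⟩ : Fin (k + 1)) = Fin.succ ⟨i - (n + 1), by omega⟩ :=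
              Fin.ext (by simp; omega)
            rw [this]
            exact (Fin.cons_succ (α := fun _ => M) x a _).symm
          · rw [dif_neg (by omega), dif_neg h2]
            simp [up, h1]

theorem ev_Conj (l : List Fml) : Ev D (Conj l) n e ↔ ∀ F ∈ l, Ev D F n e := by
  induction l with
  | nil => simp [Conj, ev_Neg, ev_Bot]
  | cons F l ih =>
    change Ev D (FAnd F (Conj l)) n e ↔ _
    simp [ev_And, ih]

end Semantics

local infix:60 " ε " => El
local infix:60 " ∊ " => Mem
local infix:60 " ≐ " => Eqv
local infixr:50 " ⋏ " => FAnd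
local infixr:45 " ⋎ " => FOr
local infixr:40 " ⟶ᶠ " => FImp
local infix:35 " ⟷ᶠ " => FIff

/-! ## The Lévy hierarchy up to equivalence -/

section Levy

variable {α β : Type} {n : ℕ}

/-- Extension of a renaming of variables under a quantifier. -/
def extendVar {n m : ℕ} (f : α ⊕ Fin n → β ⊕ Fin m) : α ⊕ Fin (n + 1) → β ⊕ Fin (m + 1) :=
  Sum.elim (fun a => Sum.map id Fin.castSucc (f (Sum.inl a)))
    fun i => Fin.lastCases (Sum.inr (Fin.last m)) (fun i => Sum.map id Fin.castSucc (f
      (Sum.inr i))) i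

theorem elim_snoc_castSucc {M : Type} {m : ℕ} (v : β → M) (xs : Fin m → M) (x : M)
    (z : β ⊕ Fin m) :
    Sum.elim v (Fin.snoc xs x : Fin (m + 1) → M) (Sum.map id Fin.castSucc z) = Sum.elim v xs z := by
  cases z <;> simp

theorem elim_extendVar_inl {M : Type} {n m : ℕ} (f : α ⊕ Fin n → β ⊕ Fin m) (v : β → M)
    (xs : Fin m → M) (x : M) :
    (fun a => Sum.elim v (Fin.snoc xs x : Fin (m + 1) → M) (extendVar f (Sum.inl a))) =
      fun a => Sum.elim v xs (f (Sum.inl a)) := by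
  funext a
  simp [extendVar, elim_snoc_castSucc]

theorem elim_extendVar_inr {M : Type} {n m : ℕ} (f : α ⊕ Fin n → β ⊕ Fin m) (v : β → M)
    (xs : Fin m → M) (x : M) :
    (fun i => Sum.elim v (Fin.snoc xs x : Fin (m + 1) → M) (extendVar f (Sum.inr i))) =
      Fin.snoc (fun i => Sum.elim v xs (f (Sum.inr i))) x := by
  funext i
  refine Fin.lastCases ?_ (fun i => ?_) i
  · simp [extendVar]
  · simp [extendVar, elim_snoc_castSucc]

/-- `ψ` is equivalent to `φ` with its variables renamed by `f`. -/
def Renames {m : ℕ} (f : α ⊕ Fin n → β ⊕ Fin m) (φ : setLang.BoundedFormula α n)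
    (ψ : setLang.BoundedFormula β m) : Prop :=
  ∀ (M : Type) [setLang.Structure M] (D : Set M) (v : β → M) (xs : Fin m → M),
    Rlz D ψ v xs ↔
      Rlz D φ (fun a => Sum.elim v xs (f (Sum.inl a))) (fun i => Sum.elim v xs (f (Sum.inr i)))

theorem Renames.all {m : ℕ} {f : α ⊕ Fin n → β ⊕ Fin m} {φ : setLang.BoundedFormula α (n + 1)}
    {ψ : setLang.BoundedFormula β (m + 1)} (h : Renames (extendVar f) φ ψ) :
    Renames f φ.all ψ.all := by
  intro M _ D v xs
  simp only [Rlz]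
  refine forall₂_congr fun x _ => ?_
  rw [h, elim_extendVar_inl, elim_extendVar_inr]

theorem Renames.imp {m : ℕ} {f : α ⊕ Fin n → β ⊕ Fin m} {φ φ' : setLang.BoundedFormula α n}
    {ψ ψ' : setLang.BoundedFormula β m} (h : Renames f φ ψ) (h' : Renames f φ' ψ') :
    Renames f (φ.imp φ') (ψ.imp ψ') := by
  intro M _ D v xs
  simp only [Rlz]
  rw [h, h']

theorem rlz_memSym {M : Type} [setLang.Structure M] (D : Set M) (v : α → M) (xs : Fin n → M)
    (a b : α ⊕ Fin n) :
    Rlz D (memSym.boundedFormula₂ (Term.var a) (Term.var b)) v xs ↔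
      El (Sum.elim v xs a) (Sum.elim v xs b) := by
  unfold Relations.boundedFormula₂ Relations.boundedFormula
  simp only [Rlz, El]
  refine iff_of_eq (congrArg _ ?_)
  funext i
  fin_cases i <;> simp

/-- The axiom schemas take formulas with free variables in `Fin k`, while the formulas written here
have named bound variables. Renaming passes between the two formats without leaving a class of the
hierarchy. -/
theorem IsDelta0.rename {φ : setLang.BoundedFormula α n} (h : IsDelta0 φ) :
    ∀ {m : ℕ} (f : α ⊕ Fin n → β ⊕ Fin m),
      ∃ ψ : setLang.BoundedFormula β m, IsDelta0 ψ ∧ Renames f φ ψ := by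
  have key : ∀ {M : Type} {n m : ℕ} (f : α ⊕ Fin n → β ⊕ Fin m) (v : β → M) (xs : Fin m → M),
      Sum.elim v xs ∘ f = Sum.elim (fun a => Sum.elim v xs (f (Sum.inl a)))
        (fun i => Sum.elim v xs (f (Sum.inr i))) := by
    intro M n m f v xs
    funext z; cases z <;> rfl
  induction h with
  | falsum => exact fun f => ⟨_, .falsum, fun _ _ _ _ _ => Iff.rfl⟩
  | equal s t =>
    intro m f
    refine ⟨_, .equal (s.relabel f) (t.relabel f), fun M _ D v xs => ?_⟩
    simp only [Rlz, Term.realize_relabel, key]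
  | rel R ts =>
    intro m f
    refine ⟨_, .rel R (fun i => (ts i).relabel f), fun M _ D v xs => ?_⟩
    simp only [Rlz, Term.realize_relabel, key]
  | imp _ _ ih1 ih2 =>
    intro m f
    obtain ⟨ψ₁, h₁, h₁'⟩ := ih1 f
    obtain ⟨ψ₂, h₂, h₂'⟩ := ih2 f
    exact ⟨_, .imp h₁ h₂, h₁'.imp h₂'⟩
  | ball z _ ih =>
    intro m f
    obtain ⟨ψ, h, h'⟩ := ih (extendVar f)
    refine ⟨_, .ball (f z) h, Renames.all (Renames.imp ?_ h')⟩
    intro M _ D v xs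
    simp only [rlz_memSym]
    refine iff_of_eq (congrArg₂ _ ?_ ?_)
    · simp [extendVar]
    · cases z <;> simp [extendVar]

theorem IsLevy.rename {s : Side} {k : ℕ} {φ : setLang.BoundedFormula α n} (h : IsLevy s k φ) :
    ∀ {m : ℕ} (f : α ⊕ Fin n → β ⊕ Fin m),
      ∃ ψ : setLang.BoundedFormula β m, IsLevy s k ψ ∧ Renames f φ ψ := by
  induction h with
  | delta0 s h =>
    intro m f
    obtain ⟨ψ, h, h'⟩ := h.rename f
    exact ⟨ψ, .delta0 s h, h'⟩
  | raise _ ih =>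
    intro m f
    obtain ⟨ψ, h, h'⟩ := ih f
    exact ⟨ψ, .raise h, h'⟩
  | ex _ ih =>
    intro m f
    obtain ⟨ψ, h, h'⟩ := ih (extendVar f)
    refine ⟨_, .ex h, ?_⟩
    have hb : Renames (extendVar f) BoundedFormula.falsum BoundedFormula.falsum :=
      fun _ _ _ _ _ => Iff.rfl
    have hb' : Renames f BoundedFormula.falsum BoundedFormula.falsum :=
      fun _ _ _ _ _ => Iff.rfl
    exact (Renames.all (h'.imp hb)).imp hb'
  | all _ ih =>
    intro m f
    obtain ⟨ψ, h, h'⟩ := ih (extendVar f)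
    exact ⟨_, .all h, h'.all⟩

/-- Equivalence with respect to all nonempty classes. -/
def Equivalent (φ ψ : setLang.BoundedFormula α n) : Prop :=
  ∀ (M : Type) [setLang.Structure M] (D : Set M), D.Nonempty → ∀ (v : α → M) (xs : Fin n → M),
    Rlz D φ v xs ↔ Rlz D ψ v xs

/-- `φ` is equivalent to a formula in the class `s k` of the Lévy hierarchy. -/
def HasLevy (s : Side) (k : ℕ) (φ : setLang.BoundedFormula α n) : Prop :=
  ∃ ψ, IsLevy s k ψ ∧ Equivalent ψ φ

theorem HasLevy.congr {s : Side} {k : ℕ} {φ ψ : setLang.BoundedFormula α n} (h : HasLevy s k φ)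
    (e : Equivalent φ ψ) : HasLevy s k ψ :=
  let ⟨χ, hχ, e'⟩ := h
  ⟨χ, hχ, fun M _ D hD v xs => (e' M D hD v xs).trans (e M D hD v xs)⟩

theorem IsDelta0.isLevy {φ : setLang.BoundedFormula α n} (h : IsDelta0 φ) (s : Side) (k : ℕ) :
    IsLevy s k φ := by
  induction k generalizing s with
  | zero => exact .delta0 s h
  | succ k ih => cases s with
    | sigma => exact .raise (ih .pi)
    | pi => exact .raise (ih .sigma)

theorem IsDelta0.hasLevy {φ : setLang.BoundedFormula α n} (h : IsDelta0 φ) (s : Side) (k : ℕ) :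
    HasLevy s k φ :=
  ⟨φ, h.isLevy s k, fun _ _ _ _ _ _ => Iff.rfl⟩

theorem IsLevy.succ {s : Side} {k : ℕ} {φ : setLang.BoundedFormula α n} (h : IsLevy s k φ) :
    IsLevy s (k + 1) φ := by
  induction h with
  | delta0 s h => exact h.isLevy _ _
  | raise _ ih => exact .raise ih
  | ex _ ih => exact .ex ih
  | all _ ih => exact .all ih

theorem IsLevy.lt {s t : Side} {k l : ℕ} {φ : setLang.BoundedFormula α n} (h : IsLevy s k φ)
    (hkl : k < l) : IsLevy t l φ := by
  induction l with
  | zero => omega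
  | succ l ih =>
    rcases Nat.lt_succ_iff_lt_or_eq.1 hkl with h' | rfl
    · exact (ih h').succ
    · by_cases hst : s = t
      · subst hst; exact h.succ
      · have : t = s.dual := by cases s <;> cases t <;> first | rfl | exact absurd rfl hst
        rw [this]; exact .raise h

theorem HasLevy.lt {s t : Side} {k l : ℕ} {φ : setLang.BoundedFormula α n} (h : HasLevy s k φ)
    (hkl : k < l) : HasLevy t l φ :=
  let ⟨ψ, hψ, e⟩ := h
  ⟨ψ, hψ.lt hkl, e⟩

theorem HasLevy.le {s : Side} {k l : ℕ} {φ : setLang.BoundedFormula α n} (h : HasLevy s k φ)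
    (hkl : k ≤ l) : HasLevy s l φ := by
  rcases hkl.lt_or_eq with h' | rfl
  · exact h.lt h'
  · exact h

theorem HasLevy.all {k : ℕ} {φ : setLang.BoundedFormula α (n + 1)} (h : HasLevy .pi (k + 1) φ) :
    HasLevy .pi (k + 1) φ.all := by
  obtain ⟨ψ, hψ, e⟩ := h
  exact ⟨_, .all hψ, fun M _ D hD v xs => forall₂_congr fun x _ => e M D hD _ _⟩

theorem rlz_ex {M : Type} [setLang.Structure M] (D : Set M) (φ : setLang.BoundedFormula α (n + 1))
    (v : α → M) (xs : Fin n → M) :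
    Rlz D φ.ex v xs ↔ ∃ x ∈ D, Rlz D φ v (Fin.snoc xs x) := by
  change ¬ (∀ x ∈ D, ¬ _) ↔ _
  push Not
  rfl

theorem rlz_inf {M : Type} [setLang.Structure M] (D : Set M) (φ ψ : setLang.BoundedFormula α n)
    (v : α → M) (xs : Fin n → M) :
    Rlz D (φ ⊓ ψ) v xs ↔ Rlz D φ v xs ∧ Rlz D ψ v xs := by
  change ¬ (Rlz D φ v xs → ¬ Rlz D ψ v xs) ↔ _
  tauto

theorem HasLevy.ex {k : ℕ} {φ : setLang.BoundedFormula α (n + 1)} (h : HasLevy .sigma (k + 1) φ) :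
    HasLevy .sigma (k + 1) φ.ex := by
  obtain ⟨ψ, hψ, e⟩ := h
  refine ⟨_, .ex hψ, fun M _ D hD v xs => ?_⟩
  rw [rlz_ex, rlz_ex]
  exact exists_congr fun x => and_congr Iff.rfl (e M D hD _ _)

theorem IsLevy.not {s : Side} {k : ℕ} {φ : setLang.BoundedFormula α n} (h : IsLevy s k φ) :
    HasLevy s.dual k φ.not := by
  induction h with
  | delta0 s h => exact IsDelta0.hasLevy (.imp h .falsum) _ _
  | raise _ ih =>
    obtain ⟨ψ, hψ, e⟩ := ih
    exact ⟨ψ, .raise hψ, e⟩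
  | ex _ ih =>
    refine (HasLevy.all ih).congr fun M _ D _ v xs => ?_
    change (∀ x ∈ D, ¬ _) ↔ ¬ _
    rw [rlz_ex]
    push Not
    rfl
  | all _ ih =>
    refine (HasLevy.ex ih).congr fun M _ D _ v xs => ?_
    rw [rlz_ex]
    change (∃ x ∈ D, ¬ _) ↔ ¬ (∀ x ∈ D, _)
    push Not
    rfl

theorem HasLevy.not {s : Side} {k : ℕ} {φ : setLang.BoundedFormula α n} (h : HasLevy s k φ) :
    HasLevy s.dual k φ.not := by
  obtain ⟨ψ, hψ, e⟩ := h
  exact hψ.not.congr fun M _ D hD v xs => not_congr (e M D hD v xs)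

theorem HasLevy.weaken {s : Side} {k : ℕ} {φ : setLang.BoundedFormula α n} (h : HasLevy s k φ) :
    ∃ ψ : setLang.BoundedFormula α (n + 1), IsLevy s k ψ ∧
      ∀ (M : Type) [setLang.Structure M] (D : Set M), D.Nonempty →
        ∀ (v : α → M) (xs : Fin n → M) (x : M),
          Rlz D ψ v (Fin.snoc xs x) ↔ Rlz D φ v xs := by
  obtain ⟨φ', hφ', e⟩ := h
  obtain ⟨ψ, hψ, hr⟩ := hφ'.rename (β := α) (m := n + 1) (Sum.map id Fin.castSucc)
  refine ⟨ψ, hψ, fun M _ D hD v xs x => ?_⟩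
  rw [hr, ← e M D hD]
  simp

/-- One prenexing step: the universal quantifier of the first conjunct is pulled out, and the second
conjunct is weakened to the longer context. -/
theorem HasLevy.all_inf {t : Side} {k l : ℕ} {φ : setLang.BoundedFormula α (n + 1)}
    {χ : setLang.BoundedFormula α n} (hχ : HasLevy t l χ)
    (ih : ∀ {ψ : setLang.BoundedFormula α (n + 1)}, HasLevy t l ψ →
      HasLevy .pi (k + 1) (φ ⊓ ψ)) : HasLevy .pi (k + 1) (φ.all ⊓ χ) := by
  obtain ⟨ψ, hψ, e⟩ := hχ.weaken
  refine (ih ⟨ψ, hψ, fun _ _ _ _ _ _ => Iff.rfl⟩).all.congr fun M _ D hD v xs => ?_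
  simp only [rlz_inf, Rlz, e M D hD]
  -- An instance of the pulled-out quantifier is needed to recover `χ`; this is why equivalence
  -- refers to nonempty classes only.
  obtain ⟨d, hd⟩ := hD
  exact ⟨fun h => ⟨fun x hx => (h x hx).1, (h d hd).2⟩, fun h x hx => ⟨h.1 x hx, h.2⟩⟩

theorem HasLevy.ex_inf {t : Side} {k l : ℕ} {φ : setLang.BoundedFormula α (n + 1)}
    {χ : setLang.BoundedFormula α n} (hχ : HasLevy t l χ)
    (ih : ∀ {ψ : setLang.BoundedFormula α (n + 1)}, HasLevy t l ψ →
      HasLevy .sigma (k + 1) (φ ⊓ ψ)) : HasLevy .sigma (k + 1) (φ.ex ⊓ χ) := by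
  obtain ⟨ψ, hψ, e⟩ := hχ.weaken
  refine (ih ⟨ψ, hψ, fun _ _ _ _ _ _ => Iff.rfl⟩).ex.congr fun M _ D hD v xs => ?_
  simp only [rlz_inf, rlz_ex, e M D hD]
  exact ⟨fun ⟨x, hx, h⟩ => ⟨⟨x, hx, h.1⟩, h.2⟩, fun ⟨⟨x, hx, h⟩, h'⟩ => ⟨x, hx, h, h'⟩⟩

theorem inf_comm_equivalent (φ ψ : setLang.BoundedFormula α n) : Equivalent (φ ⊓ ψ) (ψ ⊓ φ) := by
  intro M _ D _ v xs
  simp only [rlz_inf, and_comm]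

/-- Nested inductions: strip the leading block of the first conjunct, then that of the second. When
both are exhausted, the two formulas have level `k` on the dual side and the outer induction
applies. The two blocks end up concatenated, which the definition of the hierarchy permits. -/
theorem HasLevy.inf_of_eq {k : ℕ} : ∀ {s : Side} {n : ℕ} {φ ψ : setLang.BoundedFormula α n},
    HasLevy s k φ → HasLevy s k ψ → HasLevy s k (φ ⊓ ψ) := by
  induction k with
  | zero =>
    intro s n φ ψ ⟨φ', h, e⟩ ⟨ψ', h', e'⟩
    have hd : ∀ {χ : setLang.BoundedFormula α n}, IsLevy s 0 χ → IsDelta0 χ := by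
      intro χ h; cases h; assumption
    refine HasLevy.congr (IsDelta0.hasLevy (φ := φ' ⊓ ψ') ?_ s 0) fun M _ D hD v xs => ?_
    · exact .imp (.imp (hd h) (.imp (hd h') .falsum)) .falsum
    · simp only [rlz_inf, e M D hD, e' M D hD]
  | succ k ihk =>
    intro s n φ ψ ⟨φ', h, e⟩ ⟨ψ', h', e'⟩
    suffices H : ∀ {s : Side} {l n : ℕ} {φ : setLang.BoundedFormula α n}, IsLevy s l φ → l = k + 1 →
        ∀ {ψ : setLang.BoundedFormula α n}, HasLevy s (k + 1) ψ → HasLevy s (k + 1) (φ ⊓ ψ) from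
      (H h rfl ⟨ψ', h', e'⟩).congr fun M _ D hD v xs => by simp only [rlz_inf, e M D hD]
    clear h h' e e' φ ψ φ' ψ'
    intro s l n φ h hl
    induction h with
    | delta0 => omega
    | @raise s l n φ h _ =>
      obtain rfl : l = k := by omega
      -- The block of the first conjunct is used up; now the same is done for the second one.
      suffices H : ∀ {t : Side} {m n : ℕ} {ψ : setLang.BoundedFormula α n}, IsLevy t m ψ →
          m = l + 1 → t = s.dual → ∀ {φ : setLang.BoundedFormula α n}, HasLevy s l φ →
          HasLevy s.dual (l + 1) (ψ ⊓ φ) by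
        intro ψ ⟨ψ', h', e'⟩
        refine ((H h' rfl rfl ⟨φ, h, fun _ _ _ _ _ _ => Iff.rfl⟩).congr
          (inf_comm_equivalent _ _)).congr fun M _ D hD v xs => by simp only [rlz_inf, e' M D hD]
      intro t m n ψ h'
      induction h' with
      | delta0 => intro; omega
      | @raise t m n ψ h' _ =>
        intro hm ht χ hχ
        obtain rfl : m = l := by omega
        have : t = s := by cases s <;> cases t <;> simp_all [Side.dual]
        subst this
        obtain ⟨θ, hθ, e⟩ := ihk ⟨ψ, h', fun _ _ _ _ _ _ => Iff.rfl⟩ hχ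
        exact ⟨θ, .raise hθ, e⟩
      | @ex m n ψ h' ih =>
        intro hm ht χ hχ
        obtain rfl : m = l := by omega
        rw [← ht] at ih ⊢
        exact hχ.ex_inf fun {θ} hθ => ih rfl rfl hθ
      | @all m n ψ h' ih =>
        intro hm ht χ hχ
        obtain rfl : m = l := by omega
        rw [← ht] at ih ⊢
        exact hχ.all_inf fun {θ} hθ => ih rfl rfl hθ
    | @ex l n φ h ih =>
      intro ψ hψ
      obtain rfl : l = k := by omega
      exact hψ.ex_inf fun hθ => ih rfl hθ
    | @all l n φ h ih =>
      intro ψ hψ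
      obtain rfl : l = k := by omega
      exact hψ.all_inf fun hθ => ih rfl hθ

theorem HasLevy.inf {s : Side} {k : ℕ} {φ ψ : setLang.BoundedFormula α n}
    (h : HasLevy s k φ) (h' : HasLevy s k ψ) : HasLevy s k (φ ⊓ ψ) :=
  h.inf_of_eq h'

theorem Side.dual_dual (s : Side) : s.dual.dual = s := by cases s <;> rfl

theorem HasLevy.imp {s : Side} {k : ℕ} {φ ψ : setLang.BoundedFormula α n}
    (h : HasLevy s.dual k φ) (h' : HasLevy s k ψ) : HasLevy s k (φ.imp ψ) := by
  have := (h.inf h'.not).not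
  rw [Side.dual_dual] at this
  refine this.congr fun M _ D _ v xs => ?_
  change ¬ _ ↔ _
  rw [rlz_inf]
  change ¬ (_ ∧ ¬ _) ↔ (_ → _)
  tauto

end Levy

/-! ## Complexity of formulas in every context -/

section Complexity

variable {n : ℕ}

theorem d0_Mem (x y : ℕ) : IsDelta0 (Mem x y n) := by
  unfold Mem
  split_ifs
  · exact .rel _ _
  · exact .falsum

theorem d0_Eqv (x y : ℕ) : IsDelta0 (Eqv x y n) := by
  unfold Eqv
  split_ifs
  · exact .equal _ _
  · exact .falsum

theorem d0_Bot : IsDelta0 (FBot n) := .falsum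

theorem d0_Imp {F G : Fml} (hF : IsDelta0 (F n)) (hG : IsDelta0 (G n)) :
    IsDelta0 (FImp F G n) := .imp hF hG

theorem d0_Neg {F : Fml} (hF : IsDelta0 (F n)) : IsDelta0 (FNeg F n) := .imp hF .falsum

theorem d0_And {F G : Fml} (hF : IsDelta0 (F n)) (hG : IsDelta0 (G n)) :
    IsDelta0 (FAnd F G n) := .imp (.imp hF (.imp hG .falsum)) .falsum

theorem d0_Or {F G : Fml} (hF : IsDelta0 (F n)) (hG : IsDelta0 (G n)) :
    IsDelta0 (FOr F G n) := .imp (.imp hF .falsum) hG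

theorem d0_Iff {F G : Fml} (hF : IsDelta0 (F n)) (hG : IsDelta0 (G n)) :
    IsDelta0 (FIff F G n) := d0_And (d0_Imp hF hG) (d0_Imp hG hF)

theorem d0_ball {y : ℕ} {φ : setLang.BoundedFormula Empty (n + 1)} (hy : y < n)
    (hF : IsDelta0 φ) : IsDelta0 ((Mem n y (n + 1)).imp φ).all := by
  have : Mem n y (n + 1) = memSym.boundedFormula₂ (Term.var (Sum.inr (Fin.last n)))
      (Term.var (Sum.map id Fin.castSucc (Sum.inr ⟨y, hy⟩ : Empty ⊕ Fin n))) := by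
    rw [Mem, dif_pos (by omega)]
    rfl
  rw [this]
  exact .ball (Sum.inr ⟨y, hy⟩) hF

theorem d0_AllIn {y : ℕ} {F : ℕ → Fml} (hy : y < n) (hF : IsDelta0 (F n (n + 1))) :
    IsDelta0 (AllIn y F n) := d0_ball hy hF

theorem d0_ExIn {y : ℕ} {F : ℕ → Fml} (hy : y < n) (hF : IsDelta0 (F n (n + 1))) :
    IsDelta0 (ExIn y F n) := d0_Neg (d0_AllIn hy (d0_Neg hF))

theorem d0_relativize {P : ℕ} (hP : P < n) (φ : setLang.BoundedFormula Empty n) :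
    IsDelta0 (relativize P φ) := by
  induction φ with
  | falsum => exact .falsum
  | equal => exact .equal _ _
  | rel => exact .rel _ _
  | imp _ _ ih1 ih2 => exact .imp (ih1 hP) (ih2 hP)
  | all φ ih => exact d0_ball hP (ih (by omega))

theorem d0_Sat {P : ℕ} (hP : P < n) (F : Fml) : IsDelta0 (Sat P F n) := d0_relativize hP _

theorem d0_IsEmp {x : ℕ} (hx : x < n) : IsDelta0 (IsEmp x n) := d0_AllIn hx d0_Bot

theorem d0_IsSucc {y x : ℕ} (hy : y < n) (hx : x < n) : IsDelta0 (IsSucc y x n) :=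
  d0_And (d0_Mem _ _) (d0_And (d0_AllIn hx (d0_Mem _ _))
    (d0_AllIn hy (d0_Or (d0_Mem _ _) (d0_Eqv _ _))))

theorem d0_IsTrans {x : ℕ} (hx : x < n) : IsDelta0 (IsTrans x n) :=
  d0_AllIn hx (d0_AllIn (by omega) (d0_Mem _ _))

theorem d0_IsZeroOrSucc {x : ℕ} (hx : x < n) : IsDelta0 (IsZeroOrSucc x n) :=
  d0_Or (d0_IsEmp hx) (d0_ExIn hx (d0_IsSucc (by omega) (by omega)))

theorem d0_IsNat {x : ℕ} (hx : x < n) : IsDelta0 (IsNat x n) :=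
  d0_And (d0_IsTrans hx) (d0_And (d0_AllIn hx (d0_IsTrans (by omega)))
    (d0_And (d0_IsZeroOrSucc hx) (d0_AllIn hx (d0_IsZeroOrSucc (by omega)))))

theorem d0_IsOmega {w : ℕ} (hw : w < n) : IsDelta0 (IsOmega w n) :=
  d0_And (d0_ExIn hw (d0_IsEmp (by omega)))
    (d0_And (d0_AllIn hw (d0_ExIn (by omega) (d0_IsSucc (by omega) (by omega))))
      (d0_AllIn hw (d0_IsNat (by omega))))

theorem d0_IsUniverse {P : ℕ} (hP : P < n) : IsDelta0 (IsUniverse P n) :=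
  d0_And (d0_IsTrans hP) (d0_ExIn hP (d0_IsOmega (by omega)))

theorem d0_IsNum (k : ℕ) {n x : ℕ} (hx : x < n) : IsDelta0 (IsNum k x n) := by
  induction k generalizing n x with
  | zero => exact d0_IsEmp hx
  | succ k ih => exact d0_ExIn hx (d0_And (ih (by omega)) (d0_IsSucc (by omega) (by omega)))

theorem d0_IsUPair {z x y : ℕ} (hz : z < n) : IsDelta0 (IsUPair z x y n) :=
  d0_And (d0_Mem _ _) (d0_And (d0_Mem _ _) (d0_AllIn hz (d0_Or (d0_Eqv _ _) (d0_Eqv _ _))))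

theorem d0_IsPair {p x y : ℕ} (hp : p < n) : IsDelta0 (IsPair p x y n) :=
  d0_And (d0_ExIn hp (d0_IsUPair (by omega))) (d0_And (d0_ExIn hp (d0_IsUPair (by omega)))
    (d0_AllIn hp (d0_Or (d0_IsUPair (by omega)) (d0_IsUPair (by omega)))))

theorem d0_PairIn {r x y : ℕ} (hr : r < n) : IsDelta0 (PairIn r x y n) :=
  d0_ExIn hr (d0_IsPair (by omega))

theorem d0_ExPair {p : ℕ} {F : ℕ → ℕ → Fml} (hp : p < n)
    (hF : IsDelta0 (F (n + 1) (n + 3) (n + 4))) : IsDelta0 (ExPair p F n) :=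
  d0_ExIn hp (d0_ExIn (by omega) (d0_ExIn (by omega) (d0_ExIn (by omega)
    (d0_And (d0_IsPair (by omega)) hF))))

theorem d0_ExVal {g i : ℕ} {F : ℕ → Fml} (hg : g < n) (hF : IsDelta0 (F (n + 4) (n + 5))) :
    IsDelta0 (ExVal g i F n) :=
  d0_ExIn hg (d0_ExPair (by omega) (d0_And (d0_Eqv _ _) hF))

theorem d0_IsUpdate {g' g k x : ℕ} (hg' : g' < n) (hg : g < n) : IsDelta0 (IsUpdate g' g k x n) :=
  d0_And (d0_PairIn hg') (d0_And
    (d0_AllIn hg' (d0_Or (d0_IsPair (by omega)) (d0_And (d0_Mem _ _)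
      (d0_ExPair (by omega) (d0_Neg (d0_Eqv _ _))))))
    (d0_AllIn hg (d0_Or (d0_ExPair (by omega) (d0_Eqv _ _)) (d0_Mem _ _))))

theorem d0_TrueStep {T F p : ℕ} (hT : T < n) (hF : F < n) (hp : p < n) :
    IsDelta0 (TrueStep T F p n) := by
  refine d0_ExPair hp (d0_ExPair (by omega) (d0_Or (d0_And (d0_IsNum _ (by omega)) ?_)
    (d0_Or (d0_And (d0_IsNum _ (by omega)) ?_) (d0_Or (d0_And (d0_IsNum _ (by omega)) ?_)
      (d0_And (d0_IsNum _ (by omega)) ?_)))))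
  · exact d0_ExPair (by omega) (d0_ExVal (by omega) (d0_ExVal (by omega) (d0_Mem _ _)))
  · exact d0_ExPair (by omega) (d0_ExVal (by omega) (d0_ExVal (by omega) (d0_Eqv _ _)))
  · exact d0_ExPair (by omega) (d0_Or (d0_PairIn (by omega)) (d0_PairIn (by omega)))
  · exact d0_ExPair (by omega) (d0_ExPair (by omega) (d0_ExVal (by omega) (d0_ExIn (by omega)
      (d0_ExIn (by omega) (d0_ExPair (by omega) (d0_And (d0_Eqv _ _)
        (d0_IsUpdate (by omega) (by omega))))))))

theorem d0_FalseStep {T F p : ℕ} (hT : T < n) (hF : F < n) (hp : p < n) :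
    IsDelta0 (FalseStep T F p n) := by
  refine d0_ExPair hp (d0_ExPair (by omega) (d0_Or (d0_And (d0_IsNum _ (by omega)) ?_)
    (d0_Or (d0_And (d0_IsNum _ (by omega)) ?_) (d0_Or (d0_And (d0_IsNum _ (by omega)) ?_)
      (d0_And (d0_IsNum _ (by omega)) ?_)))))
  · exact d0_ExPair (by omega) (d0_ExVal (by omega) (d0_ExVal (by omega) (d0_Neg (d0_Mem _ _))))
  · exact d0_ExPair (by omega) (d0_ExVal (by omega) (d0_ExVal (by omega) (d0_Neg (d0_Eqv _ _))))
  · exact d0_ExPair (by omega) (d0_And (d0_PairIn (by omega)) (d0_PairIn (by omega)))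
  · exact d0_ExPair (by omega) (d0_ExPair (by omega) (d0_ExVal (by omega) (d0_AllIn (by omega)
      (d0_ExIn (by omega) (d0_ExPair (by omega) (d0_And (d0_Eqv _ _)
        (d0_IsUpdate (by omega) (by omega))))))))

theorem d0_IsAssign {g c x y : ℕ} (hg : g < n) : IsDelta0 (IsAssign g c x y n) := by
  have h : ∀ {k i z c m : ℕ}, i < m → IsDelta0 (FAnd (IsNum k i) (Eqv z c) m) := fun hi =>
    d0_And (d0_IsNum _ hi) (d0_Eqv _ _)
  exact d0_And (d0_AllIn hg (d0_ExPair (by omega) (d0_Or (h (by omega))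
    (d0_Or (h (by omega)) (h (by omega)))))) (d0_And (d0_ExIn hg (d0_ExPair (by omega) (h
      (by omega))))
    (d0_And (d0_ExIn hg (d0_ExPair (by omega) (h (by omega))))
      (d0_ExIn hg (d0_ExPair (by omega) (h (by omega))))))

theorem hl_All {F : ℕ → Fml} {k : ℕ} (hF : HasLevy .pi (k + 1) (F n (n + 1))) :
    HasLevy .pi (k + 1) (FAll F n) := hF.all

theorem hl_Ex {F : ℕ → Fml} {k : ℕ} (hF : HasLevy .sigma (k + 1) (F n (n + 1))) :
    HasLevy .sigma (k + 1) (FEx F n) := hF.ex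

theorem hl_And {F G : Fml} {s : Side} {k : ℕ} (hF : HasLevy s k (F n)) (hG : HasLevy s k (G n)) :
    HasLevy s k (FAnd F G n) := hF.inf hG

theorem hl_Imp {F G : Fml} {s : Side} {k : ℕ} (hF : HasLevy s.dual k (F n))
    (hG : HasLevy s k (G n)) : HasLevy s k (FImp F G n) := hF.imp hG

theorem hl_Neg {F : Fml} {s : Side} {k : ℕ} (hF : HasLevy s.dual k (F n)) :
    HasLevy s k (FNeg F n) := by
  have := hF.not
  rwa [Side.dual_dual] at this

theorem hl_Or {F G : Fml} {s : Side} {k : ℕ} (hF : HasLevy s k (F n)) (hG : HasLevy s k (G n)) :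
    HasLevy s k (FOr F G n) := hF.not.imp hG

theorem hl_d0 {F : Fml} {s : Side} {k : ℕ} (hF : IsDelta0 (F n)) : HasLevy s k (F n) :=
  hF.hasLevy s k

theorem hl_Inst {k l : ℕ} {s : Side} {φ : setLang.Formula (Fin k)} (h : IsLevy s l φ)
    {p : Fin k → ℕ} (hp : ∀ i, p i < n) : HasLevy s l (Inst φ p n) := by
  obtain ⟨ψ, hψ, hr⟩ := h.rename (β := Empty) (m := n)
    (Sum.elim (fun i => Sum.inr ⟨p i, hp i⟩) Fin.elim0)
  refine ⟨ψ, hψ, fun M _ D hD v xs => ?_⟩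
  rw [hr]
  simp only [Inst, hp, implies_true, dif_pos]
  refine Iff.trans ?_ (rlz_relabel D φ _ v (xs : Fin (n + 0) → M)).symm
  refine iff_of_eq (congrArg₂ _ ?_ ?_)
  · funext i; rfl
  · funext i; exact i.elim0

theorem hl_UnivPi2 {b : ℕ} (hb : b < n) : HasLevy .pi 2 (UnivPi2 b n) := by
  refine hl_All (HasLevy.lt (s := .sigma) (k := 1) ?_ (by omega))
  refine hl_Ex (hl_Ex (hl_Ex (hl_Ex (hl_Ex (hl_Ex (hl_d0 ?_))))))
  exact d0_And (d0_IsPair (by omega)) (d0_And (d0_IsAssign (by omega)) (d0_And (d0_PairIn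
    (by omega))
    (d0_And (d0_AllIn (by omega) (d0_TrueStep (by omega) (by omega) (by omega)))
      (d0_AllIn (by omega) (d0_FalseStep (by omega) (by omega) (by omega))))))

end Complexity

/-! ### Absoluteness of bounded formulas and persistence of existential ones -/

section Absoluteness

variable {M : Type} [setLang.Structure M] {α : Type} {n : ℕ}

/-- `D` is a transitive class. -/
def TransClass (D : Set M) : Prop := ∀ x ∈ D, ∀ y, y ε x → y ∈ D

theorem snoc_mem {D : Set M} {xs : Fin n → M} {x : M} (hxs : ∀ i, xs i ∈ D) (hx : x ∈ D) :
    ∀ i, (Fin.snoc xs x : Fin (n + 1) → M) i ∈ D := by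
  intro i
  refine Fin.lastCases ?_ (fun i => ?_) i
  · simpa using hx
  · simpa using hxs i

/-- `Δ₀`-formulas are absolute for transitive classes. -/
theorem IsDelta0.absolute {φ : setLang.BoundedFormula α n} (h : IsDelta0 φ) {D D' : Set M}
    (hDD' : D ⊆ D') (hD : TransClass D) (v : α → M) (xs : Fin n → M) (hv : ∀ i, v i ∈ D)
    (hxs : ∀ i, xs i ∈ D) : Rlz D φ v xs ↔ Rlz D' φ v xs := by
  induction h with
  | falsum => rfl
  | equal => rfl
  | rel => rfl
  | imp _ _ ih1 ih2 => simp only [Rlz, ih1 xs hxs, ih2 xs hxs]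
  | @ball n z φ _ ih =>
    simp only [Rlz, rlz_memSym, elim_snoc_castSucc]
    have hz : Sum.elim v xs z ∈ D := by cases z <;> simp [hv, hxs]
    have : ∀ x, Sum.elim v (Fin.snoc xs x : Fin (n + 1) → M) (Sum.inr (Fin.last n)) = x := by simp
    simp only [this]
    constructor
    · intro h x hx hxz
      have hxD := hD _ hz _ hxz
      exact (ih _ (snoc_mem hxs hxD)).1 (h x hxD hxz)
    · intro h x hx hxz
      exact (ih _ (snoc_mem hxs hx)).2 (h x (hDD' hx) hxz)

/-- `Σ₁`-formulas are upwards persistent. -/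
theorem IsSigma.persistent {φ : setLang.BoundedFormula α n} (h : IsSigma 1 φ) {D D' : Set M}
    (hDD' : D ⊆ D') (hD : TransClass D) (v : α → M) (xs : Fin n → M) (hv : ∀ i, v i ∈ D)
    (hxs : ∀ i, xs i ∈ D) : Rlz D φ v xs → Rlz D' φ v xs := by
  suffices H : ∀ {s : Side} {k n : ℕ} {φ : setLang.BoundedFormula α n}, IsLevy s k φ →
      s = .sigma → k = 1 → ∀ xs : Fin n → M, (∀ i, xs i ∈ D) → Rlz D φ v xs → Rlz D' φ v xs from
    H h rfl rfl xs hxs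
  intro s k n φ h
  induction h with
  | delta0 => intro _ h; omega
  | @raise s k n φ h _ =>
    intro _ hk xs hxs hφ
    obtain rfl : k = 0 := by omega
    cases h with
    | delta0 _ h => exact (h.absolute hDD' hD v xs hv hxs).1 hφ
  | ex _ ih =>
    intro _ hk xs hxs hφ
    rw [rlz_ex] at hφ ⊢
    obtain ⟨x, hx, hφ⟩ := hφ
    exact ⟨x, hDD' hx, ih rfl hk _ (snoc_mem hxs hx) hφ⟩
  | all => intro h; cases h

theorem ev_absolute {F : Fml} (h : IsDelta0 (F n)) {D D' : Set M} (hDD' : D ⊆ D')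
    (hD : TransClass D) (e : ℕ → M) (he : ∀ i < n, e i ∈ D) : Ev D F n e ↔ Ev D' F n e :=
  h.absolute hDD' hD _ _ (fun i => i.elim) fun i => he i i.2

end Absoluteness

/-! ## Models of `KPΠ_N` -/

section Models

variable {α β : Type} {n : ℕ}

theorem exists_renames (φ : setLang.BoundedFormula α n) :
    ∀ {m : ℕ} (f : α ⊕ Fin n → β ⊕ Fin m), ∃ ψ : setLang.BoundedFormula β m, Renames f φ ψ := by
  have h : ∀ {n : ℕ} {φ : setLang.BoundedFormula α n}, IsDelta0 φ → ∀ {m : ℕ}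
      (f : α ⊕ Fin n → β ⊕ Fin m), ∃ ψ : setLang.BoundedFormula β m, Renames f φ ψ :=
    fun h _ f => let ⟨ψ, _, h⟩ := h.rename f; ⟨ψ, h⟩
  induction φ with
  | falsum => exact h .falsum
  | equal s t => exact h (.equal s t)
  | rel R ts => exact h (.rel R ts)
  | imp _ _ ih1 ih2 =>
    intro m f
    obtain ⟨ψ₁, h₁⟩ := ih1 f
    obtain ⟨ψ₂, h₂⟩ := ih2 f
    exact ⟨_, h₁.imp h₂⟩
  | all _ ih =>
    intro m f
    obtain ⟨ψ, h⟩ := ih (extendVar f)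
    exact ⟨_, h.all⟩

/-- The renaming that makes the last variable the first one. -/
def lastFirst (n : ℕ) : Empty ⊕ Fin (n + 1) → Fin (n + 1) ⊕ Fin 0 :=
  Sum.elim Empty.elim fun i => Sum.inl (Fin.lastCases 0 (fun i => i.succ) i)

/-- The renaming that makes all variables free. -/
def freeVars (n : ℕ) : Empty ⊕ Fin n → Fin n ⊕ Fin 0 := Sum.elim Empty.elim Sum.inl

theorem Renames.lastFirst {F : Fml} {ψ : setLang.Formula (Fin (n + 1))}
    (h : Renames (lastFirst n) (F (n + 1)) ψ) (M : Type) [setLang.Structure M] (D : Set M)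
    (e : ℕ → M) (x : M) (v : Fin (n + 1) → M) (hv : v = Fin.cons x fun i => e i) :
    Rlz D ψ v Fin.elim0 ↔ Ev D F (n + 1) (up e n x) := by
  rw [h, Ev]
  subst hv
  refine iff_of_eq (congrArg₂ _ ?_ ?_)
  · funext i; exact i.elim
  · rw [← snoc_env]
    funext i
    refine Fin.lastCases ?_ (fun i => ?_) i
    · simp [PiRefl.lastFirst]
    · simp [PiRefl.lastFirst]

theorem Renames.freeVars {F : Fml} {ψ : setLang.Formula (Fin n)}
    (h : Renames (freeVars n) (F n) ψ) (M : Type) [setLang.Structure M] (D : Set M)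
    (e : ℕ → M) : Rlz D ψ (fun i => e i) Fin.elim0 ↔ Ev D F n e := by
  rw [h, Ev]
  refine iff_of_eq (congrArg₂ _ ?_ ?_)
  · funext i; exact i.elim
  · rfl

variable {M : Type} [setLang.Structure M]

/-- The consequences of `KPΠ_N` that are used, in semantic form. -/
structure KPModel (N : ℕ) (M : Type) [setLang.Structure M] : Prop where
  nonempty : Nonempty M
  ext : ∀ x y : M, (∀ z, z ε x ↔ z ε y) → x = y
  sep : ∀ (F : Fml) (n : ℕ) (e : ℕ → M) (u : M), IsDelta0 (F (n + 1)) →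
    ∃ z, ∀ x, x ε z ↔ x ε u ∧ Ev univ F (n + 1) (up e n x)
  found : ∀ (F : Fml) (n : ℕ) (e : ℕ → M),
    (∀ x, (∀ y, y ε x → Ev univ F (n + 1) (up e n y)) → Ev univ F (n + 1) (up e n x)) →
      ∀ x, Ev univ F (n + 1) (up e n x)
  refl : ∀ (F : Fml) (n : ℕ) (e : ℕ → M), HasLevy .pi N (F n) → Ev univ F n e →
    ∃ z, Ev univ (IsUniverse 0) 1 (fun _ => z) ∧ (∀ i < n, e i ε z) ∧ Ev (elts z) F n e

theorem ev_sentence (F : Fml) (e : ℕ → M) : Ev univ F 0 e ↔ M ⊨ (F 0 : setLang.Sentence) := by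
  rw [Ev, rlz_univ, Sentence.Realize, Formula.Realize]
  refine iff_of_eq (congrArg₂ _ ?_ ?_)
  · funext i; exact i.elim
  · funext i; exact i.elim0

theorem ups_zero_lt (e : ℕ → M) {k i : ℕ} (a : Fin k → M) (h : i < k) :
    ups e 0 k a i = a ⟨i, h⟩ := by
  simp [ups, h]

/-- The schemas are transferred from formulas with free variables in `Fin k` to formulas in a named
context with parameters `e`. Four principles suffice below: pairs, `ω` and the bounds needed for
recursion are all obtained from reflection. -/
theorem kpModel_of_models {N : ℕ} [hne : Nonempty M] (hM : ∀ φ, KPPi N φ → M ⊨ φ) :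
    KPModel N M where
  nonempty := hne
  ext := by
    intro x y h
    have e : ℕ → M := fun _ => x
    have := (ev_sentence (M := M) _ e).2 (hM _ .ext)
    simp (disch := omega) only [ev_All, ev_Imp, ev_Iff, ev_Mem, ev_Eqv, up_self, up_lt] at this
    exact this x trivial y trivial fun z _ => h z
  sep := by
    intro F n e u hF
    obtain ⟨ψ, hψ, hr⟩ := hF.rename (lastFirst n)
    have := (ev_sentence (M := M) _ e).2 (hM _ (.sep ψ hψ))
    have := (ev_Alls univ e _ _).1 this (fun i => e i) fun _ => trivial
    rw [ev_All] at this
    have := this u trivial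
    rw [ev_Ex] at this
    obtain ⟨z, _, hz⟩ := this
    refine ⟨z, fun x => ?_⟩
    rw [ev_All] at hz
    have := hz x trivial
    rw [ev_Iff, ev_And, ev_Inst _ _ _ _ (by
      intro i
      refine Fin.cases ?_ (fun i => ?_) i
      · simp
      · simp; omega)] at this
    simp (disch := omega) only [ev_Mem, up_self, up_lt] at this
    rw [this]
    refine and_congr Iff.rfl (Renames.lastFirst hr M univ e x _ ?_)
    funext i
    refine Fin.cases ?_ (fun i => ?_) i
    · simp [up_self]
    · simp (disch := omega) [up_lt, ups_zero_lt]
  found := by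
    intro F n e h
    obtain ⟨ψ, hr⟩ := exists_renames (F (n + 1)) (lastFirst n)
    have := (ev_sentence (M := M) _ e).2 (hM _ (.found ψ))
    have := (ev_Alls univ e _ _).1 this (fun i => e i) fun _ => trivial
    rw [ev_Imp, ev_All, ev_All] at this
    have key : ∀ x {m : ℕ} {e' : ℕ → M} {y : ℕ}, (∀ i < n, e' i = e i) → e' y = x → y < m → n ≤ m →
        (Ev univ (Inst ψ (Fin.cons y fun i => 0 + (i : ℕ))) m e' ↔ Ev univ F (n + 1)
          (up e n x)) := by
      intro x m e' y h1 h2 h3 h4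
      rw [ev_Inst _ _ _ _ (by
        intro i
        refine Fin.cases ?_ (fun i => ?_) i
        · simpa using h3
        · simp; omega)]
      refine Renames.lastFirst hr M univ e x _ ?_
      funext i
      refine Fin.cases ?_ (fun i => ?_) i
      · simp [h2]
      · simp [h1]
    have hu : ∀ i < n, ups e 0 n (fun i : Fin n => e i) i = e i := fun i hi => by
      rw [ups_zero_lt _ _ hi]
    intro x
    refine (key x (fun i hi => ?_) (up_self _ _ _) (by omega) (by omega)).1
      (this (fun x _ => ?_) x trivial)
    · rw [up_lt _ _ (by omega), hu i hi]
    · rw [ev_Imp, ev_AllIn _ _ (by omega)]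
      intro h'
      refine (key x (fun i hi => ?_) (up_self _ _ _) (by omega) (by omega)).2 (h x fun y hy => ?_)
      · rw [up_lt _ _ (by omega), hu i hi]
      · refine (key y (fun i hi => ?_) (up_self _ _ _) (by omega) (by omega)).1
          (h' y trivial (by simpa [up_self] using hy))
        rw [up_lt _ _ (by omega), up_lt _ _ (by omega), hu i hi]
  refl := by
    intro F n e ⟨φ, hφ, heq⟩ h
    obtain ⟨ψ, hψ, hr⟩ := hφ.rename (freeVars n)
    have hev : ∀ D : Set M, D.Nonempty → ∀ (m : ℕ) (e' : ℕ → M), n ≤ m → (∀ i < n, e' i = e i) →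
        (Ev D (Inst ψ fun i => 0 + (i : ℕ)) m e' ↔ Ev D F n e) := by
      intro D hD m e' hm he'
      rw [ev_Inst _ _ _ _ (by intro i; simp; omega)]
      simp only [zero_add]
      have h1 : (fun i : Fin n => e' i) = fun i : Fin n => e i := funext fun i => he' i i.2
      rw [h1, hr M D, Ev, ← heq M D hD]
      refine iff_of_eq (congrArg₂ _ ?_ rfl)
      funext i; exact i.elim
    have := (ev_sentence (M := M) _ e).2 (hM _ (.refl ψ hψ))
    have := (ev_Alls univ e _ _).1 this (fun i => e i) fun _ => trivial
    have hu : ∀ i < n, ups e 0 n (fun i : Fin n => e i) i = e i := fun i hi => by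
      rw [ups_zero_lt _ _ hi]
    rw [ev_Imp, hev univ ⟨hne.some, trivial⟩ _ _ (by omega) hu] at this
    obtain ⟨z, _, hz⟩ := (ev_Ex _ _ _).1 (this h)
    rw [ev_And, ev_And, ev_Conj, ev_Sat _ _ (by omega), up_self, univ_inter] at hz
    obtain ⟨h1, h2, h3⟩ := hz
    have hU : Ev univ (IsUniverse 0) 1 (fun _ => z) := by
      simp (disch := omega) only [IsUniverse, IsTrans, IsOmega, IsNat, IsZeroOrSucc, IsEmp, IsSucc,
        ev_And, ev_Or, ev_AllIn, ev_ExIn, ev_Mem, ev_Eqv, ev_Bot, up_self, up_lt] at h1 ⊢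
      exact h1
    -- The given formula is only equivalent to a `Π_N`-formula, and only over nonempty classes; `ω`
    -- witnesses that the reflecting set qualifies.
    have hn : (elts z).Nonempty := by
      simp (disch := omega) only [IsUniverse, ev_And, ev_ExIn] at hU
      obtain ⟨_, w, _, hw, _⟩ := hU
      exact ⟨w, hw⟩
    refine ⟨z, hU, fun i hi => ?_, ?_⟩
    · have := h2 (Mem (0 + i) (0 + n)) (by simp only [List.mem_ofFn]; exact ⟨⟨i, hi⟩, rfl⟩)
      rw [ev_Mem _ _ (by omega) (by omega), up_self, up_lt _ _ (by omega)] at this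
      simpa [hu i hi] using this
    · refine (hev _ hn _ _ (by omega) fun i hi => ?_).1 h3
      rw [up_lt _ _ (by omega), hu i hi]

end Models

/-- The assignment with the values `a, l₀, l₁, …`, continued by the last of them. -/
def env {M : Type} : M → List M → ℕ → M
  | a, [], _ => a
  | a, _ :: _, 0 => a
  | _, b :: l, i + 1 => env b l i

theorem env_nil {M : Type} (a : M) (i : ℕ) : env a [] i = a := by cases i <;> rfl

theorem env_zero {M : Type} (a : M) (l : List M) : env a l 0 = a := by cases l <;> rfl

theorem env_succ {M : Type} (a b : M) (l : List M) (i : ℕ) : env a (b :: l) (i + 1) = env b l i :=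
  rfl

section Notions

variable {M : Type} [setLang.Structure M]

/-! ## Basic notions in a structure -/

def Emp (x : M) : Prop := ∀ y, ¬ y ε x

def SuccOf (y x : M) : Prop := x ε y ∧ (∀ z, z ε x → z ε y) ∧ ∀ z, z ε y → z ε x ∨ z = x

def TransSet (x : M) : Prop := ∀ y, y ε x → ∀ z, z ε y → z ε x

def EmpOrSucc (x : M) : Prop := Emp x ∨ ∃ y, y ε x ∧ SuccOf x y

def Natural (x : M) : Prop :=
  TransSet x ∧ (∀ y, y ε x → TransSet y) ∧ EmpOrSucc x ∧ ∀ y, y ε x → EmpOrSucc y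

def Omega (w : M) : Prop :=
  (∃ x, x ε w ∧ Emp x) ∧ (∀ x, x ε w → ∃ y, y ε w ∧ SuccOf y x) ∧ ∀ x, x ε w → Natural x

def Universe (P : M) : Prop := TransSet P ∧ ∃ w, w ε P ∧ Omega w

def UPair (z x y : M) : Prop := x ε z ∧ y ε z ∧ ∀ w, w ε z → w = x ∨ w = y

def OPair (p x y : M) : Prop :=
  (∃ u, u ε p ∧ UPair u x x) ∧ (∃ v, v ε p ∧ UPair v x y) ∧
    ∀ w, w ε p → UPair w x x ∨ UPair w x y

def OPairIn (r x y : M) : Prop := ∃ p, p ε r ∧ OPair p x y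

variable (D : Set M) {n : ℕ} (e : ℕ → M)

/-- `IsEmp` with quantifiers restricted to `D`. -/
def sEmp (x : M) : Prop := Ev D (IsEmp 0) 1 (env x [])

/-- Every basic notion gets three facts of this kind: its value depends only on the values of its
arguments and not on the context; over the whole model it has the intended meaning; over transitive
classes it is absolute. -/
theorem ev_IsEmp {x : ℕ} (hx : x < n) :
    Ev D (IsEmp x) n e ↔ sEmp D (e x) := by
  simp (disch := omega) only [sEmp, IsEmp,
    ev_And, ev_Or, ev_AllIn, ev_ExIn, ev_Mem, ev_Eqv, ev_Bot,
    up_self, up_lt, env_nil, env_zero, env_succ]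

theorem sEmp_univ (x : M) : sEmp univ x ↔ Emp x := by
  simp (disch := omega) only [sEmp, IsEmp, Emp,
    ev_And, ev_Or, ev_AllIn, ev_ExIn, ev_Mem, ev_Eqv, ev_Bot,
    up_self, up_lt, env_nil, env_zero, env_succ, mem_univ, true_and, true_imp_iff, forall_const,
      imp_false]

variable {D} in
theorem sEmp_iff (hD : TransClass D) {x : M} (hx : x ∈ D) :
    sEmp D x ↔ Emp x := by
  rw [← sEmp_univ]
  refine ev_absolute (d0_IsEmp (by omega)) (subset_univ D) hD _ fun i hi => ?_
  interval_cases i <;> assumption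

/-- `IsSucc` with quantifiers restricted to `D`. -/
def sSucc (x y : M) : Prop := Ev D (IsSucc 0 1) 2 (env x [y])

theorem ev_IsSucc {x y : ℕ} (hx : x < n) (hy : y < n) :
    Ev D (IsSucc x y) n e ↔ sSucc D (e x) (e y) := by
  simp (disch := omega) only [sSucc, IsSucc,
    ev_And, ev_Or, ev_AllIn, ev_ExIn, ev_Mem, ev_Eqv, ev_Bot,
    up_self, up_lt, env_nil, env_zero, env_succ]

theorem sSucc_univ (x y : M) : sSucc univ x y ↔ SuccOf x y := by
  simp (disch := omega) only [sSucc, IsSucc, SuccOf,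
    ev_And, ev_Or, ev_AllIn, ev_ExIn, ev_Mem, ev_Eqv, ev_Bot,
    up_self, up_lt, env_nil, env_zero, env_succ, mem_univ, true_and, true_imp_iff, forall_const,
      imp_false]

variable {D} in
theorem sSucc_iff (hD : TransClass D) {x y : M} (hx : x ∈ D) (hy : y ∈ D) :
    sSucc D x y ↔ SuccOf x y := by
  rw [← sSucc_univ]
  refine ev_absolute (d0_IsSucc (by omega) (by omega)) (subset_univ D) hD _ fun i hi => ?_
  interval_cases i <;> assumption

/-- `IsTrans` with quantifiers restricted to `D`. -/
def sTrans (x : M) : Prop := Ev D (IsTrans 0) 1 (env x [])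

theorem ev_IsTrans {x : ℕ} (hx : x < n) :
    Ev D (IsTrans x) n e ↔ sTrans D (e x) := by
  simp (disch := omega) only [sTrans, IsTrans,
    ev_And, ev_Or, ev_AllIn, ev_ExIn, ev_Mem, ev_Eqv, ev_Bot,
    up_self, up_lt, env_nil, env_zero, env_succ]

theorem sTrans_univ (x : M) : sTrans univ x ↔ TransSet x := by
  simp (disch := omega) only [sTrans, IsTrans, TransSet,
    ev_And, ev_Or, ev_AllIn, ev_ExIn, ev_Mem, ev_Eqv, ev_Bot,
    up_self, up_lt, env_nil, env_zero, env_succ, mem_univ, true_and, true_imp_iff, forall_const,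
      imp_false]

variable {D} in
theorem sTrans_iff (hD : TransClass D) {x : M} (hx : x ∈ D) :
    sTrans D x ↔ TransSet x := by
  rw [← sTrans_univ]
  refine ev_absolute (d0_IsTrans (by omega)) (subset_univ D) hD _ fun i hi => ?_
  interval_cases i <;> assumption

/-- `IsNat` with quantifiers restricted to `D`. -/
def sNat (x : M) : Prop := Ev D (IsNat 0) 1 (env x [])

theorem ev_IsNat {x : ℕ} (hx : x < n) :
    Ev D (IsNat x) n e ↔ sNat D (e x) := by
  simp (disch := omega) only [sNat, IsNat, IsTrans, IsZeroOrSucc, IsEmp, IsSucc,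
    ev_And, ev_Or, ev_AllIn, ev_ExIn, ev_Mem, ev_Eqv, ev_Bot,
    up_self, up_lt, env_nil, env_zero, env_succ]

theorem sNat_univ (x : M) : sNat univ x ↔ Natural x := by
  simp (disch := omega) only [sNat, IsNat, IsTrans, IsZeroOrSucc, IsEmp, IsSucc, Natural, TransSet,
    EmpOrSucc, Emp, SuccOf,
    ev_And, ev_Or, ev_AllIn, ev_ExIn, ev_Mem, ev_Eqv, ev_Bot,
    up_self, up_lt, env_nil, env_zero, env_succ, mem_univ, true_and, true_imp_iff, forall_const,
      imp_false]

variable {D} in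
theorem sNat_iff (hD : TransClass D) {x : M} (hx : x ∈ D) :
    sNat D x ↔ Natural x := by
  rw [← sNat_univ]
  refine ev_absolute (d0_IsNat (by omega)) (subset_univ D) hD _ fun i hi => ?_
  interval_cases i <;> assumption

/-- `IsOmega` with quantifiers restricted to `D`. -/
def sOmega (x : M) : Prop := Ev D (IsOmega 0) 1 (env x [])

theorem ev_IsOmega {x : ℕ} (hx : x < n) :
    Ev D (IsOmega x) n e ↔ sOmega D (e x) := by
  simp (disch := omega) only [sOmega, IsOmega, IsNat, IsTrans, IsZeroOrSucc, IsEmp, IsSucc,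
    ev_And, ev_Or, ev_AllIn, ev_ExIn, ev_Mem, ev_Eqv, ev_Bot,
    up_self, up_lt, env_nil, env_zero, env_succ]

theorem sOmega_univ (x : M) : sOmega univ x ↔ Omega x := by
  simp (disch := omega) only [sOmega, IsOmega, IsNat, IsTrans, IsZeroOrSucc, IsEmp, IsSucc, Omega,
    Natural, TransSet, EmpOrSucc, Emp, SuccOf,
    ev_And, ev_Or, ev_AllIn, ev_ExIn, ev_Mem, ev_Eqv, ev_Bot,
    up_self, up_lt, env_nil, env_zero, env_succ, mem_univ, true_and, true_imp_iff, forall_const,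
      imp_false]

variable {D} in
theorem sOmega_iff (hD : TransClass D) {x : M} (hx : x ∈ D) :
    sOmega D x ↔ Omega x := by
  rw [← sOmega_univ]
  refine ev_absolute (d0_IsOmega (by omega)) (subset_univ D) hD _ fun i hi => ?_
  interval_cases i <;> assumption

/-- `IsUniverse` with quantifiers restricted to `D`. -/
def sUniv (x : M) : Prop := Ev D (IsUniverse 0) 1 (env x [])

theorem ev_IsUniverse {x : ℕ} (hx : x < n) :
    Ev D (IsUniverse x) n e ↔ sUniv D (e x) := by
  simp (disch := omega) only [sUniv, IsUniverse, IsOmega, IsNat, IsTrans, IsZeroOrSucc, IsEmp,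
    IsSucc,
    ev_And, ev_Or, ev_AllIn, ev_ExIn, ev_Mem, ev_Eqv, ev_Bot,
    up_self, up_lt, env_nil, env_zero, env_succ]

theorem sUniv_univ (x : M) : sUniv univ x ↔ Universe x := by
  simp (disch := omega) only [sUniv, IsUniverse, IsOmega, IsNat, IsTrans, IsZeroOrSucc, IsEmp,
    IsSucc, Universe, Omega, Natural, TransSet, EmpOrSucc, Emp, SuccOf,
    ev_And, ev_Or, ev_AllIn, ev_ExIn, ev_Mem, ev_Eqv, ev_Bot,
    up_self, up_lt, env_nil, env_zero, env_succ, mem_univ, true_and, true_imp_iff, forall_const,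
      imp_false]

variable {D} in
theorem sUniv_iff (hD : TransClass D) {x : M} (hx : x ∈ D) :
    sUniv D x ↔ Universe x := by
  rw [← sUniv_univ]
  refine ev_absolute (d0_IsUniverse (by omega)) (subset_univ D) hD _ fun i hi => ?_
  interval_cases i <;> assumption

/-- `IsPair` with quantifiers restricted to `D`. -/
def sPair (x y z : M) : Prop := Ev D (IsPair 0 1 2) 3 (env x [y, z])

theorem ev_IsPair {x y z : ℕ} (hx : x < n) (hy : y < n) (hz : z < n) :
    Ev D (IsPair x y z) n e ↔ sPair D (e x) (e y) (e z) := by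
  simp (disch := omega) only [sPair, IsPair, IsUPair,
    ev_And, ev_Or, ev_AllIn, ev_ExIn, ev_Mem, ev_Eqv, ev_Bot,
    up_self, up_lt, env_nil, env_zero, env_succ]

theorem sPair_univ (x y z : M) : sPair univ x y z ↔ OPair x y z := by
  simp (disch := omega) only [sPair, IsPair, IsUPair, OPair, UPair,
    ev_And, ev_Or, ev_AllIn, ev_ExIn, ev_Mem, ev_Eqv, ev_Bot,
    up_self, up_lt, env_nil, env_zero, env_succ, mem_univ, true_and, true_imp_iff, forall_const,
      imp_false]

variable {D} in
theorem sPair_iff (hD : TransClass D) {x y z : M} (hx : x ∈ D) (hy : y ∈ D) (hz : z ∈ D) :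
    sPair D x y z ↔ OPair x y z := by
  rw [← sPair_univ]
  refine ev_absolute (d0_IsPair (by omega)) (subset_univ D) hD _ fun i hi => ?_
  interval_cases i <;> assumption

/-- `PairIn` with quantifiers restricted to `D`. -/
def sPairIn (x y z : M) : Prop := Ev D (PairIn 0 1 2) 3 (env x [y, z])

theorem ev_PairIn {x y z : ℕ} (hx : x < n) (hy : y < n) (hz : z < n) :
    Ev D (PairIn x y z) n e ↔ sPairIn D (e x) (e y) (e z) := by
  simp (disch := omega) only [sPairIn, PairIn, IsPair, IsUPair,
    ev_And, ev_Or, ev_AllIn, ev_ExIn, ev_Mem, ev_Eqv, ev_Bot,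
    up_self, up_lt, env_nil, env_zero, env_succ]

theorem sPairIn_univ (x y z : M) : sPairIn univ x y z ↔ OPairIn x y z := by
  simp (disch := omega) only [sPairIn, PairIn, IsPair, IsUPair, OPairIn, OPair, UPair,
    ev_And, ev_Or, ev_AllIn, ev_ExIn, ev_Mem, ev_Eqv, ev_Bot,
    up_self, up_lt, env_nil, env_zero, env_succ, mem_univ, true_and, true_imp_iff, forall_const,
      imp_false]

variable {D} in
theorem sPairIn_iff (hD : TransClass D) {x y z : M} (hx : x ∈ D) (hy : y ∈ D) (hz : z ∈ D) :
    sPairIn D x y z ↔ OPairIn x y z := by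
  rw [← sPairIn_univ]
  refine ev_absolute (d0_PairIn (by omega)) (subset_univ D) hD _ fun i hi => ?_
  interval_cases i <;> assumption

end Notions

/-! ## Set theory in models of `KPΠ_N` -/

section SetTheory

variable {M : Type} [setLang.Structure M]

theorem transClass_univ : TransClass (univ : Set M) := fun _ _ _ _ => trivial

theorem TransSet.transClass {P : M} (h : TransSet P) : TransClass (elts P) := h

theorem Universe.transClass {P : M} (h : Universe P) : TransClass (elts P) := h.1

theorem TransClass.inter_elts {D : Set M} (hD : TransClass D) {P : M} (hP : P ∈ D) :
    D ∩ elts P = elts P :=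
  inter_eq_right.2 fun x hx => hD P hP x hx

theorem OPair.left_mem {D : Set M} (hD : TransClass D) {p x y : M} (h : OPair p x y) (hp : p ∈ D) :
    x ∈ D := by
  obtain ⟨⟨u, hu, hxu⟩, -⟩ := h
  exact hD u (hD p hp u hu) x hxu.1

theorem OPair.right_mem {D : Set M} (hD : TransClass D) {p x y : M} (h : OPair p x y)
    (hp : p ∈ D) : y ∈ D := by
  obtain ⟨-, ⟨u, hu, hxu⟩, -⟩ := h
  exact hD u (hD p hp u hu) y hxu.2.1

theorem OPair.inj {p x y x' y' : M} (h : OPair p x y) (h' : OPair p x' y') : x = x' ∧ y = y' := by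
  obtain ⟨⟨u, hu, hu1, -, hu2⟩, ⟨v, hv, hv1, hv2, hv3⟩, hw⟩ := h
  obtain ⟨⟨u', hu', hu1', -, hu2'⟩, ⟨v', hv', hv1', hv2', hv3'⟩, hw'⟩ := h'
  have hx : x' = x := by
    rcases hw u' hu' with h | h
    · rcases h.2.2 _ hu1' with h | h <;> exact h
    · rcases hu2' x h.1 with h | h <;> exact h.symm
  subst hx
  refine ⟨rfl, ?_⟩
  rcases hw v' hv' with h | h
  · have h1 : y' = x' := by rcases h.2.2 _ hv2' with h | h <;> exact h
    subst h1
    rcases hw' v hv with h | h <;> rcases h.2.2 _ hv2 with h | h <;> exact h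
  · rcases hv3' y h.2.1 with h1 | h1
    · subst h1
      rcases h.2.2 _ hv2' with h | h <;> exact h.symm
    · exact h1

/-- `A` is definable with parameters. -/
def DefinableClass (A : M → Prop) : Prop :=
  ∃ (F : Fml) (n : ℕ) (e : ℕ → M), ∀ x, Ev univ F (n + 1) (up e n x) ↔ A x

/-- `A` is definable by a `Δ₀`-formula with parameters. -/
def Delta0Class (A : M → Prop) : Prop :=
  ∃ (F : Fml) (n : ℕ) (e : ℕ → M), IsDelta0 (F (n + 1)) ∧ ∀ x, Ev univ F (n + 1) (up e n x) ↔ A x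

variable {N : ℕ}

namespace KPModel

theorem separation (hM : KPModel N M)
    {A : M → Prop} (hA : Delta0Class A) (u : M) : ∃ z, ∀ x, x ε z ↔ x ε u ∧ A x := by
  obtain ⟨F, n, e, hF, h⟩ := hA
  obtain ⟨z, hz⟩ := hM.sep F n e u hF
  exact ⟨z, fun x => by rw [hz, h]⟩

theorem mem_induction (hM : KPModel N M)
    {A : M → Prop} (hA : DefinableClass A) (h : ∀ x, (∀ y, y ε x → A y) → A x)
    (x : M) : A x := by
  obtain ⟨F, n, e, hF⟩ := hA
  rw [← hF]
  refine hM.found F n e (fun x hx => ?_) x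
  rw [hF]
  exact h x fun y hy => (hF y).1 (hx y hy)

theorem reflection (hM : KPModel N M)
    (F : Fml) (n : ℕ) (e : ℕ → M) (hF : HasLevy .pi N (F n)) (h : Ev univ F n e) :
    ∃ z, Universe z ∧ (∀ i < n, e i ε z) ∧ Ev (elts z) F n e := by
  obtain ⟨z, h1, h2, h3⟩ := hM.refl F n e hF h
  exact ⟨z, (sUniv_univ z).1 h1, h2, h3⟩

/-- Reflect a trivially true formula with `x` and `y` as parameters. Pairs and `ω` are then cut out
of the reflecting universe or found in it. -/
theorem exists_universe (hM : KPModel N M) (x y : M) : ∃ z, Universe z ∧ x ε z ∧ y ε z := by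
  obtain ⟨z, h1, h2, -⟩ := hM.reflection (FNeg FBot) 2 (env x [y]) (hl_d0 (d0_Neg d0_Bot))
    (by simp [ev_Neg, ev_Bot])
  exact ⟨z, h1, h2 0 (by omega), h2 1 (by omega)⟩

theorem exists_uPair (hM : KPModel N M) (x y : M) : ∃ z, UPair z x y := by
  obtain ⟨u, hu, hx, hy⟩ := hM.exists_universe x y
  obtain ⟨z, hz⟩ := hM.separation (A := fun w => w = x ∨ w = y)
    ⟨2 ≐ 0 ⋎ 2 ≐ 1, 2, env x [y], d0_Or (d0_Eqv _ _) (d0_Eqv _ _), fun w => by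
      simp (disch := omega) only [ev_Or, ev_Eqv, up_self, up_lt, env_nil, env_zero, env_succ]⟩ u
  refine ⟨z, (hz x).2 ⟨hx, .inl rfl⟩, (hz y).2 ⟨hy, .inr rfl⟩, fun w hw => ((hz w).1 hw).2⟩

theorem exists_oPair (hM : KPModel N M) (x y : M) : ∃ p, OPair p x y := by
  obtain ⟨u, hu⟩ := hM.exists_uPair x x
  obtain ⟨v, hv⟩ := hM.exists_uPair x y
  obtain ⟨p, hp⟩ := hM.exists_uPair u v
  refine ⟨p, ⟨u, hp.1, hu⟩, ⟨v, hp.2.1, hv⟩, fun w hw => ?_⟩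
  rcases hp.2.2 w hw with rfl | rfl
  · exact .inl hu
  · exact .inr hv

theorem uPair_unique (hM : KPModel N M)
    {z z' x y : M} (h : UPair z x y) (h' : UPair z' x y) : z = z' := by
  refine hM.ext _ _ fun w => ⟨fun hw => ?_, fun hw => ?_⟩
  · rcases h.2.2 w hw with rfl | rfl
    · exact h'.1
    · exact h'.2.1
  · rcases h'.2.2 w hw with rfl | rfl
    · exact h.1
    · exact h.2.1

theorem oPair_unique (hM : KPModel N M)
    {p p' x y : M} (h : OPair p x y) (h' : OPair p' x y) : p = p' := by
  have : ∀ {p p' : M}, OPair p x y → OPair p' x y → ∀ w, w ε p → w ε p' := by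
    intro p p' h h' w hw
    obtain ⟨⟨u, hu, hu'⟩, ⟨v, hv, hv'⟩, -⟩ := h'
    rcases h.2.2 w hw with h | h
    · rwa [hM.uPair_unique h hu']
    · rwa [hM.uPair_unique h hv']
  exact hM.ext _ _ fun w => ⟨this h h' w, this h' h w⟩

theorem oPairIn_iff (hM : KPModel N M) {r p x y : M} (h : OPair p x y) : OPairIn r x y ↔ p ε r :=
  ⟨fun ⟨q, hq, hq'⟩ => by rwa [hM.oPair_unique h hq'], fun hp => ⟨p, hp, h⟩⟩

theorem mem_irrefl (hM : KPModel N M) (x : M) : ¬ x ε x := by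
  refine hM.mem_induction (A := fun x => ¬ x ε x) ⟨FNeg (0 ∊ 0), 0, env x [], fun y => by
    simp (disch := omega) only [ev_Neg, ev_Mem, up_self]⟩ (fun x hx h => hx x h h) x

theorem succ_unique (hM : KPModel N M)
    {y y' x : M} (h : SuccOf y x) (h' : SuccOf y' x) : y = y' := by
  have : ∀ {y y' : M}, SuccOf y x → SuccOf y' x → ∀ w, w ε y → w ε y' := by
    intro y y' h h' w hw
    rcases h.2.2 w hw with h | rfl
    · exact h'.2.1 w h
    · exact h'.1
  exact hM.ext _ _ fun w => ⟨this h h' w, this h' h w⟩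

theorem emp_unique (hM : KPModel N M) {x y : M} (h : Emp x) (h' : Emp y) : x = y :=
  hM.ext _ _ fun w => ⟨fun hw => absurd hw (h w), fun hw => absurd hw (h' w)⟩

end KPModel

theorem Natural.mem {x y : M} (h : Natural x) (hy : y ε x) : Natural y :=
  ⟨h.2.1 y hy, fun z hz => h.2.1 z (h.1 y hy z hz), h.2.2.2 y hy,
    fun z hz => h.2.2.2 z (h.1 y hy z hz)⟩

theorem natural_emp {x : M} (h : Emp x) : Natural x :=
  ⟨fun y hy => absurd hy (h y), fun y hy => absurd hy (h y), .inl h, fun y hy => absurd hy (h y)⟩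

theorem Natural.succ {x y : M} (h : Natural x) (hy : SuccOf y x) : Natural y := by
  refine ⟨fun z hz w hw => ?_, fun z hz => ?_, .inr ⟨x, hy.1, hy⟩, fun z hz => ?_⟩
  · rcases hy.2.2 z hz with hz | rfl
    · exact hy.2.1 w (h.1 z hz w hw)
    · exact hy.2.1 w hw
  · rcases hy.2.2 z hz with hz | rfl
    · exact h.2.1 z hz
    · exact h.1
  · rcases hy.2.2 z hz with hz | rfl
    · exact h.2.2.2 z hz
    · exact h.2.2.1

namespace KPModel

/-- Foundation suffices: a nonempty natural number is the successor of one of its elements, and that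
element is again natural. -/
theorem nat_induction (hM : KPModel N M)
    {A : M → Prop} (hA : DefinableClass A) (h0 : ∀ x, Emp x → A x)
    (hs : ∀ x y, Natural x → SuccOf y x → A x → A y) (x : M) (hx : Natural x) : A x := by
  refine hM.mem_induction (A := fun x => Natural x → A x) ?_ (fun x ih hx => ?_) x hx
  · obtain ⟨F, n, e, hF⟩ := hA
    refine ⟨IsNat n ⟶ᶠ F, n, e, fun x => ?_⟩
    rw [ev_Imp, hF, ev_IsNat _ _ (by omega), sNat_univ, up_self]
  · rcases hx.2.2.1 with h | ⟨y, hy, hxy⟩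
    · exact h0 x h
    · exact hs y x (hx.mem hy) hxy (ih y hy (hx.mem hy))

theorem natural_mem_omega (hM : KPModel N M)
    {w : M} (hw : Omega w) (x : M) (hx : Natural x) : x ε w := by
  refine hM.nat_induction (A := fun x => x ε w) ⟨1 ∊ 0, 1, env w [], fun x => ?_⟩ ?_ ?_ x hx
  · simp (disch := omega) only [ev_Mem, up_self, up_lt, env_nil]
  · intro x hx
    obtain ⟨z, hz, hz'⟩ := hw.1
    rwa [hM.emp_unique hx hz']
  · intro x y _ hy hx
    obtain ⟨z, hz, hz'⟩ := hw.2.1 x hx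
    rwa [hM.succ_unique hy hz']

theorem mem_omega_iff (hM : KPModel N M) {w : M} (hw : Omega w) {x : M} : x ε w ↔ Natural x :=
  ⟨hw.2.2 x, hM.natural_mem_omega hw x⟩

theorem exists_omega (hM : KPModel N M) : ∃ w : M, Omega w := by
  obtain ⟨x⟩ := hM.nonempty
  obtain ⟨z, ⟨-, w, -, hw⟩, -⟩ := hM.exists_universe x x
  exact ⟨w, hw⟩

theorem natural_mem_universe (hM : KPModel N M)
    {P : M} (hP : Universe P) {x : M} (hx : Natural x) : x ε P := by
  obtain ⟨w, hw, hw'⟩ := hP.2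
  exact hP.1 w hw x (hM.natural_mem_omega hw' x hx)

theorem exists_emp (hM : KPModel N M) : ∃ x : M, Emp x := by
  obtain ⟨w, ⟨x, -, hx⟩, -⟩ := hM.exists_omega
  exact ⟨x, hx⟩

theorem exists_succ (hM : KPModel N M) {x : M} (hx : Natural x) : ∃ y, SuccOf y x := by
  obtain ⟨w, hw⟩ := hM.exists_omega
  obtain ⟨y, -, hy⟩ := hw.2.1 x (hM.natural_mem_omega hw x hx)
  exact ⟨y, hy⟩

theorem emp_mem_or_eq (hM : KPModel N M)
    {z : M} (hz : Emp z) (x : M) (hx : Natural x) : z ε x ∨ z = x := by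
  refine hM.nat_induction (A := fun x => z ε x ∨ z = x)
    ⟨0 ∊ 1 ⋎ 0 ≐ 1, 1, env z [], fun x => ?_⟩ ?_ ?_ x hx
  · simp (disch := omega) only [ev_Or, ev_Eqv, ev_Mem, up_self, up_lt, env_nil]
  · exact fun x hx => .inr (hM.emp_unique hz hx)
  · rintro x y _ hy (h | rfl)
    · exact .inl (hy.2.1 z h)
    · exact .inl hy.1

theorem succ_mem_or_eq (hM : KPModel N M)
    {x x' y : M} (hx' : SuccOf x' x) (hy : Natural y) (hxy : x ε y) :
    x' ε y ∨ x' = y := by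
  refine hM.nat_induction (A := fun y => x ε y → x' ε y ∨ x' = y)
    ⟨0 ∊ 2 ⟶ᶠ 1 ∊ 2 ⋎ 1 ≐ 2, 2, env x [x'], fun x => ?_⟩ ?_ ?_ y hy hxy
  · simp (disch := omega) only [ev_Imp, ev_Or, ev_Eqv, ev_Mem, up_self, up_lt, env_nil, env_zero,
      env_succ]
  · exact fun y hy h => absurd h (hy x)
  · intro z y _ hy ih h
    rcases hy.2.2 x h with h | rfl
    · rcases ih h with h | rfl
      · exact .inl (hy.2.1 _ h)
      · exact .inl hy.1
    · exact .inr (hM.succ_unique hx' hy)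

theorem nat_trichotomy (hM : KPModel N M)
    {x y : M} (hx : Natural x) (hy : Natural y) : x ε y ∨ x = y ∨ y ε x := by
  refine hM.nat_induction (A := fun x => x ε y ∨ x = y ∨ y ε x)
    ⟨1 ∊ 0 ⋎ 1 ≐ 0 ⋎ 0 ∊ 1, 1, env y [], fun x => ?_⟩ ?_ ?_ x hx
  · simp (disch := omega) only [ev_Or, ev_Eqv, ev_Mem, up_self, up_lt, env_nil, env_zero, env_succ]
  · intro x hx
    rcases hM.emp_mem_or_eq hx y hy with h | h
    · exact .inl h
    · exact .inr (.inl h)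
  · rintro x x' _ hx' (h | rfl | h)
    · rcases hM.succ_mem_or_eq hx' hy h with h | h
      · exact .inl h
      · exact .inr (.inl h)
    · exact .inr (.inr hx'.1)
    · exact .inr (.inr (hx'.2.1 _ h))

end KPModel

end SetTheory

/-! ## Recursion on `∈` -/

section Recursion

variable {M : Type} [setLang.Structure M]

/-- `D` is transitive, and `H` satisfies the recursion with the step `S` at `P ∈ D` and
`a ∈ P ∪ c`. -/
def RecursionF (S : ℕ → ℕ → ℕ → Fml) (c D H : ℕ) : Fml :=
  IsTrans D ⋏ AllIn D fun P => (AllIn P fun a => PairIn H P a ⟷ᶠ S P a H) ⋏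
    AllIn c fun a => PairIn H P a ⟷ᶠ S P a H

/-- The relation defined by `RecursionF`. -/
def Recursion (Step : M → M → M → Prop) (c D H : M) : Prop :=
  TransSet D ∧ ∀ P, P ε D → ∀ a, a ε P ∨ a ε c → (OPairIn H P a ↔ Step P a H)

/-- The formula `S` with the parameters `e₀` in the first `k` variables is `Δ₀` and defines
`Step`. -/
structure StepDef (S : ℕ → ℕ → ℕ → Fml) (k : ℕ) (e₀ : ℕ → M) (Step : M → M → M → Prop) : Prop where
  d0 : ∀ {n P a H : ℕ}, k ≤ n → P < n → a < n → H < n → IsDelta0 (S P a H n)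
  ev : ∀ {n P a H : ℕ} {e : ℕ → M}, k ≤ n → P < n → a < n → H < n → (∀ i < k, e i = e₀ i) →
    (Ev univ (S P a H) n e ↔ Step (e P) (e a) (e H))

variable {S : ℕ → ℕ → ℕ → Fml} {k : ℕ} {e₀ : ℕ → M} {Step : M → M → M → Prop}

theorem StepDef.d0_recursion (hS : StepDef S k e₀ Step) {n c D H : ℕ} (hk : k ≤ n) (hc : c < n)
    (hD : D < n) (hH : H < n) : IsDelta0 (RecursionF S c D H n) :=
  d0_And (d0_IsTrans hD) (d0_AllIn hD (d0_And
    (d0_AllIn (by omega) (d0_Iff (d0_PairIn (by omega))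
      (hS.d0 (by omega) (by omega) (by omega) (by omega))))
    (d0_AllIn (by omega) (d0_Iff (d0_PairIn (by omega))
      (hS.d0 (by omega) (by omega) (by omega) (by omega))))))

theorem StepDef.ev_recursion (hS : StepDef S k e₀ Step) {n c D H : ℕ} {e : ℕ → M} (hk : k ≤ n)
    (hc : c < n) (hD : D < n) (hH : H < n) (he : ∀ i < k, e i = e₀ i) :
    Ev univ (RecursionF S c D H) n e ↔ Recursion Step (e c) (e D) (e H) := by
  have h : ∀ P a, Ev univ (S n (n + 1) H) (n + 1 + 1) (up (up e n P) (n + 1) a) ↔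
      Step P a (e H) := by
    intro P a
    rw [hS.ev (by omega) (by omega) (by omega) (by omega)]
    · simp (disch := omega) only [up_self, up_lt]
    · intro i hi
      rw [up_lt _ _ (by omega), up_lt _ _ (by omega), he i hi]
  simp (disch := omega) only [RecursionF, Recursion, ev_And, ev_AllIn, ev_Iff, ev_IsTrans,
    ev_PairIn, h, up_self, up_lt, sPairIn_univ, sTrans_univ, mem_univ, true_imp_iff, or_imp,
    forall_and]

namespace KPModel

variable {N : ℕ}

/-- `∈`-induction on `P`; locality `hloc` says that the step at `P` consults `H` only at elements of
`P`. -/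
theorem recursion_unique (hM : KPModel N M) {c : M}
    (hloc : ∀ P a H H', (∀ Q, Q ε P → ∀ b, b ε Q ∨ b ε c → (OPairIn H Q b ↔ OPairIn H' Q b)) →
      Step P a H → Step P a H')
    {D H D' H' : M} (h : Recursion Step c D H) (h' : Recursion Step c D' H') {P : M} (hP : P ε D)
    (hP' : P ε D') {a : M} (ha : a ε P ∨ a ε c) : OPairIn H P a ↔ OPairIn H' P a := by
  refine hM.mem_induction (A := fun P => P ε D → P ε D' → ∀ a, a ε P ∨ a ε c →
    (OPairIn H P a ↔ OPairIn H' P a)) ⟨5 ∊ 0 ⟶ᶠ 5 ∊ 1 ⟶ᶠ FAll fun a => a ∊ 5 ⋎ a ∊ 4 ⟶ᶠ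
      (PairIn 2 5 a ⟷ᶠ PairIn 3 5 a), 5, env D [D', H, H', c], fun P => ?_⟩ ?_ P hP hP' a ha
  · simp (disch := omega) only [ev_Imp, ev_Mem, ev_All, ev_Or, ev_Iff, ev_PairIn, up_self, up_lt,
      env_nil, env_zero, env_succ, sPairIn_univ, mem_univ, true_imp_iff]
  · intro P ih hP hP' a ha
    rw [h.2 P hP a ha, h'.2 P hP' a ha]
    have key : ∀ Q, Q ε P → ∀ b, b ε Q ∨ b ε c → (OPairIn H Q b ↔ OPairIn H' Q b) :=
      fun Q hQ b hb => ih Q hQ (h.1 P hP Q hQ) (h'.1 P hP' Q hQ) b hb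
    exact ⟨hloc _ _ _ _ key, hloc _ _ _ _ fun Q hQ b hb => (key Q hQ b hb).symm⟩

/-- `∈`-induction. The induction hypothesis for the elements of `x` is a `Π₂`-statement, so it is
reflected to a universe `z` that already contains suitable hierarchies for all of them. By
uniqueness these agree, so they can be united inside `z` and extended by one step at `x`. The extra
set `c` provides second arguments that need not belong to the first one. -/
theorem exists_recursion (hM : KPModel N M)
    (hN : 3 ≤ N) (hS : StepDef S k e₀ Step) {ci : ℕ} (hci : ci < k)
    (hloc : ∀ P a H H', (∀ Q, Q ε P → ∀ b, b ε Q ∨ b ε e₀ ci →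
      (OPairIn H Q b ↔ OPairIn H' Q b)) → Step P a H → Step P a H') (x : M) :
    ∃ D H, Recursion Step (e₀ ci) D H ∧ x ε D := by
  have hup : ∀ {e : ℕ → M} {n : ℕ} {x : M}, k ≤ n → (∀ i < k, e i = e₀ i) →
      ∀ i < k, up e n x i = e₀ i := fun hk he i hi => by rw [up_lt _ _ (by omega), he i hi]
  have he₀ : ∀ i < k, e₀ i = e₀ i := fun _ _ => rfl
  refine hM.mem_induction (A := fun x => ∃ D H, Recursion Step (e₀ ci) D H ∧ x ε D)
    ⟨FEx fun D => FEx fun H => RecursionF S ci D H ⋏ k ∊ D, k, e₀, fun x => ?_⟩ ?_ x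
  · simp only [ev_Ex, ev_And, mem_univ, true_and]
    refine exists_congr fun D => exists_congr fun H => and_congr ?_ ?_
    · rw [hS.ev_recursion (by omega) (by omega) (by omega) (by omega)
        (hup (by omega) (hup (by omega) (hup le_rfl he₀)))]
      simp (disch := omega) only [up_self, up_lt]
    · simp (disch := omega) only [ev_Mem, up_self, up_lt]
  intro x ih
  set c := e₀ ci with hc
  -- Closure under pairs is reflected along with the hypothesis: the new pairs `⟨x, a⟩` must lie in
  -- `z` for bounded separation to collect them.
  set F : Fml := (FAll fun y => y ∊ k ⟶ᶠ FEx fun D => FEx fun H => RecursionF S ci D H ⋏ y ∊ D) ⋏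
    FAll fun a => FAll fun b => FEx fun p => IsPair p a b with hF
  have hFl : HasLevy .pi N (F (k + 1)) := by
    refine HasLevy.le (k := 2) ?_ (by omega)
    refine hl_And (hl_All (hl_Imp (hl_d0 (d0_Mem _ _)) (HasLevy.lt (s := .sigma) (k := 1) ?_
      (by omega)))) (hl_All (hl_All (HasLevy.lt (s := .sigma) (k := 1)
        (hl_Ex (hl_d0 (d0_IsPair (by omega)))) (by omega))))
    exact hl_Ex (hl_Ex (hl_d0 (d0_And (hS.d0_recursion (by omega) (by omega) (by omega) (by omega))
      (d0_Mem _ _))))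
  have hFe : Ev univ F (k + 1) (up e₀ k x) := by
    rw [hF, ev_And]
    constructor
    · rw [ev_All]
      intro y _
      rw [ev_Imp]
      intro hy
      simp (disch := omega) only [ev_Mem, up_self, up_lt] at hy
      obtain ⟨D, H, h1, h2⟩ := ih y hy
      rw [ev_Ex]
      refine ⟨D, trivial, ?_⟩
      rw [ev_Ex]
      refine ⟨H, trivial, ?_⟩
      rw [ev_And, hS.ev_recursion (by omega) (by omega) (by omega) (by omega)
        (hup (by omega) (hup (by omega) (hup (by omega) (hup le_rfl he₀))))]
      simp (disch := omega) only [ev_Mem, up_self, up_lt]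
      exact ⟨h1, h2⟩
    · simp (disch := omega) only [ev_All, ev_Ex, ev_IsPair, up_self, up_lt, sPair_univ, mem_univ,
        true_imp_iff, true_and]
      exact hM.exists_oPair
  obtain ⟨z, hz, hez, hFz⟩ := hM.reflection F (k + 1) _ hFl hFe
  have hxz : x ε z := by simpa [up_self] using hez k (by omega)
  have he₀z : ∀ i < k, e₀ i ε z := fun i hi => by
    have := hez i (by omega)
    rwa [up_lt _ _ hi] at this
  rw [hF, ev_And] at hFz
  have hpair : ∀ a b, a ε z → b ε z → ∃ p, p ε z ∧ OPair p a b := by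
    intro a b ha hb
    have := hFz.2
    simp (disch := omega) only [ev_All, ev_Ex, ev_IsPair, up_self, up_lt] at this
    obtain ⟨p, hp, hp'⟩ := this a ha b hb
    exact ⟨p, hp, (sPair_iff hz.transClass hp ha hb).1 hp'⟩
  have hrec : ∀ y, y ε x → ∃ D H, D ε z ∧ H ε z ∧ Recursion Step c D H ∧ y ε D := by
    intro y hy
    have hyz : y ε z := hz.1 x hxz y hy
    have := hFz.1
    rw [ev_All] at this
    have := this y hyz
    rw [ev_Imp] at this
    have := this (by simpa (disch := omega) only [ev_Mem, up_self, up_lt] using hy)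
    rw [ev_Ex] at this
    obtain ⟨D, hD, this⟩ := this
    rw [ev_Ex] at this
    obtain ⟨H, hH, this⟩ := this
    rw [ev_And, ev_absolute (hS.d0_recursion (by omega) (by omega) (by omega) (by omega))
      (subset_univ _) hz.transClass, hS.ev_recursion (by omega) (by omega) (by omega) (by omega)
        (hup (by omega) (hup (by omega) (hup (by omega) (hup le_rfl he₀))))] at this
    · simp (disch := omega) only [ev_Mem, up_self, up_lt] at this
      exact ⟨D, H, hD, hH, this⟩
    · intro i hi
      by_cases h1 : i < k
      · rw [up_lt _ _ (by omega), up_lt _ _ (by omega), up_lt _ _ (by omega), up_lt _ _ (by omega)]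
        exact he₀z i h1
      · obtain rfl | rfl | rfl | rfl : i = k ∨ i = k + 1 ∨ i = k + 2 ∨ i = k + 3 := by omega
        all_goals simp (disch := omega) only [up_self, up_lt]; assumption
  -- If some hierarchy in `z` already covers `x`, nothing is left to do. Otherwise the union has no
  -- entries at `x` that could interfere with the new step.
  by_cases hxD : ∃ D H, D ε z ∧ H ε z ∧ Recursion Step c D H ∧ x ε D
  · obtain ⟨D, H, -, -, h⟩ := hxD
    exact ⟨D, H, h⟩
  push Not at hxD
  obtain ⟨D₂, hD₂⟩ := hM.separation
    (A := fun Q => Q = x ∨ ∃ D, D ε z ∧ ∃ H, H ε z ∧ Recursion Step c D H ∧ Q ε D)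
    ⟨(k + 2) ≐ (k + 1) ⋎ ExIn k fun D => ExIn k fun H => RecursionF S ci D H ⋏ (k + 2) ∊ D, k + 2,
      up (up e₀ k z) (k + 1) x, d0_Or (d0_Eqv _ _) (d0_ExIn (by omega) (d0_ExIn (by omega)
        (d0_And (hS.d0_recursion (by omega) (by omega) (by omega) (by omega)) (d0_Mem _ _)))),
      fun Q => by
        simp (disch := omega) only [ev_Or, ev_Eqv, ev_ExIn, ev_And, ev_Mem, up_self, up_lt,
          mem_univ, true_and]
        refine or_congr Iff.rfl (exists_congr fun D => and_congr Iff.rfl (exists_congr fun H =>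
          and_congr Iff.rfl (and_congr ?_ Iff.rfl)))
        rw [hS.ev_recursion (by omega) (by omega) (by omega) (by omega) (hup (by omega)
          (hup (by omega) (hup (by omega) (hup (by omega) (hup le_rfl he₀)))))]
        simp (disch := omega) only [up_self, up_lt]
        rfl⟩ z
  -- The union of the relations is restricted to pairs with first component in the associated `D`,
  -- since `H` is arbitrary outside `D`.
  obtain ⟨H₁, hH₁⟩ := hM.separation
    (A := fun p => ∃ D, D ε z ∧ ∃ H, H ε z ∧ Recursion Step c D H ∧ p ε H ∧
      ∃ Q, Q ε D ∧ ∃ b, b ε z ∧ OPair p Q b)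
    ⟨ExIn k fun D => ExIn k fun H => RecursionF S ci D H ⋏ (k + 1) ∊ H ⋏
      ExIn D fun Q => ExIn k fun b => IsPair (k + 1) Q b, k + 1, up e₀ k z,
      d0_ExIn (by omega) (d0_ExIn (by omega)
        (d0_And (hS.d0_recursion (by omega) (by omega) (by omega) (by omega)) (d0_And (d0_Mem _ _)
          (d0_ExIn (by omega) (d0_ExIn (by omega) (d0_IsPair (by omega))))))),
      fun p => by
        simp (disch := omega) only [ev_ExIn, ev_And, ev_Mem, ev_IsPair, up_self, up_lt,
          mem_univ, true_and, sPair_univ]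
        refine exists_congr fun D => and_congr Iff.rfl (exists_congr fun H =>
          and_congr Iff.rfl (and_congr ?_ Iff.rfl))
        rw [hS.ev_recursion (by omega) (by omega) (by omega) (by omega) (hup (by omega)
          (hup (by omega) (hup (by omega) (hup le_rfl he₀))))]
        simp (disch := omega) only [up_self, up_lt]
        rfl⟩ z
  -- The union extended by the values of the step at `x`. The step is computed from `H₁`, which
  -- agrees with `H₂` below `x`.
  obtain ⟨H₂, hH₂⟩ := hM.separation
    (A := fun p => p ε H₁ ∨ ∃ a, a ε z ∧ OPair p x a ∧ Step x a H₁)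
    ⟨(k + 3) ∊ (k + 1) ⋎ ExIn k fun a => IsPair (k + 3) (k + 2) a ⋏ S (k + 2) a (k + 1), k + 3,
      up (up (up e₀ k z) (k + 1) H₁) (k + 2) x,
      d0_Or (d0_Mem _ _) (d0_ExIn (by omega) (d0_And (d0_IsPair (by omega))
        (hS.d0 (by omega) (by omega) (by omega) (by omega)))),
      fun p => by
        simp (disch := omega) only [ev_Or, ev_ExIn, ev_And, ev_Mem, ev_IsPair, up_self, up_lt,
          mem_univ, true_and, sPair_univ]
        refine or_congr Iff.rfl (exists_congr fun a => and_congr Iff.rfl (and_congr Iff.rfl ?_))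
        rw [hS.ev (by omega) (by omega) (by omega) (by omega) (hup (by omega)
          (hup (by omega) (hup (by omega) (hup (by omega) (hup le_rfl he₀)))))]
        simp (disch := omega) only [up_self, up_lt]⟩ z
  have h1 : ∀ {D H}, D ε z → H ε z → Recursion Step c D H → ∀ Q, Q ε D → ∀ a, a ε Q ∨ a ε c →
      (OPairIn H₁ Q a ↔ OPairIn H Q a) := by
    intro D H hD hH hDH Q hQ a ha
    have haz : a ε z := by
      rcases ha with ha | ha
      · exact hz.1 Q (hz.1 D hD Q hQ) a ha
      · exact hz.1 c (he₀z ci hci) a ha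
    constructor
    · rintro ⟨p, hp, hpa⟩
      obtain ⟨-, D', hD', H', hH', hr, hpH, Q', hQ', b, hb, hpb⟩ := (hH₁ p).1 hp
      obtain ⟨rfl, rfl⟩ := hpa.inj hpb
      exact (hM.recursion_unique hloc hr hDH hQ' hQ ha).1 ⟨p, hpH, hpa⟩
    · rintro ⟨p, hp, hpa⟩
      exact ⟨p, (hH₁ p).2 ⟨hz.1 H hH p hp, D, hD, H, hH, hDH, hp, Q, hQ, a, haz, hpa⟩, hpa⟩
  have h2 : ∀ {D H}, D ε z → H ε z → Recursion Step c D H → ∀ Q, Q ε D → ∀ a, a ε Q ∨ a ε c →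
      (OPairIn H₂ Q a ↔ OPairIn H Q a) := by
    intro D H hD hH hDH Q hQ a ha
    rw [← h1 hD hH hDH Q hQ a ha]
    constructor
    · rintro ⟨p, hp, hpa⟩
      rcases ((hH₂ p).1 hp).2 with h | ⟨b, -, hb, -⟩
      · exact ⟨p, h, hpa⟩
      · obtain ⟨rfl, -⟩ := hpa.inj hb
        exact absurd hQ (hxD D H hD hH hDH)
    · rintro ⟨p, hp, hpa⟩
      exact ⟨p, (hH₂ p).2 ⟨((hH₁ p).1 hp).1, .inl hp⟩, hpa⟩
  refine ⟨D₂, H₂, ⟨?_, ?_⟩, (hD₂ x).2 ⟨hxz, .inl rfl⟩⟩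
  · intro Q hQ y hy
    obtain ⟨hQz, hQ⟩ := (hD₂ Q).1 hQ
    refine (hD₂ y).2 ⟨hz.1 Q hQz y hy, .inr ?_⟩
    rcases hQ with rfl | ⟨D, hD, H, hH, hr, hQD⟩
    · obtain ⟨D, H, hD, hH, hr, hyD⟩ := hrec y hy
      exact ⟨D, hD, H, hH, hr, hyD⟩
    · exact ⟨D, hD, H, hH, hr, hr.1 Q hQD y hy⟩
  · intro P hP a ha
    obtain ⟨hPz, hP⟩ := (hD₂ P).1 hP
    rcases hP with rfl | ⟨D, hD, H, hH, hr, hPD⟩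
    · have haz : a ε z := by
        rcases ha with ha | ha
        · exact hz.1 _ hPz a ha
        · exact hz.1 c (he₀z ci hci) a ha
      have h12 : ∀ Q, Q ε P → ∀ b, b ε Q ∨ b ε c → (OPairIn H₁ Q b ↔ OPairIn H₂ Q b) := by
        intro Q hQ b hb
        obtain ⟨D, H, hD, hH, hr, hyD⟩ := hrec Q hQ
        rw [h1 hD hH hr Q hyD b hb, h2 hD hH hr Q hyD b hb]
      constructor
      · rintro ⟨p, hp, hpa⟩
        rcases ((hH₂ p).1 hp).2 with h | ⟨b, -, hb, hs⟩
        · obtain ⟨-, D', hD', H', hH', hr, hpH, Q', hQ', b, hb, hpb⟩ := (hH₁ p).1 h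
          obtain ⟨rfl, rfl⟩ := hpa.inj hpb
          exact absurd hQ' (hxD D' H' hD' hH' hr)
        · obtain ⟨-, rfl⟩ := hpa.inj hb
          exact hloc _ _ _ _ h12 hs
      · intro hs
        obtain ⟨p, hp, hpa⟩ := hpair P a hPz haz
        exact ⟨p, (hH₂ p).2 ⟨hp, .inr ⟨a, haz, hpa,
          hloc _ _ _ _ (fun Q hQ b hb => (h12 Q hQ b hb).symm) hs⟩⟩, hpa⟩
    · rw [h2 hD hH hr P hPD a ha, hr.2 P hPD a ha]
      have key : ∀ Q, Q ε P → ∀ b, b ε Q ∨ b ε c → (OPairIn H Q b ↔ OPairIn H₂ Q b) :=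
        fun Q hQ b hb => (h2 hD hH hr Q (hr.1 P hPD Q hQ) b hb).symm
      exact ⟨hloc _ _ _ _ key, hloc _ _ _ _ fun Q hQ b hb => (key Q hQ b hb).symm⟩

end KPModel

end Recursion

/-! ## Sequences, bad sets and descending functions -/

/-- `Entry` with bounded quantifiers. -/
def EntryB (s n u x : ℕ) : Fml :=
  ExIn s fun p => ExIn p fun a => ExIn a fun v => IsPair p n v ⋏ IsPair v u x

/-- The sequences `s` and `t` agree below `k`, with bounded quantifiers. -/
def AgreeB (s t k : ℕ) : Fml :=
  (AllIn s fun p => (ExPair p fun i _ => i ∊ k) ⟶ᶠ p ∊ t) ⋏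
    AllIn t fun p => (ExPair p fun i _ => i ∊ k) ⟶ᶠ p ∊ s

/-- The number `k` is not in the domain of `s`. -/
def NoEntry (s k : ℕ) : Fml := AllIn s fun p => FNeg (ExPair p fun i _ => i ≐ k)

/-- `X` is a set of natural numbers without minimal elements with respect to the relation defined
by `σ` in the transitive set `z`. -/
def BadSet (σ : setLang.Formula (Fin 2)) (X z : ℕ) : Fml :=
  IsTrans z ⋏ AllIn X fun y => y ∊ z ⋏ IsNat y ⋏ ExIn X fun y' => Sat z (Inst σ ![y', y])

/-- `f : w → w` starts with `x` and is descending with respect to the relation defined by `σ`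
in `z`. -/
def Descends (σ : setLang.Formula (Fin 2)) (w f x z : ℕ) : Fml :=
  (AllIn f fun p => ExPair p fun n m => n ∊ w ⋏ m ∊ w) ⋏
  (AllIn w fun n => ExIn w fun m => PairIn f n m ⋏ AllIn w fun m' => PairIn f n m' ⟶ᶠ m' ≐ m) ⋏
  (ExIn w fun o => IsEmp o ⋏ PairIn f o x) ⋏
  AllIn w fun n => AllIn w fun m => AllIn w fun u => AllIn w fun v => IsSucc m n ⟶ᶠ
    PairIn f n u ⟶ᶠ PairIn f m v ⟶ᶠ u ∊ z ⋏ v ∊ z ⋏ Sat z (Inst σ ![v, u])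

section Sequences

variable {M : Type} [setLang.Structure M]

/-- The relation defined by `σ` in `D`. -/
def Sg (σ : setLang.Formula (Fin 2)) (D : Set M) (x y : M) : Prop := Rlz D σ ![x, y] Fin.elim0

def Ent (s n u x : M) : Prop := ∃ p, p ε s ∧ ∃ v, OPair p n v ∧ OPair v u x

def Agr (s t k : M) : Prop := ∀ p i v, OPair p i v → i ε k → (p ε s ↔ p ε t)

def NoEnt (s k : M) : Prop := ∀ p v, OPair p k v → ¬ p ε s

def Bad (σ : setLang.Formula (Fin 2)) (X z : M) : Prop :=
  TransSet z ∧ ∀ y, y ε X → y ε z ∧ Natural y ∧ ∃ y', y' ε X ∧ Sg σ (elts z) y' y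

def Desc (σ : setLang.Formula (Fin 2)) (w f x z : M) : Prop :=
  (∀ p, p ε f → ∃ n m, OPair p n m ∧ n ε w ∧ m ε w) ∧
  (∀ n, n ε w → ∃ m, m ε w ∧ OPairIn f n m ∧ ∀ m', m' ε w → OPairIn f n m' → m' = m) ∧
  (∃ o, o ε w ∧ Emp o ∧ OPairIn f o x) ∧
  ∀ n, n ε w → ∀ m, m ε w → ∀ u, u ε w → ∀ v, v ε w → SuccOf m n → OPairIn f n u →
    OPairIn f m v → u ε z ∧ v ε z ∧ Sg σ (elts z) v u

variable (D : Set M) {n : ℕ} (e : ℕ → M)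

theorem ev_Inst2 (σ : setLang.Formula (Fin 2)) {x y : ℕ} (hx : x < n) (hy : y < n) :
    Ev D (Inst σ ![x, y]) n e ↔ Sg σ D (e x) (e y) := by
  rw [ev_Inst _ _ _ _ (by intro i; fin_cases i <;> simpa), Sg]
  refine iff_of_eq (congrArg₂ _ ?_ rfl)
  funext i
  fin_cases i <;> rfl

/-- The intermediate sets of a Kuratowski pair can be dropped. -/
theorem exPair_iff {p : M} {A : M → M → Prop} :
    (∃ u, u ε p ∧ ∃ x, x ε u ∧ ∃ v, v ε p ∧ ∃ y, y ε v ∧ OPair p x y ∧ A x y) ↔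
      ∃ x y, OPair p x y ∧ A x y := by
  constructor
  · rintro ⟨u, -, x, -, v, -, y, -, h⟩
    exact ⟨x, y, h⟩
  · rintro ⟨x, y, h, hA⟩
    obtain ⟨⟨u, hu, hxu⟩, ⟨v, hv, hyv⟩, -⟩ := id h
    exact ⟨u, hu, x, hxu.1, v, hv, y, hyv.2.1, h, hA⟩

theorem ev_ExPair_univ {p : ℕ} (hp : p < n) (F : ℕ → ℕ → Fml) (A : M → M → Prop)
    (h : ∀ u x v y, Ev univ (F (n + 1) (n + 3)) (n + 4)
      (up (up (up (up e n u) (n + 1) x) (n + 2) v) (n + 3) y) ↔ A x y) :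
    Ev univ (ExPair p F) n e ↔ ∃ x y, OPair (e p) x y ∧ A x y := by
  simp (disch := omega) only [ExPair, ev_ExIn, ev_And, ev_IsPair, up_self, up_lt, sPair_univ,
    mem_univ, true_and]
  rw [← exPair_iff]
  simp only [h]

theorem d0_EntryB {s n' u x : ℕ} (hs : s < n) : IsDelta0 (EntryB s n' u x n) :=
  d0_ExIn hs (d0_ExIn (by omega) (d0_ExIn (by omega) (d0_And (d0_IsPair (by omega))
    (d0_IsPair (by omega)))))

theorem d0_AgreeB {s t k : ℕ} (hs : s < n) (ht : t < n) : IsDelta0 (AgreeB s t k n) :=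
  d0_And (d0_AllIn hs (d0_Imp (d0_ExPair (by omega) (d0_Mem _ _)) (d0_Mem _ _)))
    (d0_AllIn ht (d0_Imp (d0_ExPair (by omega) (d0_Mem _ _)) (d0_Mem _ _)))

theorem d0_NoEntry {s k : ℕ} (hs : s < n) : IsDelta0 (NoEntry s k n) :=
  d0_AllIn hs (d0_Neg (d0_ExPair (by omega) (d0_Eqv _ _)))

theorem d0_BadSet (σ : setLang.Formula (Fin 2)) {X z : ℕ} (hX : X < n) (hz : z < n) :
    IsDelta0 (BadSet σ X z n) :=
  d0_And (d0_IsTrans hz) (d0_AllIn hX (d0_And (d0_Mem _ _) (d0_And (d0_IsNat (by omega))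
    (d0_ExIn (by omega) (d0_Sat (by omega) _)))))

theorem d0_Descends (σ : setLang.Formula (Fin 2)) {w f x z : ℕ} (hw : w < n) (hf : f < n)
    (hz : z < n) : IsDelta0 (Descends σ w f x z n) :=
  d0_And (d0_AllIn hf (d0_ExPair (by omega) (d0_And (d0_Mem _ _) (d0_Mem _ _)))) (d0_And
    (d0_AllIn hw (d0_ExIn (by omega) (d0_And (d0_PairIn (by omega)) (d0_AllIn (by omega)
      (d0_Imp (d0_PairIn (by omega)) (d0_Eqv _ _)))))) (d0_And
    (d0_ExIn hw (d0_And (d0_IsEmp (by omega)) (d0_PairIn (by omega))))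
    (d0_AllIn hw (d0_AllIn (by omega) (d0_AllIn (by omega) (d0_AllIn (by omega)
      (d0_Imp (d0_IsSucc (by omega) (by omega)) (d0_Imp (d0_PairIn (by omega))
        (d0_Imp (d0_PairIn (by omega)) (d0_And (d0_Mem _ _) (d0_And (d0_Mem _ _)
          (d0_Sat (by omega) _))))))))))))

/-- `EntryB` with quantifiers restricted to `D`. -/
def sEnt (s k u x : M) : Prop := Ev D (EntryB 0 1 2 3) 4 (env s [k, u, x])

theorem ev_EntryB {s k u x : ℕ} (hs : s < n) (hk : k < n) (hu : u < n) (hx : x < n) :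
    Ev D (EntryB s k u x) n e ↔ sEnt D (e s) (e k) (e u) (e x) := by
  simp (disch := omega) only [sEnt, EntryB, ExPair, ev_And, ev_Or, ev_Imp, ev_Neg, ev_AllIn,
    ev_ExIn, ev_Mem, ev_Eqv, ev_Bot, ev_IsPair, ev_IsEmp,
    ev_IsSucc, ev_IsTrans, ev_IsNat, ev_PairIn, ev_IsOmega, ev_Sat, ev_Inst2, up_self, up_lt,
      env_nil, env_zero, env_succ]

theorem sEnt_univ (s k u x : M) : sEnt univ s k u x ↔ Ent s k u x := by
  simp (disch := omega) only [sEnt, EntryB, ev_And, ev_Or, ev_Imp, ev_Neg, ev_AllIn, ev_ExIn,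
    ev_Mem, ev_Eqv, ev_Bot, ev_IsPair, ev_IsEmp,
    ev_IsSucc, ev_IsTrans, ev_IsNat, ev_PairIn, ev_IsOmega, ev_Sat, ev_Inst2, up_self, up_lt,
      env_nil, env_zero, env_succ, sPair_univ, sEmp_univ, sSucc_univ, sTrans_univ, sNat_univ,
        sPairIn_univ, sOmega_univ, univ_inter, mem_univ, true_and, true_imp_iff, forall_const,
          imp_false]
  refine exists_congr fun p => and_congr Iff.rfl ?_
  constructor
  · rintro ⟨a, -, v, -, h⟩
    exact ⟨v, h⟩
  · rintro ⟨v, h, h'⟩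
    obtain ⟨-, ⟨a, ha, hv⟩, -⟩ := id h
    exact ⟨a, ha, v, hv.2.1, h, h'⟩

variable {D} in
theorem sEnt_iff (hD : TransClass D) {s k u x : M} (hs : s ∈ D) (hk : k ∈ D) (hu : u ∈ D)
    (hx : x ∈ D) :
    sEnt D s k u x ↔ Ent s k u x := by
  rw [← sEnt_univ]
  refine ev_absolute (d0_EntryB (by omega)) (subset_univ D) hD _ fun i hi => ?_
  interval_cases i <;> assumption

/-- `AgreeB` with quantifiers restricted to `D`. -/
def sAgr (s t k : M) : Prop := Ev D (AgreeB 0 1 2) 3 (env s [t, k])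

theorem ev_AgreeB {s t k : ℕ} (hs : s < n) (ht : t < n) (hk : k < n) :
    Ev D (AgreeB s t k) n e ↔ sAgr D (e s) (e t) (e k) := by
  simp (disch := omega) only [sAgr, AgreeB, ExPair, ev_And, ev_Or, ev_Imp, ev_Neg, ev_AllIn,
    ev_ExIn, ev_Mem, ev_Eqv, ev_Bot, ev_IsPair, ev_IsEmp,
    ev_IsSucc, ev_IsTrans, ev_IsNat, ev_PairIn, ev_IsOmega, ev_Sat, ev_Inst2, up_self, up_lt,
      env_nil, env_zero, env_succ]

theorem sAgr_univ (s t k : M) : sAgr univ s t k ↔ Agr s t k := by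
  have h : ∀ s' p, Ev univ (ExPair 3 fun i _ => i ∊ 2) 4 (up (env s' [t, k]) 3 p) ↔
      ∃ i v, OPair p i v ∧ i ε k := fun s' p => ev_ExPair_univ _ (by omega) _ (fun i _ => i ε k)
    fun u x v y => by simp (disch := omega) only [ev_Mem, up_self, up_lt, env_nil, env_zero,
      env_succ]
  simp (disch := omega) only [sAgr, AgreeB, ev_And, ev_AllIn, ev_Imp, h, ev_Mem, up_self, up_lt,
    env_nil, env_zero, env_succ, sPair_univ, sEmp_univ, sSucc_univ, sTrans_univ, sNat_univ,
      sPairIn_univ, sOmega_univ, univ_inter, mem_univ, true_and, true_imp_iff, forall_const,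
        imp_false]
  constructor
  · rintro ⟨h1, h2⟩ p i v hp hi
    exact ⟨fun hs => h1 p hs ⟨i, v, hp, hi⟩, fun ht => h2 p ht ⟨i, v, hp, hi⟩⟩
  · intro h
    exact ⟨fun p hp ⟨i, v, h1, h2⟩ => (h p i v h1 h2).1 hp,
      fun p hp ⟨i, v, h1, h2⟩ => (h p i v h1 h2).2 hp⟩

variable {D} in
theorem sAgr_iff (hD : TransClass D) {s t k : M} (hs : s ∈ D) (ht : t ∈ D) (hk : k ∈ D) :
    sAgr D s t k ↔ Agr s t k := by
  rw [← sAgr_univ]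
  refine ev_absolute (d0_AgreeB (by omega) (by omega)) (subset_univ D) hD _ fun i hi => ?_
  interval_cases i <;> assumption

/-- `NoEntry` with quantifiers restricted to `D`. -/
def sNoEnt (s k : M) : Prop := Ev D (NoEntry 0 1) 2 (env s [k])

theorem ev_NoEntry {s k : ℕ} (hs : s < n) (hk : k < n) :
    Ev D (NoEntry s k) n e ↔ sNoEnt D (e s) (e k) := by
  simp (disch := omega) only [sNoEnt, NoEntry, ExPair, ev_And, ev_Or, ev_Imp, ev_Neg, ev_AllIn,
    ev_ExIn, ev_Mem, ev_Eqv, ev_Bot, ev_IsPair, ev_IsEmp,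
    ev_IsSucc, ev_IsTrans, ev_IsNat, ev_PairIn, ev_IsOmega, ev_Sat, ev_Inst2, up_self, up_lt,
      env_nil, env_zero, env_succ]

theorem sNoEnt_univ (s k : M) : sNoEnt univ s k ↔ NoEnt s k := by
  have h : ∀ p, Ev univ (ExPair 2 fun i _ => i ≐ 1) 3 (up (env s [k]) 2 p) ↔
      ∃ i v, OPair p i v ∧ i = k := fun p => ev_ExPair_univ _ (by omega) _ (fun i _ => i = k)
    fun u x v y => by simp (disch := omega) only [ev_Eqv, up_self, up_lt, env_nil, env_zero,
      env_succ]
  simp (disch := omega) only [sNoEnt, NoEntry, ev_Neg, ev_AllIn, h, up_self, up_lt, env_nil,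
    env_zero, env_succ, sPair_univ, sEmp_univ, sSucc_univ, sTrans_univ, sNat_univ, sPairIn_univ,
      sOmega_univ, univ_inter, mem_univ, true_and, true_imp_iff, forall_const, imp_false]
  constructor
  · intro h p v hp hps
    exact h p hps ⟨k, v, hp, rfl⟩
  · rintro h p hps ⟨i, v, hp, rfl⟩
    exact h p v hp hps

variable {D} in
theorem sNoEnt_iff (hD : TransClass D) {s k : M} (hs : s ∈ D) (hk : k ∈ D) :
    sNoEnt D s k ↔ NoEnt s k := by
  rw [← sNoEnt_univ]
  refine ev_absolute (d0_NoEntry (by omega)) (subset_univ D) hD _ fun i hi => ?_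
  interval_cases i <;> assumption

/-- `BadSet` with quantifiers restricted to `D`. -/
def sBad (σ : setLang.Formula (Fin 2)) (X z : M) : Prop := Ev D (BadSet σ 0 1) 2 (env X [z])

theorem ev_BadSet (σ : setLang.Formula (Fin 2)) {X z : ℕ} (hX : X < n) (hz : z < n) :
    Ev D (BadSet σ X z) n e ↔ sBad D σ (e X) (e z) := by
  simp (disch := omega) only [sBad, BadSet, ExPair, ev_And, ev_Or, ev_Imp, ev_Neg, ev_AllIn,
    ev_ExIn, ev_Mem, ev_Eqv, ev_Bot, ev_IsPair, ev_IsEmp,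
    ev_IsSucc, ev_IsTrans, ev_IsNat, ev_PairIn, ev_IsOmega, ev_Sat, ev_Inst2, up_self, up_lt,
      env_nil, env_zero, env_succ]

theorem sBad_univ (σ : setLang.Formula (Fin 2)) (X z : M) : sBad univ σ X z ↔ Bad σ X z := by
  simp (disch := omega) only [sBad, BadSet, Bad, ev_And, ev_Or, ev_Imp, ev_Neg, ev_AllIn, ev_ExIn,
    ev_Mem, ev_Eqv, ev_Bot, ev_IsPair, ev_IsEmp,
    ev_IsSucc, ev_IsTrans, ev_IsNat, ev_PairIn, ev_IsOmega, ev_Sat, ev_Inst2, up_self, up_lt,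
      env_nil, env_zero, env_succ, sPair_univ, sEmp_univ, sSucc_univ, sTrans_univ, sNat_univ,
        sPairIn_univ, sOmega_univ, univ_inter, mem_univ, true_and, true_imp_iff, forall_const,
          imp_false]

variable {D} in
theorem sBad_iff (hD : TransClass D) {σ : setLang.Formula (Fin 2)} {X z : M} (hX : X ∈ D)
    (hz : z ∈ D) :
    sBad D σ X z ↔ Bad σ X z := by
  rw [← sBad_univ]
  refine ev_absolute (d0_BadSet σ (by omega) (by omega)) (subset_univ D) hD _ fun i hi => ?_
  interval_cases i <;> assumption

/-- `Descends` with quantifiers restricted to `D`. -/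
def sDesc (σ : setLang.Formula (Fin 2)) (w f x z : M) : Prop := Ev D (Descends σ 0 1 2 3) 4 (env w
    [f, x, z])

theorem ev_Descends (σ : setLang.Formula (Fin 2)) {w f x z : ℕ} (hw : w < n) (hf : f < n)
    (hx : x < n) (hz : z < n) :
    Ev D (Descends σ w f x z) n e ↔ sDesc D σ (e w) (e f) (e x) (e z) := by
  simp (disch := omega) only [sDesc, Descends, ExPair, ev_And, ev_Or, ev_Imp, ev_Neg, ev_AllIn,
    ev_ExIn, ev_Mem, ev_Eqv, ev_Bot, ev_IsPair, ev_IsEmp,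
    ev_IsSucc, ev_IsTrans, ev_IsNat, ev_PairIn, ev_IsOmega, ev_Sat, ev_Inst2, up_self, up_lt,
      env_nil, env_zero, env_succ]

theorem sDesc_univ (σ : setLang.Formula (Fin 2)) (w f x z : M) : sDesc univ σ w f x z ↔ Desc σ w f
    x z := by
  have h : ∀ p, Ev univ (ExPair 4 fun n m => n ∊ 0 ⋏ m ∊ 0) 5 (up (env w [f, x, z]) 4 p) ↔
      ∃ n m, OPair p n m ∧ n ε w ∧ m ε w := fun p =>
    ev_ExPair_univ _ (by omega) _ (fun n m => n ε w ∧ m ε w) fun u x v y => by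
      simp (disch := omega) only [ev_And, ev_Mem, up_self, up_lt, env_nil, env_zero, env_succ]
  simp (disch := omega) only [sDesc, Descends, Desc, h, ev_And, ev_Or, ev_Imp, ev_Neg, ev_AllIn,
    ev_ExIn, ev_Mem, ev_Eqv, ev_Bot, ev_IsPair, ev_IsEmp,
    ev_IsSucc, ev_IsTrans, ev_IsNat, ev_PairIn, ev_IsOmega, ev_Sat, ev_Inst2, up_self, up_lt,
      env_nil, env_zero, env_succ, sPair_univ, sEmp_univ, sSucc_univ, sTrans_univ, sNat_univ,
        sPairIn_univ, sOmega_univ, univ_inter, mem_univ, true_and, true_imp_iff, forall_const,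
          imp_false]

variable {D} in
theorem sDesc_iff (hD : TransClass D) {σ : setLang.Formula (Fin 2)} {w f x z : M} (hw : w ∈ D)
    (hf : f ∈ D) (hx : x ∈ D) (hz : z ∈ D) :
    sDesc D σ w f x z ↔ Desc σ w f x z := by
  rw [← sDesc_univ]
  refine ev_absolute (d0_Descends σ (by omega) (by omega) (by omega))
    (subset_univ D) hD _ fun i hi => ?_
  interval_cases i <;> assumption

end Sequences

/-! ### Descending functions through sets without minimal elements -/

section Descent

variable {M : Type} [setLang.Structure M] {N : ℕ}

namespace KPModel

theorem exists_minimal (hM : KPModel N M)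
    {A : M → Prop} (hA : DefinableClass A) {x : M} (hx : A x) :
    ∃ m, A m ∧ ∀ y, y ε m → ¬ A y := by
  by_contra h
  push Not at h
  obtain ⟨F, n, e, hF⟩ := hA
  refine hM.mem_induction (A := fun x => ¬ A x) ⟨FNeg F, n, e, fun x => by rw [ev_Neg, hF]⟩
    (fun x ih hx => ?_) x hx
  obtain ⟨y, hy, hy'⟩ := h x hx
  exact ih y hy hy'

theorem pred_unique (hM : KPModel N M)
    {x y y' : M} (hx : Natural x) (h : SuccOf x y) (h' : SuccOf x y') : y = y' := by
  rcases h.2.2 y' h'.1 with h1 | h1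
  · rcases h'.2.2 y h.1 with h2 | h2
    · exact absurd ((hx.2.1 y h.1) y' h1 y h2) (hM.mem_irrefl y)
    · exact h2
  · exact h1.symm

/-- Recursion along `ω`. No choice is needed: the next value is the `∈`-least element of `X` below
the current value, and `∈` is a linear ordering of the natural numbers. -/
theorem exists_descends (hM : KPModel N M)
    (hN : 3 ≤ N) {σ : setLang.Formula (Fin 2)} {w X z x : M} (hw : Omega w)
    (hX : Bad σ X z) (hx : x ε X) : ∃ f, Desc σ w f x z := by
  set Step : M → M → M → Prop := fun P a H => a ε X ∧ ((Emp P ∧ a = x) ∨ ∃ n, n ε P ∧ SuccOf P n ∧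
    ∃ y, y ε w ∧ OPairIn H n y ∧ Sg σ (elts z) a y ∧
      ∀ b, b ε a → ¬ (b ε X ∧ Sg σ (elts z) b y)) with hStep
  have hS : StepDef (fun P a H => a ∊ 1 ⋏ ((IsEmp P ⋏ a ≐ 3) ⋎ ExIn P fun n => IsSucc P n ⋏
      ExIn 0 fun y => PairIn H n y ⋏ Sat 2 (Inst σ ![a, y]) ⋏
        AllIn a fun b => FNeg (b ∊ 1 ⋏ Sat 2 (Inst σ ![b, y])))) 4 (env w [X, z, x]) Step :=
    { d0 := fun hk hP ha hH => d0_And (d0_Mem _ _) (d0_Or (d0_And (d0_IsEmp hP) (d0_Eqv _ _))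
        (d0_ExIn hP (d0_And (d0_IsSucc (by omega) (by omega)) (d0_ExIn (by omega)
          (d0_And (d0_PairIn (by omega)) (d0_And (d0_Sat (by omega) _) (d0_AllIn (by omega)
            (d0_Neg (d0_And (d0_Mem _ _) (d0_Sat (by omega) _))))))))))
      ev := fun {n P a H e} hk hP ha hH he => by
        have h0 : e 0 = w := he 0 (by omega)
        have h1 : e 1 = X := he 1 (by omega)
        have h2 : e 2 = z := he 2 (by omega)
        have h3 : e 3 = x := he 3 (by omega)
        simp (disch := omega) only [ev_And, ev_Or, ev_Neg, ev_AllIn, ev_ExIn, ev_Mem, ev_Eqv,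
          ev_IsEmp, ev_IsSucc, ev_PairIn, ev_Sat, ev_Inst2, up_self, up_lt, sEmp_univ, sSucc_univ,
          sPairIn_univ, univ_inter, mem_univ, true_and, true_imp_iff, h0, h1, h2, h3, hStep] }
  -- The extra set of arguments is `ω`, because the value at `n` need not be an element of `n`.
  obtain ⟨D, H, hr, hwD⟩ := hM.exists_recursion hN hS (ci := 0) (by omega) (by
    rintro P a H H' h ⟨ha, hs⟩
    refine ⟨ha, hs.imp_right ?_⟩
    rintro ⟨n, hn, hPn, y, hy, hny, h'⟩
    exact ⟨n, hn, hPn, y, hy, (h n hn y (.inr hy)).1 hny, h'⟩) w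
  have hrec : ∀ n, n ε w → ∀ y, y ε w → (OPairIn H n y ↔ Step n y H) := fun n hn y hy =>
    hr.2 n (hr.1 w hwD n hn) y (.inr hy)
  have hXw : ∀ y, y ε X → y ε w := fun y hy => hM.natural_mem_omega hw y (hX.2 y hy).2.1
  have hU : ∀ n, Natural n → ∃ y, y ε w ∧ OPairIn H n y ∧ ∀ y',
    y' ε w → OPairIn H n y' → y' = y := by
    refine hM.nat_induction ⟨ExIn 0 fun y => PairIn 1 2 y ⋏ AllIn 0 fun y' => PairIn 1 2 y' ⟶ᶠ y' ≐
      y,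
      2, env w [H], fun n => ?_⟩ ?_ ?_
    · simp (disch := omega) only [ev_And, ev_Imp, ev_AllIn, ev_ExIn, ev_Eqv,
          ev_PairIn, up_self, up_lt, env_zero, env_succ, env_nil,
          sPairIn_univ, univ_inter, mem_univ, true_and, true_imp_iff]
    · intro n hn
      have hnw := hM.natural_mem_omega hw n (natural_emp hn)
      refine ⟨x, hXw x hx, (hrec n hnw x (hXw x hx)).2 ⟨hx, .inl ⟨hn, rfl⟩⟩, fun y' hy' h => ?_⟩
      rcases ((hrec n hnw y' hy').1 h).2 with h | ⟨m, hm, -⟩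
      · exact h.2
      · exact absurd hm (hn m)
    · rintro n m hn hm ⟨y, hy, hny, hun⟩
      have hmw := hM.natural_mem_omega hw m (hn.succ hm)
      have hyX := ((hrec n (hM.natural_mem_omega hw n hn) y hy).1 hny).1
      obtain ⟨-, -, y₁, hy₁, hyy₁⟩ := hX.2 y hyX
      obtain ⟨a, ⟨haX, hay⟩, hmin⟩ := hM.exists_minimal (A := fun b => b ε X ∧ Sg σ (elts z) b y)
        ⟨3 ∊ 0 ⋏ Sat 1 (Inst σ ![3, 2]), 3, env X [z, y], fun b => by
          simp (disch := omega) only [ev_And, ev_Mem, ev_Sat, ev_Inst2, up_self, up_lt, env_zero,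
            env_succ, env_nil, univ_inter]⟩ ⟨hy₁, hyy₁⟩
      refine ⟨a, hXw a haX, (hrec m hmw a (hXw a haX)).2
        ⟨haX, .inr ⟨n, hm.1, hm, y, hy, hny, hay, hmin⟩⟩, fun b hb hmb => ?_⟩
      obtain ⟨hbX, h | ⟨n', hn', hmn', y', hy', hny', hby, hbmin⟩⟩ := (hrec m hmw b hb).1 hmb
      · exact absurd hm.1 (h.1 n)
      · obtain rfl := hM.pred_unique (hn.succ hm) hm hmn'
        obtain rfl := hun y' hy' hny'
        rcases hM.nat_trichotomy (hX.2 b hbX).2.1 (hX.2 a haX).2.1 with h | h | h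
        · exact absurd ⟨hbX, hby⟩ (hmin b h)
        · exact h
        · exact absurd ⟨haX, hay⟩ (hbmin a h)
  -- The recursion determines `H` only at its intended arguments; everything outside `ω × ω` is
  -- discarded.
  obtain ⟨f, hf⟩ := hM.separation (A := fun p => ∃ n, n ε w ∧ ∃ m, m ε w ∧ OPair p n m)
    ⟨ExIn 0 fun n => ExIn 0 fun m => IsPair 1 n m, 1, env w [],
      d0_ExIn (by omega) (d0_ExIn (by omega) (d0_IsPair (by omega))), fun p => by
        simp (disch := omega) only [ev_And, ev_ExIn, ev_IsPair, up_self, up_lt, env_zero,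
            env_succ, env_nil, sPair_univ, mem_univ, true_and]⟩ H
  have hfH : ∀ n, n ε w → ∀ y, y ε w → (OPairIn f n y ↔ OPairIn H n y) := by
    intro n hn y hy
    constructor
    · rintro ⟨p, hp, h⟩
      exact ⟨p, ((hf p).1 hp).1, h⟩
    · rintro ⟨p, hp, h⟩
      exact ⟨p, (hf p).2 ⟨hp, n, hn, y, hy, h⟩, h⟩
  refine ⟨f, ?_, ?_, ?_, ?_⟩
  · intro p hp
    obtain ⟨-, n, hn, m, hm, h⟩ := (hf p).1 hp
    exact ⟨n, m, h, hn, hm⟩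
  · intro n hn
    obtain ⟨y, hy, hny, hun⟩ := hU n (hw.2.2 n hn)
    exact ⟨y, hy, (hfH n hn y hy).2 hny, fun y' hy' h => hun y' hy' ((hfH n hn y' hy').1 h)⟩
  · obtain ⟨o, ho, ho'⟩ := hw.1
    exact ⟨o, ho, ho', (hfH o ho x (hXw x hx)).2
      ((hrec o ho x (hXw x hx)).2 ⟨hx, .inl ⟨ho', rfl⟩⟩)⟩
  · intro n hn m hm u hu v hv hmn hnu hmv
    rw [hfH n hn u hu] at hnu
    rw [hfH m hm v hv] at hmv
    have huX := ((hrec n hn u hu).1 hnu).1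
    obtain ⟨hvX, h | ⟨n', hn', hmn', y', hy', hny', hby, -⟩⟩ := (hrec m hm v hv).1 hmv
    · exact absurd hmn.1 (h.1 n)
    · obtain rfl := hM.pred_unique (hw.2.2 m hm) hmn hmn'
      obtain ⟨y, hy, hny, hun⟩ := hU n (hw.2.2 n hn)
      obtain rfl := hun y' hy' hny'
      obtain rfl := hun u hu hnu
      exact ⟨(hX.2 u huX).1, (hX.2 v hvX).1, hby⟩

end KPModel

end Descent

/-! ## Towers of exponential orderings with bounded quantifiers -/

/-- The comparison of the sequences `s` and `t` at the place `k`. -/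
def CoreAt (C : ℕ → ℕ → Fml) (τ : setLang.Formula (Fin 2)) (s t k : ℕ) : Fml :=
  FEx fun u' => FEx fun x' => EntryB t k u' x' ⋏ AgreeB s t k ⋏ (NoEntry s k ⋎
    FEx fun u => FEx fun x => EntryB s k u x ⋏ (C u u' ⋎ (u ≐ u' ⋏ Rel τ x x')))

/-- The ordering of height `h`, without the condition on the domain. -/
def Core (N : ℕ) (σ : ℕ → setLang.Formula (Fin 2)) : ℕ → ℕ → ℕ → Fml
  | 0 => Rel (σ (N - 1))
  | h + 1 => fun s t => FEx fun k => IsNat k ⋏ CoreAt (Core N σ h) (σ (N - 1 - (h + 1))) s t k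

/-- The ordering of height `h + 1` restricted to differences at places in `m`. -/
def CoreBelow (N : ℕ) (σ : ℕ → setLang.Formula (Fin 2)) (h : ℕ) (s t m : ℕ) : Fml :=
  FEx fun k => k ∊ m ⋏ CoreAt (Core N σ h) (σ (N - 1 - (h + 1))) s t k

/-- `x` is in no bad set. -/
def InWfB (τ : setLang.Formula (Fin 2)) (x : ℕ) : Fml :=
  IsNat x ⋏ FNeg (FEx fun X => FEx fun z => BadSet τ X z ⋏ x ∊ X)

/-- The domain of the ordering of height `h`. -/
def DomB (N : ℕ) (σ : ℕ → setLang.Formula (Fin 2)) : ℕ → ℕ → Fml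
  | 0 => IsNat
  | h + 1 => fun s =>
    (FAll fun n => FAll fun u => FAll fun x => EntryB s n u x ⟶ᶠ
      IsNat n ⋏ DomB N σ h u ⋏ InWfB (σ (N - 1 - (h + 1))) x) ⋏
    (FAll fun n => FAll fun m => FAll fun u => FAll fun x => FAll fun u' => FAll fun x' =>
      IsSucc m n ⟶ᶠ EntryB s n u x ⟶ᶠ EntryB s m u' x' ⟶ᶠ Core N σ h u' u) ⋏
    (FAll fun n => FAll fun u => FAll fun x => FAll fun u' => FAll fun x' =>
      EntryB s n u x ⟶ᶠ EntryB s n u' x' ⟶ᶠ u ≐ u' ⋏ x ≐ x') ⋏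
    FAll fun n => FAll fun m => FAll fun u' => FAll fun x' =>
      IsSucc m n ⟶ᶠ EntryB s m u' x' ⟶ᶠ FEx fun u => FEx fun x => EntryB s n u x

/-- Bad sets have descending functions. -/
def DescentAx (τ : setLang.Formula (Fin 2)) : Fml :=
  FAll fun w => FAll fun X => FAll fun z => FAll fun x =>
    IsOmega w ⟶ᶠ BadSet τ X z ⟶ᶠ x ∊ X ⟶ᶠ FEx fun f => Descends τ w f x z

/-- The basic closure properties of universes. -/
def BaseAx (N : ℕ) (σ : ℕ → setLang.Formula (Fin 2)) : Fml :=
  Conj ((List.range (N - 2)).map fun i =>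
    Transitivity (Rel (σ (i + 2))) ⋏ DescentAx (σ (i + 2))) ⋏
  FAll fun a => FAll fun b => FEx fun p => IsPair p a b

/-! ### Complexity of the bounded towers -/

section TowerComplexity

variable {N : ℕ} {σ : ℕ → setLang.Formula (Fin 2)} {n : ℕ}

theorem hl_Rel {τ : setLang.Formula (Fin 2)} (hτ : IsSigma 1 τ) {x y : ℕ} (hx : x < n)
    (hy : y < n) : HasLevy .sigma 1 (Rel τ x y n) :=
  hl_And (hl_d0 (d0_IsNat hx)) (hl_And (hl_d0 (d0_IsNat hy))
    (hl_Inst hτ (by intro i; fin_cases i <;> simpa)))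

theorem hl_CoreAt {C : ℕ → ℕ → Fml} {τ : setLang.Formula (Fin 2)} (hτ : IsSigma 1 τ)
    (hC : ∀ {n x y : ℕ}, x < n → y < n → HasLevy .sigma 1 (C x y n)) {s t k : ℕ} (hs : s < n)
    (ht : t < n) : HasLevy .sigma 1 (CoreAt C τ s t k n) := by
  refine hl_Ex (hl_Ex (hl_And (hl_d0 (d0_EntryB (by omega))) (hl_And
    (hl_d0 (d0_AgreeB (by omega) (by omega))) (hl_Or (hl_d0 (d0_NoEntry (by omega)))
      (hl_Ex (hl_Ex (hl_And (hl_d0 (d0_EntryB (by omega))) (hl_Or (hC (by omega) (by omega))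
        (hl_And (hl_d0 (d0_Eqv _ _)) (hl_Rel hτ (by omega) (by omega)))))))))))

/-- Entries and agreement are bounded, so the only unbounded quantifiers are existential ones,
including those of the `Σ₁`-relations; the height does not raise the complexity. -/
theorem hl_Core (hN : 3 ≤ N) (hσ : ∀ i, 2 ≤ i → i ≤ N - 1 → IsSigma 1 (σ i)) {h : ℕ}
    (hh : h ≤ N - 3) {n s t : ℕ} (hs : s < n) (ht : t < n) :
    HasLevy .sigma 1 (Core N σ h s t n) := by
  induction h generalizing n s t with
  | zero => exact hl_Rel (hσ _ (by omega) (by omega)) hs ht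
  | succ h ih =>
    have hτ := hσ (N - 1 - (h + 1)) (by omega) (by omega)
    unfold Core
    exact hl_Ex (hl_And (hl_d0 (d0_IsNat (by omega))) (hl_CoreAt hτ
      (fun hx hy => ih (by omega) hx hy) (by omega) (by omega)))

theorem hl_CoreBelow (hN : 3 ≤ N) (hσ : ∀ i, 2 ≤ i → i ≤ N - 1 → IsSigma 1 (σ i)) {h : ℕ}
    (hh : h + 1 ≤ N - 3) {n s t m : ℕ} (hs : s < n) (ht : t < n) :
    HasLevy .sigma 1 (CoreBelow N σ h s t m n) :=
  hl_Ex (hl_And (hl_d0 (d0_Mem _ _)) (hl_CoreAt (hσ _ (by omega) (by omega))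
    (fun hx hy => hl_Core (h := h) hN hσ (by omega) hx hy) (by omega) (by omega)))

theorem hl_InWfB (τ : setLang.Formula (Fin 2)) {x : ℕ} (hx : x < n) :
    HasLevy .pi 1 (InWfB τ x n) :=
  hl_And (hl_d0 (d0_IsNat hx)) (hl_Neg (hl_Ex (hl_Ex (hl_d0
    (d0_And (d0_BadSet τ (by omega) (by omega)) (d0_Mem _ _))))))

/-- The order condition contributes a `Σ₁`-conclusion, wellfoundedness is `Π₁`, and the rest is
universal. Staying at `Π₂` for every height is what allows the domain to occur on either side of an
implication at level three or above. -/
theorem hl_DomB (hN : 3 ≤ N) (hσ : ∀ i, 2 ≤ i → i ≤ N - 1 → IsSigma 1 (σ i)) {h : ℕ}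
    (hh : h ≤ N - 3) {n s : ℕ} (hs : s < n) : HasLevy .pi 2 (DomB N σ h s n) := by
  induction h generalizing n s with
  | zero => exact hl_d0 (d0_IsNat hs)
  | succ h ih =>
    refine hl_And (hl_All (hl_All (hl_All (hl_Imp (hl_d0 (d0_EntryB (by omega))) (hl_And
      (hl_d0 (d0_IsNat (by omega))) (hl_And (ih (by omega) (by omega))
        ((hl_InWfB _ (by omega)).lt (by omega)))))))) (hl_And ?_ (hl_And ?_ ?_))
    · exact hl_All (hl_All (hl_All (hl_All (hl_All (hl_All (hl_Imp
        (hl_d0 (d0_IsSucc (by omega) (by omega))) (hl_Imp (hl_d0 (d0_EntryB (by omega)))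
          (hl_Imp (hl_d0 (d0_EntryB (by omega)))
            ((hl_Core hN hσ (by omega) (by omega) (by omega)).lt (by omega))))))))))
    · exact hl_All (hl_All (hl_All (hl_All (hl_All (hl_d0 (d0_Imp (d0_EntryB (by omega))
        (d0_Imp (d0_EntryB (by omega)) (d0_And (d0_Eqv _ _) (d0_Eqv _ _)))))))))
    · exact hl_All (hl_All (hl_All (hl_All (hl_Imp (hl_d0 (d0_IsSucc (by omega) (by omega)))
        (hl_Imp (hl_d0 (d0_EntryB (by omega))) ((hl_Ex (k := 0) (hl_Ex (hl_d0
          (d0_EntryB (by omega))))).lt (by omega)))))))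

theorem hl_Conj {s : Side} {k : ℕ} (l : List Fml) (hl : ∀ F ∈ l, HasLevy s k (F n)) :
    HasLevy s k (Conj l n) := by
  induction l with
  | nil => exact hl_d0 (d0_Neg d0_Bot)
  | cons F l ih =>
    change HasLevy s k (FAnd F (Conj l) n)
    exact hl_And (hl F (by simp)) (ih fun G hG => hl G (by simp [hG]))

theorem hl_BaseAx (hσ : ∀ i, 2 ≤ i → i ≤ N - 1 → IsSigma 1 (σ i)) :
    HasLevy .pi 2 (BaseAx N σ n) := by
  unfold BaseAx
  refine hl_And (hl_Conj _ ?_) (hl_All (hl_All (HasLevy.lt (s := .sigma) (k := 1)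
    (hl_Ex (hl_d0 (d0_IsPair (by omega)))) (by omega))))
  intro F hF
  simp only [List.mem_map, List.mem_range] at hF
  obtain ⟨i, hi, rfl⟩ := hF
  have hσi := hσ (i + 2) (by omega) (by omega)
  refine hl_And (hl_All (hl_All (hl_All (hl_Imp ((hl_Rel hσi (by omega) (by omega)).lt (by omega))
    (hl_Imp ((hl_Rel hσi (by omega) (by omega)).lt (by omega))
      ((hl_Rel hσi (by omega) (by omega)).lt (by omega))))))) ?_
  unfold DescentAx
  refine hl_All (hl_All (hl_All (hl_All (hl_Imp (hl_d0 (d0_IsOmega (by omega))) ?_))))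
  refine hl_Imp (hl_d0 (d0_BadSet _ (by omega) (by omega))) (hl_Imp (hl_d0 (d0_Mem _ _)) ?_)
  exact HasLevy.lt (s := .sigma) (k := 1) (hl_Ex (hl_d0 (d0_Descends _ (by omega) (by omega)
    (by omega)))) (by omega)

end TowerComplexity

/-! ### The bounded towers in transitive classes -/

section TowerSemantics

variable {M : Type} [setLang.Structure M]

/-- Transitive classes that contain the natural numbers. -/
structure NiceClass (D : Set M) : Prop where
  trans : TransClass D
  nat : ∀ x, Natural x → x ∈ D

theorem niceClass_univ : NiceClass (univ : Set M) := ⟨transClass_univ, fun _ _ => trivial⟩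

theorem KPModel.niceClass {N : ℕ} (hM : KPModel N M) {P : M} (hP : Universe P) :
    NiceClass (elts P) := ⟨hP.transClass, fun _ hx => hM.natural_mem_universe hP hx⟩

theorem Ent.mem {D : Set M} (hD : TransClass D) {s n u x : M} (h : Ent s n u x) (hs : s ∈ D) :
    n ∈ D ∧ u ∈ D ∧ x ∈ D := by
  obtain ⟨p, hp, v, h1, h2⟩ := h
  have hpD := hD s hs p hp
  have hvD := h1.right_mem hD hpD
  exact ⟨h1.left_mem hD hpD, h2.left_mem hD hvD, h2.right_mem hD hvD⟩

/-- The relation on the natural numbers defined by `τ` in `D`. -/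
def NatRel (τ : setLang.Formula (Fin 2)) (D : Set M) (x y : M) : Prop :=
  Natural x ∧ Natural y ∧ Sg τ D x y

def LtAt (C R : M → M → Prop) (s t k : M) : Prop :=
  ∃ u' x', Ent t k u' x' ∧ Agr s t k ∧
    (NoEnt s k ∨ ∃ u x, Ent s k u x ∧ (C u u' ∨ (u = u' ∧ R x x')))

def LtCore (N : ℕ) (σ : ℕ → setLang.Formula (Fin 2)) (D : Set M) : ℕ → M → M → Prop
  | 0 => NatRel (σ (N - 1)) D
  | h + 1 => fun s t => ∃ k, Natural k ∧
      LtAt (LtCore N σ D h) (NatRel (σ (N - 1 - (h + 1))) D) s t k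

def LtBelow (N : ℕ) (σ : ℕ → setLang.Formula (Fin 2)) (D : Set M) (h : ℕ) (s t m : M) : Prop :=
  ∃ k, k ε m ∧ LtAt (LtCore N σ D h) (NatRel (σ (N - 1 - (h + 1))) D) s t k

/-- The relation is evaluated in an element `z` of `D` and not in `D` itself. Hence badness is
bounded and wellfoundedness `Π₁`, and a set bad for the relation of a universe `Q ∈ D` already
refutes wellfoundedness in `D`. -/
def Wf (τ : setLang.Formula (Fin 2)) (D : Set M) (x : M) : Prop :=
  Natural x ∧ ¬ ∃ X ∈ D, ∃ z ∈ D, Bad τ X z ∧ x ε X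

/-- No length and no finiteness are demanded; it suffices that entries are unique and their places
closed under predecessors. This domain contains the literal one, which only strengthens the
iteration. -/
def Dom (N : ℕ) (σ : ℕ → setLang.Formula (Fin 2)) (D : Set M) : ℕ → M → Prop
  | 0 => Natural
  | h + 1 => fun s =>
    (∀ n u x, Ent s n u x → Natural n ∧ Dom N σ D h u ∧ Wf (σ (N - 1 - (h + 1))) D x) ∧
    (∀ n m u x u' x', SuccOf m n → Ent s n u x → Ent s m u' x' → LtCore N σ D h u' u) ∧
    (∀ n u x u' x', Ent s n u x → Ent s n u' x' → u = u' ∧ x = x') ∧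
    ∀ n m u' x', SuccOf m n → Ent s m u' x' → ∃ u x, Ent s n u x

/-- The ordering of height `h` in `D`. -/
def LtDom (N : ℕ) (σ : ℕ → setLang.Formula (Fin 2)) (D : Set M) (h : ℕ) (s t : M) : Prop :=
  Dom N σ D h s ∧ Dom N σ D h t ∧ LtCore N σ D h s t

/-- What a class must know about the given relations: transitivity of the orderings, the link
between sets without minimal elements and descending functions, and pairing for the coding of
parameters. All of it is `Π₂`, so it can be carried along in every reflection. -/
structure Base (N : ℕ) (σ : ℕ → setLang.Formula (Fin 2)) (D : Set M) : Prop where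
  trans : ∀ i, 2 ≤ i → i ≤ N - 1 → ∀ x y z, NatRel (σ i) D x y → NatRel (σ i) D y z →
    NatRel (σ i) D x z
  desc : ∀ i, 2 ≤ i → i ≤ N - 1 → ∀ w ∈ D, ∀ X ∈ D, ∀ z ∈ D, ∀ x, Omega w → Bad (σ i) X z → x ε X →
    ∃ f ∈ D, Desc (σ i) w f x z
  pair : ∀ a ∈ D, ∀ b ∈ D, ∃ p ∈ D, OPair p a b

variable {N : ℕ} {σ : ℕ → setLang.Formula (Fin 2)} {D : Set M}

theorem ev_Rel (hD : TransClass D) (τ : setLang.Formula (Fin 2)) {n x y : ℕ} {e : ℕ → M}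
    (hx : x < n) (hy : y < n) (hxD : e x ∈ D) (hyD : e y ∈ D) :
    Ev D (Rel τ x y) n e ↔ NatRel τ D (e x) (e y) := by
  simp (disch := omega) only [Rel, ev_And, ev_IsNat, ev_Inst2, NatRel, sNat_iff hD hxD,
    sNat_iff hD hyD]

theorem ev_CoreAt (hD : TransClass D) {C : ℕ → ℕ → Fml} {C' : M → M → Prop}
    (hC : ∀ {n x y : ℕ} {e : ℕ → M}, x < n → y < n → e x ∈ D → e y ∈ D →
      (Ev D (C x y) n e ↔ C' (e x) (e y))) (τ : setLang.Formula (Fin 2)) {n s t k : ℕ} {e : ℕ → M}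
    (hs : s < n) (ht : t < n) (hk : k < n) (hsD : e s ∈ D) (htD : e t ∈ D) (hkD : e k ∈ D) :
    Ev D (CoreAt C τ s t k) n e ↔ LtAt C' (NatRel τ D) (e s) (e t) (e k) := by
  simp (disch := omega) only [CoreAt, ev_Ex, ev_And, ev_Or, ev_EntryB, ev_AgreeB, ev_NoEntry,
    ev_Eqv, up_self, up_lt, sAgr_iff hD hsD htD hkD, sNoEnt_iff hD hsD hkD]
  have key : ∀ {u' x' u x : M}, u' ∈ D → x' ∈ D → u ∈ D → x ∈ D →
      (Ev D (C (n + 1 + 1) n) (n + 1 + 1 + 1 + 1)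
          (up (up (up (up e n u') (n + 1) x') (n + 1 + 1) u) (n + 1 + 1 + 1) x) ↔ C' u u') ∧
        (Ev D (Rel τ (n + 1 + 1 + 1) (n + 1)) (n + 1 + 1 + 1 + 1)
          (up (up (up (up e n u') (n + 1) x') (n + 1 + 1) u) (n + 1 + 1 + 1) x) ↔
            NatRel τ D x x') := by
    intro u' x' u x hu' hx' hu hx
    constructor
    · rw [hC (by omega) (by omega)]
      all_goals simp (disch := omega) only [up_self, up_lt]; try assumption
    · rw [ev_Rel hD _ (by omega) (by omega)]
      all_goals simp (disch := omega) only [up_self, up_lt]; try assumption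
  constructor
  · rintro ⟨u', hu', x', hx', h1, h2, h3⟩
    refine ⟨u', x', (sEnt_iff hD htD hkD hu' hx').1 h1, h2, h3.imp_right ?_⟩
    rintro ⟨u, hu, x, hx, h4, h5⟩
    obtain ⟨k1, k2⟩ := key hu' hx' hu hx
    rw [k1, k2] at h5
    exact ⟨u, x, (sEnt_iff hD hsD hkD hu hx).1 h4, h5⟩
  · rintro ⟨u', x', h1, h2, h3⟩
    obtain ⟨-, hu', hx'⟩ := h1.mem hD htD
    refine ⟨u', hu', x', hx', (sEnt_iff hD htD hkD hu' hx').2 h1, h2, h3.imp_right ?_⟩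
    rintro ⟨u, x, h4, h5⟩
    obtain ⟨-, hu, hx⟩ := h4.mem hD hsD
    obtain ⟨k1, k2⟩ := key hu' hx' hu hx
    refine ⟨u, hu, x, hx, (sEnt_iff hD hsD hkD hu hx).2 h4, ?_⟩
    rw [k1, k2]
    exact h5

theorem ev_Core (hD : NiceClass D) {h n s t : ℕ} {e : ℕ → M} (hs : s < n) (ht : t < n)
    (hsD : e s ∈ D) (htD : e t ∈ D) :
    Ev D (Core N σ h s t) n e ↔ LtCore N σ D h (e s) (e t) := by
  induction h generalizing n s t e with
  | zero => exact ev_Rel hD.trans _ hs ht hsD htD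
  | succ h ih =>
    simp (disch := omega) only [Core, LtCore, ev_Ex, ev_And, ev_IsNat, up_self]
    have key : ∀ k ∈ D, (Ev D (CoreAt (Core N σ h) (σ (N - 1 - (h + 1))) s t n) (n + 1) (up e n k) ↔
        LtAt (LtCore N σ D h) (NatRel (σ (N - 1 - (h + 1))) D) (e s) (e t) k) := by
      intro k hk
      rw [ev_CoreAt hD.trans ih _ (by omega) (by omega) (by omega)]
      all_goals simp (disch := omega) only [up_self, up_lt]; try assumption
    constructor
    · rintro ⟨k, hk, h1, h2⟩
      exact ⟨k, (sNat_iff hD.trans hk).1 h1, (key k hk).1 h2⟩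
    · rintro ⟨k, h1, h2⟩
      have hk := hD.nat k h1
      exact ⟨k, hk, (sNat_iff hD.trans hk).2 h1, (key k hk).2 h2⟩

theorem ev_CoreBelow (hD : NiceClass D) {h n s t m : ℕ} {e : ℕ → M} (hs : s < n) (ht : t < n)
    (hm : m < n) (hsD : e s ∈ D) (htD : e t ∈ D) (hmD : e m ∈ D) :
    Ev D (CoreBelow N σ h s t m) n e ↔ LtBelow N σ D h (e s) (e t) (e m) := by
  simp (disch := omega) only [CoreBelow, LtBelow, ev_Ex, ev_And, ev_Mem, up_self, up_lt]
  have key : ∀ k ∈ D, (Ev D (CoreAt (Core N σ h) (σ (N - 1 - (h + 1))) s t n) (n + 1) (up e n k) ↔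
      LtAt (LtCore N σ D h) (NatRel (σ (N - 1 - (h + 1))) D) (e s) (e t) k) := by
    intro k hk
    rw [ev_CoreAt hD.trans (fun h1 h2 h3 h4 => ev_Core hD h1 h2 h3 h4) _ (by omega) (by omega)
      (by omega)]
    all_goals simp (disch := omega) only [up_self, up_lt]; try assumption
  constructor
  · rintro ⟨k, hk, h1, h2⟩
    exact ⟨k, h1, (key k hk).1 h2⟩
  · rintro ⟨k, h1, h2⟩
    have hk := hD.trans _ hmD k h1
    exact ⟨k, hk, h1, (key k hk).2 h2⟩

theorem ev_InWfB (hD : TransClass D) (τ : setLang.Formula (Fin 2)) {n x : ℕ} {e : ℕ → M}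
    (hx : x < n) (hxD : e x ∈ D) : Ev D (InWfB τ x) n e ↔ Wf τ D (e x) := by
  simp (disch := omega) only [InWfB, Wf, ev_And, ev_Neg, ev_Ex, ev_IsNat, ev_BadSet, ev_Mem,
    up_self, up_lt, sNat_iff hD hxD]
  refine and_congr Iff.rfl (not_congr (exists_congr fun X => and_congr_right fun hX =>
    exists_congr fun z => and_congr_right fun hz => ?_))
  rw [sBad_iff hD hX hz]

theorem ev_DomB (hD : NiceClass D) {h n s : ℕ} {e : ℕ → M} (hs : s < n) (hsD : e s ∈ D) :
    Ev D (DomB N σ h s) n e ↔ Dom N σ D h (e s) := by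
  induction h generalizing n s e with
  | zero => simp (disch := omega) only [DomB, Dom, ev_IsNat, sNat_iff hD.trans hsD]
  | succ h ih =>
    simp (disch := omega) only [DomB, Dom, ev_And, ev_All, ev_Ex, ev_Imp, ev_IsNat, ev_EntryB,
      ev_IsSucc, ev_Eqv, up_self, up_lt]
    have hT := hD.trans
    refine and_congr ?_ (and_congr ?_ (and_congr ?_ ?_))
    · have key : ∀ {k u x : M}, k ∈ D → u ∈ D → x ∈ D →
          (Ev D (DomB N σ h (n + 1)) (n + 1 + 1 + 1) (up (up (up e n k) (n + 1) u) (n + 1 + 1) x) ↔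
            Dom N σ D h u) ∧ (Ev D (InWfB (σ (N - 1 - (h + 1))) (n + 1 + 1)) (n + 1 + 1 + 1)
              (up (up (up e n k) (n + 1) u) (n + 1 + 1) x) ↔ Wf (σ (N - 1 - (h + 1))) D x) := by
        intro k u x hk hu hx
        constructor
        · rw [ih (by omega)]
          all_goals simp (disch := omega) only [up_self, up_lt]; try assumption
        · rw [ev_InWfB hT _ (by omega)]
          all_goals simp (disch := omega) only [up_self, up_lt]; try assumption
      constructor
      · intro H k u x hE
        obtain ⟨hk, hu, hx⟩ := hE.mem hT hsD
        have := H k hk u hu x hx ((sEnt_iff hT hsD hk hu hx).2 hE)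
        rwa [(key hk hu hx).1, (key hk hu hx).2, sNat_iff hT hk] at this
      · intro H k hk u hu x hx hE
        rw [(key hk hu hx).1, (key hk hu hx).2, sNat_iff hT hk]
        exact H k u x ((sEnt_iff hT hsD hk hu hx).1 hE)
    · have key : ∀ {k m u x u' x' : M}, u ∈ D → u' ∈ D →
          (Ev D (Core N σ h (n + 1 + 1 + 1 + 1) (n + 1 + 1)) (n + 1 + 1 + 1 + 1 + 1 + 1)
            (up (up (up (up (up (up e n k) (n + 1) m) (n + 1 + 1) u) (n + 1 + 1 + 1) x)
              (n + 1 + 1 + 1 + 1) u') (n + 1 + 1 + 1 + 1 + 1) x') ↔ LtCore N σ D h u' u) := by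
        intro k m u x u' x' hu hu'
        rw [ev_Core hD (by omega) (by omega)]
        all_goals simp (disch := omega) only [up_self, up_lt]; try assumption
      constructor
      · intro H k m u x u' x' hS hE hE'
        obtain ⟨hk, hu, hx⟩ := hE.mem hT hsD
        obtain ⟨hm, hu', hx'⟩ := hE'.mem hT hsD
        have := H k hk m hm u hu x hx u' hu' x' hx' ((sSucc_iff hT hm hk).2 hS)
          ((sEnt_iff hT hsD hk hu hx).2 hE) ((sEnt_iff hT hsD hm hu' hx').2 hE')
        rwa [key hu hu'] at this
      · intro H k hk m hm u hu x hx u' hu' x' hx' hS hE hE'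
        rw [key hu hu']
        exact H k m u x u' x' ((sSucc_iff hT hm hk).1 hS) ((sEnt_iff hT hsD hk hu hx).1 hE)
          ((sEnt_iff hT hsD hm hu' hx').1 hE')
    · constructor
      · intro H k u x u' x' hE hE'
        obtain ⟨hk, hu, hx⟩ := hE.mem hT hsD
        obtain ⟨-, hu', hx'⟩ := hE'.mem hT hsD
        exact H k hk u hu x hx u' hu' x' hx' ((sEnt_iff hT hsD hk hu hx).2 hE)
          ((sEnt_iff hT hsD hk hu' hx').2 hE')
      · intro H k hk u hu x hx u' hu' x' hx' hE hE'
        exact H k u x u' x' ((sEnt_iff hT hsD hk hu hx).1 hE) ((sEnt_iff hT hsD hk hu' hx').1 hE')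
    · constructor
      · intro H k m u' x' hS hE'
        obtain ⟨hm, hu', hx'⟩ := hE'.mem hT hsD
        have hk := hT m hm k hS.1
        obtain ⟨u, hu, x, hx, hE⟩ := H k hk m hm u' hu' x' hx' ((sSucc_iff hT hm hk).2 hS)
          ((sEnt_iff hT hsD hm hu' hx').2 hE')
        exact ⟨u, x, (sEnt_iff hT hsD hk hu hx).1 hE⟩
      · intro H k hk m hm u' hu' x' hx' hS hE'
        obtain ⟨u, x, hE⟩ := H k m u' x' ((sSucc_iff hT hm hk).1 hS)
          ((sEnt_iff hT hsD hm hu' hx').1 hE')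
        obtain ⟨-, hu, hx⟩ := hE.mem hT hsD
        exact ⟨u, hu, x, hx, (sEnt_iff hT hsD hk hu hx).2 hE⟩

theorem ev_BaseAx (hD : NiceClass D) {n : ℕ} {e : ℕ → M} :
    Ev D (BaseAx N σ) n e ↔ Base N σ D := by
  have hT := hD.trans
  have hmem : ∀ (i x y : ℕ) {m : ℕ} {e : ℕ → M}, x < m → y < m → e x ∈ D → e y ∈ D →
      (Ev D (Rel (σ i) x y) m e ↔ NatRel (σ i) D (e x) (e y)) :=
    fun i x y m e h1 h2 h3 h4 => ev_Rel hT _ h1 h2 h3 h4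
  have htr : ∀ i, Ev D (Transitivity (Rel (σ i))) n e ↔ ∀ x y z, NatRel (σ i) D x y →
      NatRel (σ i) D y z → NatRel (σ i) D x z := by
    intro i
    simp only [Transitivity, ev_All, ev_Imp]
    have key : ∀ {x y z : M}, x ∈ D → y ∈ D → z ∈ D → ((Ev D (Rel (σ i) n (n + 1)) (n + 1 + 1 + 1)
        (up (up (up e n x) (n + 1) y) (n + 1 + 1) z) ↔ NatRel (σ i) D x y) ∧
        (Ev D (Rel (σ i) (n + 1) (n + 1 + 1)) (n + 1 + 1 + 1)
        (up (up (up e n x) (n + 1) y) (n + 1 + 1) z) ↔ NatRel (σ i) D y z) ∧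
        (Ev D (Rel (σ i) n (n + 1 + 1)) (n + 1 + 1 + 1)
        (up (up (up e n x) (n + 1) y) (n + 1 + 1) z) ↔ NatRel (σ i) D x z)) := by
      intro x y z hx hy hz
      refine ⟨?_, ?_, ?_⟩
      all_goals
        rw [hmem _ _ _ (by omega) (by omega)]
        all_goals simp (disch := omega) only [up_self, up_lt]; try assumption
    constructor
    · intro H x y z h1 h2
      obtain ⟨k1, k2, k3⟩ := key (hD.nat x h1.1) (hD.nat y h2.1) (hD.nat z h2.2.1)
      have := H x (hD.nat x h1.1) y (hD.nat y h2.1) z (hD.nat z h2.2.1)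
      rw [k1, k2, k3] at this
      exact this h1 h2
    · intro H x hx y hy z hz
      obtain ⟨k1, k2, k3⟩ := key hx hy hz
      rw [k1, k2, k3]
      exact H x y z
  have hds : ∀ i, Ev D (DescentAx (σ i)) n e ↔ ∀ w ∈ D, ∀ X ∈ D, ∀ z ∈ D, ∀ x, Omega w →
      Bad (σ i) X z → x ε X → ∃ f ∈ D, Desc (σ i) w f x z := by
    intro i
    simp (disch := omega) only [DescentAx, ev_All, ev_Imp, ev_IsOmega, ev_BadSet, ev_Mem, ev_Ex,
      ev_Descends, up_self, up_lt]
    refine forall₂_congr fun w hw => forall₂_congr fun X hX => forall₂_congr fun z hz => ?_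
    rw [sOmega_iff hT hw, sBad_iff hT hX hz]
    constructor
    · intro H x h1 h2 h3
      have hx := hT X hX x h3
      obtain ⟨f, hf, h⟩ := H x hx h1 h2 h3
      exact ⟨f, hf, (sDesc_iff hT hw hf hx hz).1 h⟩
    · intro H x hx h1 h2 h3
      obtain ⟨f, hf, h⟩ := H x h1 h2 h3
      exact ⟨f, hf, (sDesc_iff hT hw hf hx hz).2 h⟩
  have hpr : Ev D (FAll fun a => FAll fun b => FEx fun p => IsPair p a b) n e ↔
      ∀ a ∈ D, ∀ b ∈ D, ∃ p ∈ D, OPair p a b := by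
    simp (disch := omega) only [ev_All, ev_Ex, ev_IsPair, up_self, up_lt]
    refine forall₂_congr fun a ha => forall₂_congr fun b hb => exists_congr fun p =>
      and_congr_right fun hp => sPair_iff hT hp ha hb
  rw [BaseAx, ev_And, ev_Conj, hpr]
  constructor
  · rintro ⟨h1, h2⟩
    have h3 : ∀ i, 2 ≤ i → i ≤ N - 1 → Ev D (Transitivity (Rel (σ i)) ⋏ DescentAx (σ i)) n e := by
      intro i hi hi'
      obtain ⟨j, rfl⟩ := Nat.exists_eq_add_of_le' hi
      exact h1 _ (List.mem_map.2 ⟨j, List.mem_range.2 (by omega), rfl⟩)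
    refine ⟨fun i hi hi' => ?_, fun i hi hi' => ?_, h2⟩
    · have := h3 i hi hi'
      rw [ev_And, htr] at this
      exact this.1
    · have := h3 i hi hi'
      rw [ev_And, hds] at this
      exact this.2
  · rintro ⟨h1, h2, h3⟩
    refine ⟨fun F hF => ?_, h3⟩
    simp only [List.mem_map, List.mem_range] at hF
    obtain ⟨i, hi, rfl⟩ := hF
    rw [ev_And, htr, hds]
    exact ⟨h1 _ (by omega) (by omega), h2 _ (by omega) (by omega)⟩

end TowerSemantics

/-! ## Transitivity of the exponential orderings -/

section Transitivity

variable {M : Type} [setLang.Structure M]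

theorem Natural.trans {m k i : M} (hm : Natural m) (hk : k ε m) (hi : i ε k) : i ε m :=
  hm.1 k hk i hi

theorem Agr.symm {s t k : M} (h : Agr s t k) : Agr t s k := fun p i v hp hi => (h p i v hp hi).symm

theorem Agr.trans {s t r k : M} (h : Agr s t k) (h' : Agr t r k) : Agr s r k :=
  fun p i v hp hi => (h p i v hp hi).trans (h' p i v hp hi)

theorem Agr.mono {s t k l : M} (h : Agr s t l) (hl : Natural l) (hk : k ε l) : Agr s t k :=
  fun p i v hp hi => h p i v hp (hl.trans hk hi)

theorem Agr.ent {s t k l u x : M} (h : Agr s t l) (hk : k ε l) (he : Ent s k u x) :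
    Ent t k u x := by
  obtain ⟨p, hp, v, h1, h2⟩ := he
  exact ⟨p, (h p k v h1 hk).1 hp, v, h1, h2⟩

theorem Agr.noEnt {s t k l : M} (h : Agr s t l) (hk : k ε l) (he : NoEnt s k) : NoEnt t k :=
  fun p v hp hpt => he p v hp ((h p k v hp hk).2 hpt)

theorem Ent.not_noEnt {s k u x : M} (h : Ent s k u x) : ¬ NoEnt s k := by
  obtain ⟨p, hp, v, h1, -⟩ := h
  exact fun h => h p v h1 hp

theorem LtAt.agr_right {C R : M → M → Prop} {v s s' k n : M} (h : LtAt C R v s k) (hk : k ε n)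
    (hn : Natural n) (hs : Agr s s' n) : LtAt C R v s' k := by
  obtain ⟨u, x, h1, h2, h3⟩ := h
  exact ⟨u, x, hs.ent hk h1, h2.trans (hs.mono hn hk), h3⟩

variable {N : ℕ} {σ : ℕ → setLang.Formula (Fin 2)} {D : Set M}

theorem LtBelow.agr_right {h : ℕ} {v s s' n : M} (hv : LtBelow N σ D h v s n) (hn : Natural n)
    (hs : Agr s s' n) : LtBelow N σ D h v s' n := by
  obtain ⟨k, hk, hv⟩ := hv
  exact ⟨k, hk, hv.agr_right hk hn hs⟩

/-- The smaller of the two places of difference decides. At equal places, uniqueness of entries in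
the middle sequence reduces the claim to transitivity for exponents, by induction on the height, and
for coefficients. -/
theorem KPModel.ltCore_trans (hM : KPModel N M) (hB : Base N σ D) (hN : 3 ≤ N) {h : ℕ}
    (hh : h ≤ N - 3) {s t r : M} (hs : Dom N σ D h s) (ht : Dom N σ D h t) (hr : Dom N σ D h r)
    (hst : LtCore N σ D h s t) (htr : LtCore N σ D h t r) : LtCore N σ D h s r := by
  induction h generalizing s t r with
  | zero => exact hB.trans _ (by omega) le_rfl _ _ _ hst htr
  | succ h ih =>
    obtain ⟨k, hk, u', x', h1, h2, h3⟩ := hst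
    obtain ⟨l, hl, w', y', g1, g2, g3⟩ := htr
    rcases hM.nat_trichotomy hk hl with hkl | rfl | hlk
    · exact ⟨k, hk, u', x', g2.ent hkl h1, h2.trans (g2.mono hl hkl), h3⟩
    · refine ⟨k, hk, w', y', g1, h2.trans g2, ?_⟩
      rcases g3 with g3 | ⟨w, y, g4, g5⟩
      · exact absurd g3 h1.not_noEnt
      obtain ⟨rfl, rfl⟩ := ht.2.2.1 _ _ _ _ _ h1 g4
      refine h3.imp_right ?_
      rintro ⟨u, x, h4, h5⟩
      refine ⟨u, x, h4, ?_⟩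
      have hu := (hs.1 _ _ _ h4).2.1
      have hu' := (ht.1 _ _ _ h1).2.1
      have hw' := (hr.1 _ _ _ g1).2.1
      rcases h5 with h5 | ⟨rfl, h5⟩
      · rcases g5 with g5 | ⟨rfl, g5⟩
        · exact .inl (ih (by omega) hu hu' hw' h5 g5)
        · exact .inl h5
      · rcases g5 with g5 | ⟨rfl, g5⟩
        · exact .inl g5
        · exact .inr ⟨rfl, hB.trans _ (by omega) (by omega) _ _ _ h5 g5⟩
    · refine ⟨l, hl, w', y', g1, (h2.mono hk hlk).trans g2, ?_⟩
      rcases g3 with g3 | ⟨w, y, g4, g5⟩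
      · exact .inl (h2.symm.noEnt hlk g3)
      · exact .inr ⟨w, y, h2.symm.ent hlk g4, g5⟩

theorem KPModel.ltDom_trans (hM : KPModel N M) (hB : Base N σ D) (hN : 3 ≤ N) {h : ℕ}
    (hh : h ≤ N - 3) {s t r : M} (hst : LtDom N σ D h s t) (htr : LtDom N σ D h t r) :
    LtDom N σ D h s r :=
  ⟨hst.1, htr.2.1, hM.ltCore_trans hB hN hh hst.1 hst.2.1 htr.2.1 hst.2.2 htr.2.2⟩

end Transitivity

/-! ## Iterated reflecting universes

A level consists of a formula `psi` to be reflected and a formula `base` that is required of the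
universes.  The next level reflects, in addition, the property of a sequence to be handled below
some place. -/

/-- The formulas of a level. -/
structure LevelF where
  psi : ℕ → Fml
  base : Fml

namespace LevelF

variable (N : ℕ) (σ : ℕ → setLang.Formula (Fin 2)) (Λ : LevelF) (h : ℕ)

/-- The universe of discourse reflects `psi` to universes in `X`. -/
def Refl (X : ℕ → Fml) : Fml :=
  FAll fun b => Λ.psi b ⟶ᶠ FEx fun Q => IsUniverse Q ⋏ b ∊ Q ⋏ Sat Q (Λ.psi b) ⋏ X Q

/-- The set `P` reflects `psi` to universes in `X`. -/
def ReflIn (X : ℕ → Fml) (P : ℕ) : Fml :=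
  AllIn P fun b => Sat P (Λ.psi b) ⟶ᶠ
    ExIn P fun Q => IsUniverse Q ⋏ b ∊ Q ⋏ Sat Q (Λ.psi b) ⋏ X Q

def LtF (v a : ℕ) : Fml := DomB N σ h v ⋏ DomB N σ h a ⋏ Core N σ h v a

/-- The recursion step for the iteration of reflection along the ordering of height `h`. -/
def StepF (P a H : ℕ) : Fml :=
  IsUniverse P ⋏ a ∊ P ⋏ Sat P Λ.base ⋏ Λ.ReflIn (fun Q => Sat Q Λ.base) P ⋏
    AllIn P fun v => Sat P (LtF N σ h v a) ⟶ᶠ Λ.ReflIn (fun Q => v ∊ Q ⋏ PairIn H Q v) P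

def HierF (D H : ℕ) : Fml :=
  IsTrans D ⋏ AllIn D fun P => AllIn P fun a => PairIn H P a ⟷ᶠ Λ.StepF N σ h P a H

/-- `Q` is in the iterate with index `v`. -/
def InIter (v Q : ℕ) : Fml :=
  v ∊ Q ⋏ FEx fun D => FEx fun H => Λ.HierF N σ h D H ⋏ Q ∊ D ⋏ PairIn H Q v

/-- The sequences that are smaller than `t` at a place in `m` are handled. -/
def Handled (t m : ℕ) : Fml :=
  FAll fun v => DomB N σ (h + 1) v ⟶ᶠ CoreBelow N σ h v t m ⟶ᶠ
    Λ.Refl fun Q => Λ.InIter N σ (h + 1) v Q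

/-- The coefficients of unhandled sequences with exponent `u` at the place `k` that agree with `s`
below `k`. -/
def Unhandled (s u k y : ℕ) : Fml :=
  FEx fun s' => FEx fun m => AgreeB s' s k ⋏ EntryB s' k u y ⋏ DomB N σ (h + 1) s' ⋏ IsSucc m k ⋏
    FNeg (Λ.Handled N σ h s' m)

/-- Hierarchies and the sets of coefficients of unhandled sequences exist. -/
def Closure : Fml :=
  (FAll fun x => FEx fun D => FEx fun H => Λ.HierF N σ (h + 1) D H ⋏ x ∊ D) ⋏
  FAll fun Q => IsUniverse Q ⟶ᶠ FAll fun s => FAll fun u => FAll fun k =>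
    s ∊ Q ⟶ᶠ u ∊ Q ⟶ᶠ k ∊ Q ⟶ᶠ FEx fun X =>
      (AllIn X fun y => y ∊ Q ⋏ Sat Q (Λ.Unhandled N σ h s u k y)) ⋏
        AllIn Q fun y => Sat Q (Λ.Unhandled N σ h s u k y) ⟶ᶠ y ∊ X

/-- The next level, for the ordering of height `h`. -/
def next : LevelF where
  base := Λ.base ⋏ Λ.Closure N σ h ⋏ Λ.Refl fun Q => Sat Q Λ.base
  psi p := (Λ.base ⋏ Λ.Closure N σ h ⋏ Λ.Refl fun Q => Sat Q Λ.base) ⋏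
    FAll fun b => FAll fun q => FAll fun t => FAll fun m => IsPair p b q ⟶ᶠ IsPair q t m ⟶ᶠ
      Λ.psi b ⋏ Λ.Handled N σ h t m ⋏ DomB N σ (h + 1) t

end LevelF

/-- The interpretation of the formulas of a level in the classes `D`. -/
structure Level (M : Type) where
  psi : Set M → M → Prop
  base : Set M → Prop

namespace Level

variable {M : Type} [setLang.Structure M] (N : ℕ) (σ : ℕ → setLang.Formula (Fin 2)) (S : Level M)
  (h : ℕ)

def Refl (D : Set M) (X : M → Prop) : Prop :=
  ∀ b ∈ D, S.psi D b → ∃ Q ∈ D, Universe Q ∧ b ε Q ∧ S.psi (elts Q) b ∧ X Q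

/-- Besides the recursion proper, `P` must satisfy `base` and reflect to universes satisfying
`base`. The latter serves sequences without an entry at the relevant place, where no iterate of an
exponent is available. -/
def Step (P a H : M) : Prop :=
  Universe P ∧ a ε P ∧ S.base (elts P) ∧ S.Refl (elts P) (fun Q => S.base (elts Q)) ∧
    ∀ v, v ε P → LtDom N σ (elts P) h v a → S.Refl (elts P) fun Q => v ε Q ∧ OPairIn H Q v

def Hier (D H : M) : Prop :=
  TransSet D ∧ ∀ P, P ε D → ∀ a, a ε P → (OPairIn H P a ↔ S.Step N σ h P a H)

def InIter (D : Set M) (v Q : M) : Prop :=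
  v ε Q ∧ ∃ D' ∈ D, ∃ H ∈ D, S.Hier N σ h D' H ∧ Q ε D' ∧ OPairIn H Q v

def Handled (D : Set M) (t m : M) : Prop :=
  ∀ v ∈ D, Dom N σ D (h + 1) v → LtBelow N σ D h v t m → S.Refl D (S.InIter N σ (h + 1) D v)

/-- The bound `m` is the successor of `k`, so the failure of handledness may involve the place `k`
itself. -/
def Unhandled (D : Set M) (s u k y : M) : Prop :=
  ∃ s' ∈ D, ∃ m ∈ D, Agr s' s k ∧ Ent s' k u y ∧ Dom N σ D (h + 1) s' ∧ SuccOf m k ∧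
    ¬ S.Handled N σ h D s' m

/-- The first clause makes the iterates computed in `D` the true ones. The second puts sets defined
by truth in a universe `Q` into `D`, where wellfoundedness of coefficients can be applied to them.
-/
structure Closure (D : Set M) : Prop where
  hier : ∀ x ∈ D, ∃ D' ∈ D, ∃ H ∈ D, S.Hier N σ (h + 1) D' H ∧ x ε D'
  sep : ∀ Q ∈ D, Universe Q → ∀ s u k, s ε Q → u ε Q → k ε Q → ∃ X ∈ D, ∀ y, y ε X ↔
    y ε Q ∧ S.Unhandled N σ h (elts Q) s u k y

/-- The parameter codes `⟨b, ⟨t, m⟩⟩`. Reflecting this property transports to the smaller universe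
not only the lower `psi` but also the handledness of `t` below `m` and its membership in the domain.
-/
def next : Level M where
  base D := S.base D ∧ S.Closure N σ h D ∧ S.Refl D fun Q => S.base (elts Q)
  psi D p := (S.base D ∧ S.Closure N σ h D ∧ S.Refl D fun Q => S.base (elts Q)) ∧
    ∀ b q t m, OPair p b q → OPair q t m →
      S.psi D b ∧ S.Handled N σ h D t m ∧ Dom N σ D (h + 1) t

end Level

/-- The formulas of a level are `Π_k` and are interpreted correctly. -/
structure IsLevel {M : Type} [setLang.Structure M] (Λ : LevelF) (S : Level M) (k : ℕ) : Prop where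
  hl_psi : ∀ {n b : ℕ}, b < n → HasLevy .pi k (Λ.psi b n)
  hl_base : ∀ {n : ℕ}, HasLevy .pi k (Λ.base n)
  ev_psi : ∀ {D : Set M} {n b : ℕ} {e : ℕ → M}, NiceClass D → b < n → e b ∈ D →
    (Ev D (Λ.psi b) n e ↔ S.psi D (e b))
  ev_base : ∀ {D : Set M} {n : ℕ} {e : ℕ → M}, NiceClass D → (Ev D Λ.base n e ↔ S.base D)

/-! ### Complexity of the levels -/

namespace LevelF

variable {N : ℕ} {σ : ℕ → setLang.Formula (Fin 2)} {Λ : LevelF} {h : ℕ}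

theorem d0_ReflIn {X : ℕ → Fml} {n P : ℕ} (hP : P < n) (hX : IsDelta0 (X (n + 1) (n + 2))) :
    IsDelta0 (Λ.ReflIn X P n) :=
  d0_AllIn hP (d0_Imp (d0_Sat (by omega) _) (d0_ExIn (by omega) (d0_And (d0_IsUniverse (by omega))
    (d0_And (d0_Mem _ _) (d0_And (d0_Sat (by omega) _) hX)))))

theorem d0_StepF {n P a H : ℕ} (hP : P < n) (hH : H < n) : IsDelta0 (Λ.StepF N σ h P a H n) :=
  d0_And (d0_IsUniverse hP) (d0_And (d0_Mem _ _) (d0_And (d0_Sat hP _) (d0_And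
    (d0_ReflIn hP (d0_Sat (by omega) _)) (d0_AllIn hP (d0_Imp (d0_Sat (by omega) _)
      (d0_ReflIn (by omega) (d0_And (d0_Mem _ _) (d0_PairIn (by omega)))))))))

theorem d0_HierF {n D H : ℕ} (hD : D < n) (hH : H < n) : IsDelta0 (Λ.HierF N σ h D H n) :=
  d0_And (d0_IsTrans hD) (d0_AllIn hD (d0_AllIn (by omega) (d0_Iff (d0_PairIn (by omega))
    (d0_StepF (by omega) (by omega)))))

theorem hl_InIter {n v Q : ℕ} : HasLevy .sigma 1 (Λ.InIter N σ h v Q n) :=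
  hl_And (hl_d0 (d0_Mem _ _)) (hl_Ex (hl_Ex (hl_d0 (d0_And (d0_HierF (by omega) (by omega))
    (d0_And (d0_Mem _ _) (d0_PairIn (by omega)))))))

/-- A premise that is `Π` of level `k + 1` costs exactly one level, since the conclusion is `Σ₁`:
satisfaction in the set `Q` is bounded. -/
theorem hl_Refl {k : ℕ} (hΛ : ∀ {n b : ℕ}, b < n → HasLevy .pi (k + 1) (Λ.psi b n))
    {X : ℕ → Fml} {n : ℕ} (hX : HasLevy .sigma 1 (X (n + 1) (n + 2))) :
    HasLevy .pi (k + 2) (Λ.Refl X n) := by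
  refine hl_All (hl_Imp ((hΛ (by omega)).lt (by omega)) (HasLevy.lt (s := .sigma) (k := 1)
    (hl_Ex ?_) (by omega)))
  exact hl_And (hl_d0 (d0_IsUniverse (by omega))) (hl_And (hl_d0 (d0_Mem _ _))
    (hl_And (hl_d0 (d0_Sat (by omega) _)) hX))

theorem hl_Handled (hN : 3 ≤ N) (hσ : ∀ i, 2 ≤ i → i ≤ N - 1 → IsSigma 1 (σ i))
    {k : ℕ} (hk : 1 ≤ k) (hh : h + 1 ≤ N - 3)
    (hΛ : ∀ {n b : ℕ}, b < n → HasLevy .pi (k + 1) (Λ.psi b n)) {n t m : ℕ} (ht : t < n) :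
    HasLevy .pi (k + 2) (Λ.Handled N σ h t m n) :=
  hl_All (hl_Imp ((hl_DomB hN hσ hh (by omega)).lt (by omega)) (hl_Imp
    ((hl_CoreBelow hN hσ hh (by omega) (by omega)).lt (by omega)) (hl_Refl hΛ hl_InIter)))

theorem hl_Closure {n : ℕ} : HasLevy .pi 2 (Λ.Closure N σ h n) := by
  refine hl_And (hl_All (HasLevy.lt (s := .sigma) (k := 1) (hl_Ex (hl_Ex (hl_d0 (d0_And
    (d0_HierF (by omega) (by omega)) (d0_Mem _ _))))) (by omega))) (hl_All (hl_Imp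
      (hl_d0 (d0_IsUniverse (by omega))) (hl_All (hl_All (hl_All ?_)))))
  refine hl_Imp (hl_d0 (d0_Mem _ _)) (hl_Imp (hl_d0 (d0_Mem _ _)) (hl_Imp (hl_d0 (d0_Mem _ _)) ?_))
  refine HasLevy.lt (s := .sigma) (k := 1) (hl_Ex (hl_d0 ?_)) (by omega)
  exact d0_And (d0_AllIn (by omega) (d0_And (d0_Mem _ _) (d0_Sat (by omega) _)))
    (d0_AllIn (by omega) (d0_Imp (d0_Sat (by omega) _) (d0_Mem _ _)))

theorem hl_next_base {k : ℕ} (hk : 1 ≤ k)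
    (hΛ : ∀ {n b : ℕ}, b < n → HasLevy .pi (k + 1) (Λ.psi b n))
    (hB : ∀ {n : ℕ}, HasLevy .pi (k + 1) (Λ.base n)) {n : ℕ} :
    HasLevy .pi (k + 2) ((Λ.next N σ h).base n) :=
  hl_And (hB.lt (by omega)) (hl_And (hl_Closure.le (by omega))
    (hl_Refl hΛ (hl_d0 (d0_Sat (by omega) _))))

theorem hl_next_psi (hN : 3 ≤ N) (hσ : ∀ i, 2 ≤ i → i ≤ N - 1 → IsSigma 1 (σ i))
    {k : ℕ} (hk : 1 ≤ k) (hh : h + 1 ≤ N - 3)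
    (hΛ : ∀ {n b : ℕ}, b < n → HasLevy .pi (k + 1) (Λ.psi b n))
    (hB : ∀ {n : ℕ}, HasLevy .pi (k + 1) (Λ.base n)) {n p : ℕ} (hp : p < n) :
    HasLevy .pi (k + 2) ((Λ.next N σ h).psi p n) := by
  refine hl_And (hl_next_base hk hΛ hB) (hl_All (hl_All (hl_All (hl_All
    (hl_Imp (hl_d0 (d0_IsPair (by omega))) (hl_Imp (hl_d0 (d0_IsPair (by omega))) ?_))))))
  exact hl_And ((hΛ (by omega)).lt (by omega)) (hl_And (hl_Handled hN hσ hk hh hΛ (by omega))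
    ((hl_DomB hN hσ hh (by omega)).le (by omega)))

end LevelF

/-! ### Correct interpretation of the levels in nice classes -/

section LevelSemantics

variable {M : Type} [setLang.Structure M] {N : ℕ} {σ : ℕ → setLang.Formula (Fin 2)}
  {Λ : LevelF} {S : Level M} {h k : ℕ} {D : Set M} {n : ℕ} {e : ℕ → M}

theorem ev_Sat_mem (hD : TransClass D) {P : ℕ} {F : Fml} (hP : P < n) (hPD : e P ∈ D) :
    Ev D (Sat P F) n e ↔ Ev (elts (e P)) F n e := by
  rw [ev_Sat _ _ hP, hD.inter_elts hPD]

theorem ev_LtF (hD : NiceClass D) {v a : ℕ} (hv : v < n) (ha : a < n) (hvD : e v ∈ D)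
    (haD : e a ∈ D) : Ev D (LevelF.LtF N σ h v a) n e ↔ LtDom N σ D h (e v) (e a) := by
  rw [LevelF.LtF, ev_And, ev_And, ev_DomB hD hv hvD, ev_DomB hD ha haD, ev_Core hD hv ha hvD haD]
  rfl

namespace IsLevel

theorem ev_Refl (hM : KPModel N M) (hΛ : IsLevel Λ S k)
    (hD : NiceClass D) {X : ℕ → Fml} {X' : M → Prop}
    (hX : ∀ b ∈ D, ∀ Q ∈ D, Universe Q →
      (Ev D (X (n + 1)) (n + 2) (up (up e n b) (n + 1) Q) ↔ X' Q)) :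
    Ev D (Λ.Refl X) n e ↔ S.Refl D X' := by
  simp (disch := omega) only [LevelF.Refl, Level.Refl, ev_All, ev_Imp, ev_Ex, ev_And, ev_Mem,
    ev_IsUniverse, up_self, up_lt]
  refine forall₂_congr fun b hb => imp_congr ?_ (exists_congr fun Q => and_congr_right fun hQ => ?_)
  · rw [hΛ.ev_psi hD (by omega) (by rwa [up_self]), up_self]
  · rw [sUniv_iff hD.trans hQ]
    refine and_congr_right fun hU => and_congr_right fun hbQ => and_congr ?_ (hX b hb Q hQ hU)
    rw [ev_Sat_mem hD.trans (by omega) (by rwa [up_self]), up_self,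
      hΛ.ev_psi (hM.niceClass hU) (by omega), up_lt _ _ (by omega), up_self]
    rwa [up_lt _ _ (by omega), up_self]

theorem ev_ReflIn (hM : KPModel N M) (hΛ : IsLevel Λ S k)
    (hD : TransClass D) {P : ℕ} (hP : P < n) (hPD : e P ∈ D) (hU : Universe (e P))
    {X : ℕ → Fml} {X' : M → Prop} (hX : ∀ b ∈ D, ∀ Q ∈ D, Universe Q →
      (Ev D (X (n + 1)) (n + 2) (up (up e n b) (n + 1) Q) ↔ X' Q)) :
    Ev D (Λ.ReflIn X P) n e ↔ S.Refl (elts (e P)) X' := by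
  simp (disch := omega) only [LevelF.ReflIn, Level.Refl, ev_AllIn, ev_Imp, ev_ExIn, ev_And, ev_Mem,
    ev_IsUniverse, up_self, up_lt]
  have hsub : ∀ x, x ε e P → x ∈ D := hD _ hPD
  have h1 : ∀ b, b ε e P → (Ev D (Sat P (Λ.psi n)) (n + 1) (up e n b) ↔ S.psi (elts (e P)) b) := by
    intro b hb
    rw [ev_Sat_mem hD (by omega) (by rwa [up_lt _ _ hP]), up_lt _ _ (by omega),
      hΛ.ev_psi (hM.niceClass hU) (by omega) (by rwa [up_self]), up_self]
  have h2 : ∀ b, b ε e P → ∀ Q, Q ε e P → (sUniv D Q ∧ b ε Q ∧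
      Ev D (Sat (n + 1) (Λ.psi n)) (n + 1 + 1) (up (up e n b) (n + 1) Q) ∧
      Ev D (X (n + 1)) (n + 1 + 1) (up (up e n b) (n + 1) Q) ↔
      Universe Q ∧ b ε Q ∧ S.psi (elts Q) b ∧ X' Q) := by
    intro b hb Q hQ
    rw [sUniv_iff hD (hsub Q hQ)]
    refine and_congr_right fun hUQ => and_congr_right fun hbQ =>
      and_congr ?_ (hX b (hsub b hb) Q (hsub Q hQ) hUQ)
    rw [ev_Sat_mem hD (by omega) (by rw [up_self]; exact hsub Q hQ), up_self,
      hΛ.ev_psi (hM.niceClass hUQ) (by omega), up_lt _ _ (by omega), up_self]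
    rwa [up_lt _ _ (by omega), up_self]
  constructor
  · intro H b hb hψ
    obtain ⟨Q, -, hQ, hh⟩ := H b (hsub b hb) hb ((h1 b hb).2 hψ)
    exact ⟨Q, hQ, (h2 b hb Q hQ).1 hh⟩
  · intro H b _ hb hψ
    obtain ⟨Q, hQ, hh⟩ := H b hb ((h1 b hb).1 hψ)
    exact ⟨Q, hsub Q hQ, hQ, (h2 b hb Q hQ).2 hh⟩

theorem ev_StepF (hM : KPModel N M) (hΛ : IsLevel Λ S k)
    (hD : TransClass D) {P a H : ℕ} (hP : P < n) (ha : a < n) (hH : H < n)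
    (hPD : e P ∈ D) (hHD : e H ∈ D) :
    Ev D (Λ.StepF N σ h P a H) n e ↔ S.Step N σ h (e P) (e a) (e H) := by
  simp (disch := omega) only [LevelF.StepF, Level.Step, ev_AllIn, ev_Imp, ev_And, ev_Mem,
    ev_IsUniverse, up_self, up_lt, sUniv_iff hD hPD]
  have hsub : ∀ x, x ε e P → x ∈ D := hD _ hPD
  refine and_congr_right fun hU => and_congr_right fun haP => and_congr ?_ (and_congr ?_ ?_)
  · rw [ev_Sat_mem hD hP hPD, hΛ.ev_base (hM.niceClass hU)]
  · refine ev_ReflIn hM hΛ hD hP hPD hU fun b hb Q hQ hUQ => ?_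
    rw [ev_Sat_mem hD (by omega) (by rwa [up_self]), up_self, hΛ.ev_base (hM.niceClass hUQ)]
  · have key : ∀ v, v ε e P → ((Ev D (Sat P (LevelF.LtF N σ h n a)) (n + 1) (up e n v) →
        Ev D (Λ.ReflIn (fun Q => n ∊ Q ⋏ PairIn H Q n) P) (n + 1) (up e n v)) ↔
        (LtDom N σ (elts (e P)) h v (e a) →
          S.Refl (elts (e P)) fun Q => v ε Q ∧ OPairIn (e H) Q v)) := by
      intro v hv
      refine imp_congr ?_ ?_
      · rw [ev_Sat_mem hD (by omega) (by rwa [up_lt _ _ hP]), up_lt _ _ (by omega),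
          ev_LtF (hM.niceClass hU) (by omega) (by omega)]
        all_goals simp (disch := omega) only [up_self, up_lt]; try assumption
      · rw [ev_ReflIn hM hΛ hD (n := n + 1) (X' := fun Q => v ε Q ∧ OPairIn (e H) Q v) (by omega)
          (by rwa [up_lt _ _ hP]) (by rwa [up_lt _ _ (by omega)]), up_lt _ _ (by omega)]
        intro b hb Q hQ hUQ
        simp (disch := omega) only [ev_And, ev_Mem, ev_PairIn, up_self, up_lt,
          sPairIn_iff hD hHD hQ (hsub v hv)]
    exact ⟨fun H v hv => (key v hv).1 (H v (hsub v hv) hv), fun H v _ hv => (key v hv).2 (H v hv)⟩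

theorem ev_HierF (hM : KPModel N M) (hΛ : IsLevel Λ S k)
    (hD : TransClass D) {D' H : ℕ} (hD' : D' < n) (hH : H < n) (hDD : e D' ∈ D)
    (hHD : e H ∈ D) : Ev D (Λ.HierF N σ h D' H) n e ↔ S.Hier N σ h (e D') (e H) := by
  simp (disch := omega) only [LevelF.HierF, Level.Hier, ev_And, ev_AllIn, ev_Iff, ev_IsTrans,
    ev_PairIn, up_self, up_lt, sTrans_iff hD hDD]
  have key : ∀ P, P ε e D' → ∀ a, a ε P → ((sPairIn D (e H) P a ↔
      Ev D (Λ.StepF N σ h n (n + 1) H) (n + 1 + 1) (up (up e n P) (n + 1) a)) ↔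
      (OPairIn (e H) P a ↔ S.Step N σ h P a (e H))) := by
    intro P hP a ha
    have hPD := hD _ hDD P hP
    rw [ev_StepF hM hΛ hD (by omega) (by omega) (by omega), sPairIn_iff hD hHD hPD (hD _ hPD a ha)]
    all_goals simp (disch := omega) only [up_self, up_lt]; try assumption
  refine and_congr_right fun _ => ⟨fun H P hP a ha => ?_, fun H P _ hP a _ ha => ?_⟩
  · have hPD := hD _ hDD P hP
    exact (key P hP a ha).1 (H P hPD hP a (hD _ hPD a ha) ha)
  · exact (key P hP a ha).2 (H P hP a ha)

theorem ev_InIter (hM : KPModel N M) (hΛ : IsLevel Λ S k)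
    (hD : TransClass D) {v Q : ℕ} (hv : v < n) (hQ : Q < n) (hvD : e v ∈ D)
    (hQD : e Q ∈ D) : Ev D (Λ.InIter N σ h v Q) n e ↔ S.InIter N σ h D (e v) (e Q) := by
  simp (disch := omega) only [LevelF.InIter, Level.InIter, ev_And, ev_Ex, ev_Mem, ev_PairIn,
    up_self, up_lt]
  refine and_congr_right fun _ => exists_congr fun D' => and_congr_right fun hD' =>
    exists_congr fun H => and_congr_right fun hH => ?_
  rw [ev_HierF hM hΛ hD (by omega) (by omega), sPairIn_iff hD hH hQD hvD]
  all_goals simp (disch := omega) only [up_self, up_lt]; try assumption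

theorem ev_Handled (hM : KPModel N M) (hΛ : IsLevel Λ S k)
    (hD : NiceClass D) {t m : ℕ} (ht : t < n) (hm : m < n) (htD : e t ∈ D)
    (hmD : e m ∈ D) : Ev D (Λ.Handled N σ h t m) n e ↔ S.Handled N σ h D (e t) (e m) := by
  simp (disch := omega) only [LevelF.Handled, Level.Handled, ev_All, ev_Imp]
  refine forall₂_congr fun v hv => imp_congr ?_ (imp_congr ?_ ?_)
  · rw [ev_DomB hD (by omega) (by rwa [up_self]), up_self]
  · rw [ev_CoreBelow hD (by omega) (by omega) (by omega)]
    all_goals simp (disch := omega) only [up_self, up_lt]; try assumption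
  · refine ev_Refl hM hΛ hD fun b hb Q hQ hU => ?_
    rw [ev_InIter hM hΛ hD.trans (by omega) (by omega)]
    all_goals simp (disch := omega) only [up_self, up_lt]; try assumption

theorem ev_Unhandled (hM : KPModel N M) (hΛ : IsLevel Λ S k)
    (hD : NiceClass D) {s u i y : ℕ} (hs : s < n) (hu : u < n) (hi : i < n)
    (hy : y < n) (hsD : e s ∈ D) (huD : e u ∈ D) (hiD : e i ∈ D) (hyD : e y ∈ D) :
    Ev D (Λ.Unhandled N σ h s u i y) n e ↔
      S.Unhandled N σ h D (e s) (e u) (e i) (e y) := by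
  simp (disch := omega) only [LevelF.Unhandled, Level.Unhandled, ev_Ex, ev_And, ev_Neg, ev_AgreeB,
    ev_EntryB, ev_IsSucc, up_self, up_lt]
  refine exists_congr fun s' => and_congr_right fun hs' => exists_congr fun m =>
    and_congr_right fun hm => ?_
  rw [sAgr_iff hD.trans hs' hsD hiD, sEnt_iff hD.trans hs' hiD huD hyD, sSucc_iff hD.trans hm hiD,
    ev_DomB hD (by omega), ev_Handled hM hΛ hD (by omega) (by omega)]
  all_goals simp (disch := omega) only [up_self, up_lt]; try assumption

theorem ev_Closure (hM : KPModel N M) (hΛ : IsLevel Λ S k) (hD : NiceClass D) :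
    Ev D (Λ.Closure N σ h) n e ↔ S.Closure N σ h D := by
  have h1 : Ev D (FAll fun x => FEx fun D => FEx fun H => Λ.HierF N σ (h + 1) D H ⋏ x ∊ D) n e ↔
      ∀ x ∈ D, ∃ D' ∈ D, ∃ H ∈ D, S.Hier N σ (h + 1) D' H ∧ x ε D' := by
    simp (disch := omega) only [ev_All, ev_Ex, ev_And, ev_Mem, up_self, up_lt]
    refine forall₂_congr fun x hx => exists_congr fun D' => and_congr_right fun hD' =>
      exists_congr fun H => and_congr_right fun hH => and_congr ?_ Iff.rfl
    rw [ev_HierF hM hΛ hD.trans (by omega) (by omega)]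
    all_goals simp (disch := omega) only [up_self, up_lt]; try assumption
  have h2 : Ev D (FAll fun Q => IsUniverse Q ⟶ᶠ FAll fun s => FAll fun u => FAll fun k =>
      s ∊ Q ⟶ᶠ u ∊ Q ⟶ᶠ k ∊ Q ⟶ᶠ FEx fun X =>
        (AllIn X fun y => y ∊ Q ⋏ Sat Q (Λ.Unhandled N σ h s u k y)) ⋏
          AllIn Q fun y => Sat Q (Λ.Unhandled N σ h s u k y) ⟶ᶠ y ∊ X) n e ↔
      ∀ Q ∈ D, Universe Q → ∀ s u k, s ε Q → u ε Q → k ε Q → ∃ X ∈ D, ∀ y, y ε X ↔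
        y ε Q ∧ S.Unhandled N σ h (elts Q) s u k y := by
    simp (disch := omega) only [ev_All, ev_AllIn, ev_Imp, ev_Ex, ev_And, ev_Mem, ev_IsUniverse,
      up_self, up_lt]
    refine forall₂_congr fun Q hQ => ?_
    rw [sUniv_iff hD.trans hQ]
    refine imp_congr_right fun hU => ?_
    have hsub : ∀ x, x ε Q → x ∈ D := hD.trans Q hQ
    have key : ∀ s, s ε Q → ∀ u, u ε Q → ∀ i, i ε Q → ∀ X y, y ε Q →
        (Ev D (Sat n (Λ.Unhandled N σ h (n + 1) (n + 1 + 1) (n + 1 + 1 + 1)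
          (n + 1 + 1 + 1 + 1 + 1)))
          (n + 1 + 1 + 1 + 1 + 1 + 1) (up (up (up (up (up (up e n Q) (n + 1) s) (n + 1 + 1) u)
            (n + 1 + 1 + 1) i) (n + 1 + 1 + 1 + 1) X) (n + 1 + 1 + 1 + 1 + 1) y) ↔
          S.Unhandled N σ h (elts Q) s u i y) := by
      intro s hs u hu i hi X y hy
      rw [ev_Sat_mem hD.trans (by omega)]
      · simp (disch := omega) only [up_self, up_lt]
        rw [ev_Unhandled hM hΛ (hM.niceClass hU) (by omega) (by omega) (by omega) (by omega)]
        all_goals simp (disch := omega) only [up_self, up_lt]; try assumption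
      · simp (disch := omega) only [up_self, up_lt]
        exact hQ
    constructor
    · intro H s u i hs hu hi
      obtain ⟨X, hX, H1, H2⟩ := H s (hsub s hs) u (hsub u hu) i (hsub i hi) hs hu hi
      refine ⟨X, hX, fun y => ⟨fun hy => ?_, fun hy => ?_⟩⟩
      · obtain ⟨H3, H4⟩ := H1 y (hD.trans X hX y hy) hy
        exact ⟨H3, (key s hs u hu i hi X y H3).1 H4⟩
      · exact H2 y (hsub y hy.1) hy.1 ((key s hs u hu i hi X y hy.1).2 hy.2)
    · intro H s _ u _ i _ hs hu hi
      obtain ⟨X, hX, H1⟩ := H s u i hs hu hi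
      refine ⟨X, hX, fun y _ hy => ?_, fun y _ hy hy' => ?_⟩
      · have := (H1 y).1 hy
        exact ⟨this.1, (key s hs u hu i hi X y this.1).2 this.2⟩
      · exact (H1 y).2 ⟨hy, (key s hs u hu i hi X y hy).1 hy'⟩
  rw [LevelF.Closure, ev_And, h1, h2]
  exact ⟨fun ⟨a, b⟩ => ⟨a, b⟩, fun ⟨a, b⟩ => ⟨a, b⟩⟩

theorem ev_next_base (hM : KPModel N M) (hΛ : IsLevel Λ S k) (hD : NiceClass D) :
    Ev D (Λ.next N σ h).base n e ↔ (S.next N σ h).base D := by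
  simp only [LevelF.next, Level.next, ev_And]
  rw [hΛ.ev_base hD, ev_Closure hM hΛ hD, ev_Refl hM hΛ hD (X' := fun Q => S.base (elts Q))]
  intro b hb Q hQ hU
  rw [ev_Sat_mem hD.trans (by omega) (by rwa [up_self]), up_self, hΛ.ev_base (hM.niceClass hU)]

theorem ev_next_psi (hM : KPModel N M) (hΛ : IsLevel Λ S k)
    (hD : NiceClass D) {p : ℕ} (hp : p < n) (hpD : e p ∈ D) :
    Ev D ((Λ.next N σ h).psi p) n e ↔ (S.next N σ h).psi D (e p) := by
  refine (ev_And _ _ _ _).trans (and_congr (ev_next_base hM hΛ hD) ?_)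
  simp (disch := omega) only [ev_All, ev_Imp, ev_And, ev_IsPair, up_self, up_lt]
  have key : ∀ b ∈ D, ∀ q ∈ D, ∀ t ∈ D, ∀ m ∈ D,
      (Ev D (Λ.psi n) (n + 1 + 1 + 1 + 1)
        (up (up (up (up e n b) (n + 1) q) (n + 1 + 1) t) (n + 1 + 1 + 1) m) ∧
      Ev D (Λ.Handled N σ h (n + 1 + 1) (n + 1 + 1 + 1)) (n + 1 + 1 + 1 + 1)
        (up (up (up (up e n b) (n + 1) q) (n + 1 + 1) t) (n + 1 + 1 + 1) m) ∧
      Ev D (DomB N σ (h + 1) (n + 1 + 1)) (n + 1 + 1 + 1 + 1)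
        (up (up (up (up e n b) (n + 1) q) (n + 1 + 1) t) (n + 1 + 1 + 1) m) ↔
      S.psi D b ∧ S.Handled N σ h D t m ∧ Dom N σ D (h + 1) t) := by
    intro b hb q hq t ht m hm
    rw [hΛ.ev_psi hD (by omega), ev_Handled hM hΛ hD (by omega) (by omega), ev_DomB hD (by omega)]
    all_goals simp (disch := omega) only [up_self, up_lt]; try assumption
  constructor
  · intro H b q t m h1 h2
    have hb := h1.left_mem hD.trans hpD
    have hq := h1.right_mem hD.trans hpD
    have ht := h2.left_mem hD.trans hq
    have hm := h2.right_mem hD.trans hq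
    exact (key b hb q hq t ht m hm).1 (H b hb q hq t ht m hm ((sPair_iff hD.trans hpD hb hq).2 h1)
      ((sPair_iff hD.trans hq ht hm).2 h2))
  · intro H b hb q hq t ht m hm h1 h2
    exact (key b hb q hq t ht m hm).2 (H b q t m ((sPair_iff hD.trans hpD hb hq).1 h1)
      ((sPair_iff hD.trans hq ht hm).1 h2))

/-- Handledness is reflection of the lower level, hence one level higher. The bound `2 ≤ k` leaves
room for the `Π₂`-domain in its premises. -/
theorem next (hM : KPModel N M) (hΛ : IsLevel Λ S k)
    (hN : 3 ≤ N) (hσ : ∀ i, 2 ≤ i → i ≤ N - 1 → IsSigma 1 (σ i)) (hk : 2 ≤ k)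
    (hh : h + 1 ≤ N - 3) : IsLevel (Λ.next N σ h) (S.next N σ h) (k + 1) := by
  obtain ⟨k, rfl⟩ := Nat.exists_eq_add_of_le' (show 1 ≤ k by omega)
  exact ⟨LevelF.hl_next_psi hN hσ (by omega) hh hΛ.hl_psi hΛ.hl_base,
    LevelF.hl_next_base (by omega) hΛ.hl_psi hΛ.hl_base,
    fun hD hb hbD => ev_next_psi hM hΛ hD hb hbD, fun hD => ev_next_base hM hΛ hD⟩

end IsLevel

end LevelSemantics

/-! ## The universal `Π₂`-formula in a class -/

section UnivPi2

variable {M : Type} [setLang.Structure M] (D : Set M) {n : ℕ} (e : ℕ → M)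

/-- `IsUpdate` with quantifiers restricted to `D`. -/
def sUpdate (g' g k x : M) : Prop := Ev D (IsUpdate 0 1 2 3) 4 (env g' [g, k, x])

theorem ev_IsUpdate {g' g k x : ℕ} (hg' : g' < n) (hg : g < n) (hk : k < n) (hx : x < n) :
    Ev D (IsUpdate g' g k x) n e ↔ sUpdate D (e g') (e g) (e k) (e x) := by
  simp (disch := omega) only [sUpdate, IsUpdate, ExPair, ev_And, ev_Or, ev_Neg, ev_AllIn, ev_ExIn,
    ev_Mem, ev_Eqv, ev_IsPair, ev_PairIn, up_self, up_lt, env_nil, env_zero, env_succ]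

/-- `IsNum` with quantifiers restricted to `D`. -/
def sNum (i : ℕ) (x : M) : Prop := Ev D (IsNum i 0) 1 (env x [])

theorem ev_IsNum (i : ℕ) {x : ℕ} (hx : x < n) : Ev D (IsNum i x) n e ↔ sNum D i (e x) := by
  induction i generalizing n x e with
  | zero => simp (disch := omega) only [sNum, IsNum, ev_IsEmp, env_zero, env_nil]
  | succ i ih =>
    change _ ↔ Ev D (IsNum (i + 1) 0) 1 (env (e x) [])
    simp (disch := omega) only [IsNum, ev_ExIn, ev_And, ev_IsSucc, ih, up_self, up_lt, env_nil]

/-- `TrueStep` with quantifiers restricted to `D`. -/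
def sTrueStep (T F p : M) : Prop := Ev D (TrueStep 0 1 2) 3 (env T [F, p])

theorem ev_TrueStep {T F p : ℕ} (hT : T < n) (hF : F < n) (hp : p < n) :
    Ev D (TrueStep T F p) n e ↔ sTrueStep D (e T) (e F) (e p) := by
  simp (disch := omega) only [sTrueStep, TrueStep, ExPair, ExVal, ev_And, ev_Or, ev_AllIn, ev_ExIn,
    ev_Mem, ev_Eqv, ev_IsPair, ev_PairIn, ev_IsNum, ev_IsUpdate, up_self, up_lt, env_nil, env_zero,
    env_succ]

/-- `FalseStep` with quantifiers restricted to `D`. -/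
def sFalseStep (T F p : M) : Prop := Ev D (FalseStep 0 1 2) 3 (env T [F, p])

theorem ev_FalseStep {T F p : ℕ} (hT : T < n) (hF : F < n) (hp : p < n) :
    Ev D (FalseStep T F p) n e ↔ sFalseStep D (e T) (e F) (e p) := by
  simp (disch := omega) only [sFalseStep, FalseStep, ExPair, ExVal, ev_And, ev_Or, ev_Neg, ev_AllIn,
    ev_ExIn, ev_Mem, ev_Eqv, ev_IsPair, ev_PairIn, ev_IsNum, ev_IsUpdate, up_self, up_lt, env_nil,
    env_zero, env_succ]

/-- `IsAssign` with quantifiers restricted to `D`. -/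
def sAssign (g c x y : M) : Prop := Ev D (IsAssign 0 1 2 3) 4 (env g [c, x, y])

theorem ev_IsAssign {g c x y : ℕ} (hg : g < n) (hc : c < n) (hx : x < n) (hy : y < n) :
    Ev D (IsAssign g c x y) n e ↔ sAssign D (e g) (e c) (e x) (e y) := by
  simp (disch := omega) only [sAssign, IsAssign, ExPair, ev_And, ev_Or, ev_AllIn, ev_ExIn, ev_Eqv,
    ev_IsPair, ev_IsNum, up_self, up_lt, env_nil, env_zero, env_succ]

/-- The universal `Π₂`-formula in `D`. -/
def sUnivPi2 (b : M) : Prop := Ev D (UnivPi2 0) 1 (env b [])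

theorem ev_UnivPi2 {b : ℕ} (hb : b < n) : Ev D (UnivPi2 b) n e ↔ sUnivPi2 D (e b) := by
  simp (disch := omega) only [sUnivPi2, UnivPi2, ev_And, ev_All, ev_Ex, ev_AllIn, ev_IsPair,
    ev_PairIn, ev_IsAssign, ev_TrueStep, ev_FalseStep, up_self, up_lt, env_nil, env_zero, env_succ]

end UnivPi2

/-! ## The levels -/

/-- The formulas of the level `j`, which uses the ordering of height `N - 3 - j`. -/
def levelF (N : ℕ) (σ : ℕ → setLang.Formula (Fin 2)) : ℕ → LevelF
  | 0 => ⟨UnivPi2, BaseAx N σ⟩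
  | j + 1 => (levelF N σ j).next N σ (N - 3 - (j + 1))

/-- The interpretation of the level `j`. -/
def level (M : Type) [setLang.Structure M] (N : ℕ) (σ : ℕ → setLang.Formula (Fin 2)) : ℕ → Level M
  | 0 => ⟨sUnivPi2, Base N σ⟩
  | j + 1 => (level M N σ j).next N σ (N - 3 - (j + 1))

section Levels

variable {M : Type} [setLang.Structure M] {N : ℕ} {σ : ℕ → setLang.Formula (Fin 2)}
  {Λ : LevelF} {S : Level M} {h k : ℕ} {D : Set M}

theorem isLevel (hM : KPModel N M) (hN : 3 ≤ N) (hσ : ∀ i, 2 ≤ i → i ≤ N - 1 → IsSigma 1 (σ i))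
    {j : ℕ} (hj : j ≤ N - 3) : IsLevel (levelF N σ j) (level M N σ j) (j + 2) := by
  induction j with
  | zero =>
    exact ⟨hl_UnivPi2, hl_BaseAx hσ, fun _ hb _ => ev_UnivPi2 _ _ hb, fun hD => ev_BaseAx hD⟩
  | succ j ih => exact (ih (by omega)).next hM hN hσ (by omega) (by omega)

theorem Level.Refl.mono {X Y : M → Prop} (hX : S.Refl D X) (hXY : ∀ Q ∈ D, Universe Q → X Q → Y Q) :
    S.Refl D Y := by
  intro b hb hψ
  obtain ⟨Q, hQ, hU, h1, h2, h3⟩ := hX b hb hψ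
  exact ⟨Q, hQ, hU, h1, h2, hXY Q hQ hU h3⟩

/-- Locality of the step, as the recursion on `∈` requires it: `H` is consulted only at universes in
`P`. -/
theorem Level.Step.of_agree {P a H H' : M}
    (hH : ∀ Q, Q ε P → ∀ b, b ε Q → (OPairIn H Q b ↔ OPairIn H' Q b)) (hs : S.Step N σ h P a H) :
    S.Step N σ h P a H' := by
  obtain ⟨h1, h2, h3, h4, h5⟩ := hs
  refine ⟨h1, h2, h3, h4, fun v hv hva => (h5 v hv hva).mono ?_⟩
  rintro Q hQ - ⟨h6, h7⟩
  exact ⟨h6, (hH Q hQ v h6).1 h7⟩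

theorem Level.hier_iff {c D' H : M} (hc : Emp c) :
    S.Hier N σ h D' H ↔ Recursion (S.Step N σ h) c D' H := by
  refine and_congr_right fun _ => forall₂_congr fun P _ => forall_congr' fun a => ?_
  have : ¬ a ε c := hc a
  tauto

theorem KPModel.hier_unique (hM : KPModel N M) {D₁ H₁ D₂ H₂ : M} (h₁ : S.Hier N σ h D₁ H₁)
    (h₂ : S.Hier N σ h D₂ H₂) {P a : M} (hP₁ : P ε D₁) (hP₂ : P ε D₂) (ha : a ε P) :
    OPairIn H₁ P a ↔ OPairIn H₂ P a := by
  obtain ⟨c, hc⟩ := hM.exists_emp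
  exact hM.recursion_unique (c := c) (fun P a H H' hH hs => hs.of_agree fun Q hQ b hb => hH Q hQ b
    (.inl hb))
    ((Level.hier_iff hc).1 h₁) ((Level.hier_iff hc).1 h₂) hP₁ hP₂ (.inl ha)

theorem KPModel.exists_hier (hM : KPModel N M) (hN : 3 ≤ N) (hΛ : IsLevel Λ S k) (x : M) :
    ∃ D' H, S.Hier N σ h D' H ∧ x ε D' := by
  obtain ⟨c, hc⟩ := hM.exists_emp
  obtain ⟨D', H, h1, h2⟩ := hM.exists_recursion (S := Λ.StepF N σ h) (Step := S.Step N σ h) (k := 1)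
    (e₀ := env c []) (ci := 0) hN
    ⟨fun _ hP _ hH => LevelF.d0_StepF hP hH, fun _ hP ha hH _ =>
      hΛ.ev_StepF hM transClass_univ hP ha hH (mem_univ _) (mem_univ _)⟩ (by omega)
    (fun P a H H' hH hs => hs.of_agree fun Q hQ b hb => hH Q hQ b (.inl hb)) x
  exact ⟨D', H, (Level.hier_iff hc).2 h1, h2⟩

/-- Membership in an iterate does not depend on the choice of the hierarchy. -/
theorem KPModel.inIter_iff_of_hier (hM : KPModel N M) {D' H v Q : M} (hH : S.Hier N σ h D' H)
    (hQ : Q ε D') : S.InIter N σ h univ v Q ↔ v ε Q ∧ OPairIn H Q v := by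
  refine and_congr_right fun hv => ⟨?_, fun h => ⟨D', trivial, H, trivial, hH, hQ, h⟩⟩
  rintro ⟨D₂, -, H₂, -, h2, h3, h4⟩
  exact (hM.hier_unique h2 hH h3 hQ hv).1 h4

theorem Level.InIter.univ {v Q : M} (hv : S.InIter N σ h D v Q) : S.InIter N σ h univ v Q := by
  obtain ⟨h1, D', -, H, -, h2⟩ := hv
  exact ⟨h1, D', trivial, H, trivial, h2⟩

/-- A class with the closure property contains a hierarchy through `Q`, and hierarchies agree on
their common domain. -/
theorem KPModel.inIter_iff_of_closure (hM : KPModel N M) (hD : S.Closure N σ h D) {v Q : M}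
    (hQ : Q ∈ D) : S.InIter N σ (h + 1) D v Q ↔ S.InIter N σ (h + 1) univ v Q := by
  refine ⟨fun h => h.univ, fun hv => ?_⟩
  obtain ⟨D', hD', H, hH, h1, h2⟩ := hD.hier Q hQ
  have := (hM.inIter_iff_of_hier h1 h2).1 hv
  exact ⟨this.1, D', hD', H, hH, h1, h2, this.2⟩

/-- The recursive characterization of the iterates. -/
theorem KPModel.inIter_iff (hM : KPModel N M) (hN : 3 ≤ N) (hΛ : IsLevel Λ S k) {v Q : M} :
    S.InIter N σ h univ v Q ↔ Universe Q ∧ v ε Q ∧ S.base (elts Q) ∧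
      S.Refl (elts Q) (fun Q' => S.base (elts Q')) ∧
      ∀ w, w ε Q → LtDom N σ (elts Q) h w v → S.Refl (elts Q) (S.InIter N σ h univ w) := by
  obtain ⟨D', H, h1, h2⟩ := hM.exists_hier (σ := σ) (h := h) hN hΛ Q
  rw [hM.inIter_iff_of_hier h1 h2]
  have key : v ε Q → ∀ w, (S.Refl (elts Q) (fun Q' => w ε Q' ∧ OPairIn H Q' w) ↔
      S.Refl (elts Q) (S.InIter N σ h Set.univ w)) := fun _ w =>
    ⟨fun h => h.mono fun Q' hQ' _ h' => (hM.inIter_iff_of_hier h1 (h1.1 Q h2 Q' hQ')).2 h',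
      fun h => h.mono fun Q' hQ' _ h' => (hM.inIter_iff_of_hier h1 (h1.1 Q h2 Q' hQ')).1 h'⟩
  constructor
  · rintro ⟨hv, hH⟩
    obtain ⟨g1, g2, g3, g4, g5⟩ := (h1.2 Q h2 v hv).1 hH
    exact ⟨g1, g2, g3, g4, fun w hw hwv => (key hv w).1 (g5 w hw hwv)⟩
  · rintro ⟨g1, hv, g3, g4, g5⟩
    exact ⟨hv, (h1.2 Q h2 v hv).2 ⟨g1, hv, g3, g4, fun w hw hwv => (key hv w).2 (g5 w hw hwv)⟩⟩

/-- Hierarchies come from recursion on `∈`, and the sets of coefficients from bounded separation,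
because truth in the set `Q` is `Δ₀`. -/
theorem KPModel.closure_univ (hM : KPModel N M) (hN : 3 ≤ N) (hΛ : IsLevel Λ S k) :
    S.Closure N σ h (univ : Set M) := by
  refine ⟨fun x _ => ?_, fun Q _ hU s u i hs hu hi => ?_⟩
  · obtain ⟨D', H, h1, h2⟩ := hM.exists_hier (σ := σ) (h := h + 1) hN hΛ x
    exact ⟨D', trivial, H, trivial, h1, h2⟩
  · obtain ⟨Y, hY⟩ := hM.separation (A := fun y => y ε Q ∧ S.Unhandled N σ h (elts Q) s u i y)
      ⟨4 ∊ 0 ⋏ Sat 0 (Λ.Unhandled N σ h 1 2 3 4), 4, env Q [s, u, i],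
        d0_And (d0_Mem _ _) (d0_Sat (by omega) _), fun y => by
          simp (disch := omega) only [ev_And, ev_Mem, up_self, up_lt, env_zero]
          refine and_congr_right fun hy => ?_
          rw [ev_Sat_mem transClass_univ (by omega) (mem_univ _), up_lt _ _ (by omega), env_zero,
            hΛ.ev_Unhandled hM (hM.niceClass hU) (by omega) (by omega) (by omega) (by omega)]
          all_goals
            simp (disch := omega) only [up_self, up_lt, env_nil, env_zero,
              env_succ]; try assumption⟩ Q
    exact ⟨Y, trivial, fun y => by rw [hY]; tauto⟩

/-- Both properties are `Π_k` with `k ≤ N`, so `Π_N`-reflection handles them at once. -/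
theorem KPModel.refl_base (hM : KPModel N M) (hΛ : IsLevel Λ S k) (hk : k ≤ N)
    (hB : S.base univ) : S.Refl univ fun Q => S.base (elts Q) := by
  intro b _ hb
  obtain ⟨Q, hU, hQ, hQe⟩ := hM.reflection (Λ.psi 0 ⋏ Λ.base) 1 (env b [])
    ((hl_And (hΛ.hl_psi (by omega)) hΛ.hl_base).le hk) (by
      rw [ev_And, hΛ.ev_psi niceClass_univ (by omega) trivial, hΛ.ev_base niceClass_univ]
      exact ⟨hb, hB⟩)
  have hbQ : b ε Q := hQ 0 (by omega)
  rw [ev_And, hΛ.ev_psi (hM.niceClass hU) (by omega) hbQ, hΛ.ev_base (hM.niceClass hU)] at hQe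
  exact ⟨Q, trivial, hU, hbQ, hQe.1, hQe.2⟩

theorem KPModel.level_base (hM : KPModel N M) (hN : 3 ≤ N)
    (hσ : ∀ i, 2 ≤ i → i ≤ N - 1 → IsSigma 1 (σ i)) (hB : Base N σ (univ : Set M)) {j : ℕ}
    (hj : j ≤ N - 3) : (level M N σ j).base univ := by
  induction j with
  | zero => exact hB
  | succ j ih =>
    have hΛ := isLevel hM hN hσ (j := j) (by omega)
    exact ⟨ih (by omega), hM.closure_univ hN hΛ, hM.refl_base hΛ (by omega) (ih (by omega))⟩

end Levels

/-! ## From one level to the previous one -/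

section Descent

variable {M : Type} [setLang.Structure M] {N : ℕ} {σ : ℕ → setLang.Formula (Fin 2)}
  {Λ : LevelF} {S : Level M} {h k : ℕ} {D : Set M}

/-- The iterates decrease along the ordering by its transitivity, which holds in `Q` because `base`
includes it. -/
theorem KPModel.inIter_of_lt (hM : KPModel N M) (hN : 3 ≤ N) (hΛ : IsLevel Λ S k) (hh : h ≤ N - 3)
    (hbase : ∀ D, S.base D → Base N σ D) {u v Q : M} (hu : S.InIter N σ h univ u Q) (hv : v ε Q)
    (hvu : LtDom N σ (elts Q) h v u) : S.InIter N σ h univ v Q := by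
  rw [hM.inIter_iff hN hΛ] at hu ⊢
  obtain ⟨h1, -, h3, h4, h5⟩ := hu
  exact ⟨h1, hv, h3, h4, fun w hw hwv => h5 w hw (hM.ltDom_trans (hbase _ h3) hN hh hwv hvu)⟩

theorem KPModel.handled_iff (hM : KPModel N M) (hD : S.Closure N σ h D) {t m : M} :
    S.Handled N σ h D t m ↔ ∀ v ∈ D, Dom N σ D (h + 1) v → LtBelow N σ D h v t m →
      S.Refl D (S.InIter N σ (h + 1) univ v) := by
  refine forall₂_congr fun v _ => imp_congr_right fun _ => imp_congr_right fun _ => ?_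
  exact ⟨fun H => H.mono fun Q _ _ h => h.univ,
    fun H => H.mono fun Q hQ _ h => (hM.inIter_iff_of_closure hD hQ).2 h⟩

theorem Level.Handled.agr {s t m : M} (hs : S.Handled N σ h D s m) (hm : Natural m)
    (ht : Agr t s m) : S.Handled N σ h D t m :=
  fun v hv hvd hvt => hs v hv hvd (hvt.agr_right hm ht)

/-- The coefficients of unhandled sequences form a set without minimal elements. -/
def Level.Progress (N : ℕ) (σ : ℕ → setLang.Formula (Fin 2)) (S : Level M) (h : ℕ) (Q : M) : Prop :=
  ∀ s, s ε Q → ∀ u, u ε Q → ∀ i, Natural i → (S.next N σ h).InIter N σ h univ u Q →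
    S.Handled N σ h (elts Q) s i → ∀ y, y ε Q → S.Unhandled N σ h (elts Q) s u i y →
      ∃ y', y' ε Q ∧ S.Unhandled N σ h (elts Q) s u i y' ∧
        NatRel (σ (N - 1 - (h + 1))) (elts Q) y' y

/-- If it failed, the coefficients at the place `m` of unhandled sequences with the same beginning
and exponent would have no minimal element, by `hprog`. They form a set in `D` and include the
coefficient of `v`, which is wellfounded in `D`. Two domains occur: `hvD` supplies wellfoundedness
in the larger class `D`, and `hvQ` makes `v` itself one of the sequences considered in `Q`. -/
theorem KPModel.handled_succ (hM : KPModel N M) (hD : S.Closure N σ h D) {Q v m m' : M}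
    (hQ : Q ∈ D) (hU : Universe Q) (hprog : S.Progress N σ h Q) (hv : v ε Q)
    (hvD : Dom N σ D (h + 1) v) (hvQ : Dom N σ (elts Q) (h + 1) v) (hm : Natural m)
    (hm' : SuccOf m' m) (hH : S.Handled N σ h (elts Q) v m)
    (hent : ∀ u x, Ent v m u x → (S.next N σ h).InIter N σ h univ u Q) :
    S.Handled N σ h (elts Q) v m' := by
  by_contra hn
  have hn' := hn
  unfold Level.Handled at hn
  push Not at hn
  obtain ⟨w, hw, hwd, ⟨i, hi, hwv⟩, hnr⟩ := hn
  rcases hm'.2.2 i hi with hi | rfl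
  · exact hnr (hH w hw hwd ⟨i, hi, hwv⟩)
  obtain ⟨u, x, hux, -, -⟩ := hwv
  have hN := hM.niceClass hU
  obtain ⟨-, huQ, hxQ⟩ := hux.mem hN.trans hv
  obtain ⟨X, hX, hXe⟩ := hD.sep Q hQ hU v u i hv huQ (hN.nat i hm)
  -- The bad set uses `Q` as the set in which the relation is evaluated; `v` itself witnesses that
  -- `x` belongs to it.
  refine (hvD.1 _ _ _ hux).2.2.2 ⟨X, hX, Q, hQ, ⟨hU.1, fun y hy => ?_⟩, (hXe x).2 ⟨hxQ, v, hv, m',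
    hN.nat _ (hm.succ hm'), fun _ _ _ _ _ => Iff.rfl, hux, hvQ, hm', hn'⟩⟩
  obtain ⟨hyQ, hyu⟩ := (hXe y).1 hy
  obtain ⟨y', hy'Q, hy'u, hlt⟩ := hprog v hv u huQ i hm (hent u x hux) hH y hyQ hyu
  exact ⟨hyQ, hlt.2.1, y', (hXe y').2 ⟨hy'Q, hy'u⟩, hlt.2.2⟩

/-- Handledness is pushed from `m` to all later places by `handled_succ`. Along the way `Q` stays in
the higher iterate of the current exponent, because the exponents decrease. -/
theorem KPModel.inIter_of_handled (hM : KPModel N M) (hN : 3 ≤ N)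
    (hσ : ∀ i, 2 ≤ i → i ≤ N - 1 → IsSigma 1 (σ i)) (hΛ : IsLevel Λ S k) (hk : 2 ≤ k)
    (hh : h + 1 ≤ N - 3) (hbase : ∀ D, S.base D → Base N σ D) (hD : (S.next N σ h).base D)
      {Q v m : M}
    (hQ : Q ∈ D) (hU : Universe Q) (hQb : (S.next N σ h).base (elts Q))
    (hprog : S.Progress N σ h Q) (hv : v ε Q) (hvD : Dom N σ D (h + 1) v)
    (hvQ : Dom N σ (elts Q) (h + 1) v) (hm : Natural m) (hH : S.Handled N σ h (elts Q) v m)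
    (hent : ∀ u x, Ent v m u x → (S.next N σ h).InIter N σ h univ u Q) :
    S.InIter N σ (h + 1) univ v Q := by
  have hΛ' := hΛ.next hM hN hσ hk hh
  have hnice := hM.niceClass hU
  -- Both properties are proved simultaneously for all `i ≥ m`: the step for handledness at `i` uses
  -- the iterate of the exponent at `i`.
  have key : ∀ i, Natural i → i ε Q → m ε i ∨ m = i → S.Handled N σ h (elts Q) v i ∧
      ∀ u, u ε Q → ∀ x, x ε Q → Ent v i u x → (S.next N σ h).InIter N σ h univ u Q := by
    refine hM.nat_induction ⟨3 ∊ 1 ⟶ᶠ 0 ∊ 3 ⋎ 0 ≐ 3 ⟶ᶠ Sat 1 (Λ.Handled N σ h 2 3) ⋏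
      FAll fun u => u ∊ 1 ⟶ᶠ FAll fun x => x ∊ 1 ⟶ᶠ EntryB 2 3 u x ⟶ᶠ
        (Λ.next N σ h).InIter N σ h u 1, 3, env m [Q, v], fun i => ?_⟩ ?_ ?_
    · simp (disch := omega) only [ev_Imp, ev_Or, ev_And, ev_All, ev_Mem, ev_Eqv, ev_EntryB, up_self,
        up_lt, env_nil, env_zero, env_succ, sEnt_univ, mem_univ, true_imp_iff]
      refine imp_congr_right fun hi => imp_congr_right fun _ => and_congr ?_ (forall_congr' fun u =>
        imp_congr_right fun hu => forall_congr' fun x => imp_congr_right fun hx =>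
          imp_congr_right fun _ => ?_)
      · rw [ev_Sat_mem transClass_univ (by omega) (mem_univ _)]
        simp (disch := omega) only [up_lt, env_zero, env_succ]
        rw [hΛ.ev_Handled hM hnice (by omega) (by omega)]
        all_goals
          simp (disch := omega) only [up_self, up_lt, env_nil, env_zero, env_succ]; try assumption
      · rw [hΛ'.ev_InIter hM transClass_univ (by omega) (by omega) (mem_univ _) (mem_univ _)]
        simp (disch := omega) only [up_self, up_lt, env_nil, env_zero, env_succ]
    · rintro i hi - (h1 | rfl)
      · exact absurd h1 (hi m)
      · exact ⟨hH, fun u _ x _ => hent u x⟩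
    · rintro i i' hi hi' ih - h1
      have h2 : i ε Q := hnice.nat i hi
      by_cases h3 : m = i'
      · subst h3
        exact ⟨hH, fun u _ x _ => hent u x⟩
      have h4 : m ε i ∨ m = i := hi'.2.2 m (h1.resolve_right h3)
      obtain ⟨h5, h6⟩ := ih h2 h4
      have h7 : ∀ u x, Ent v i u x → (S.next N σ h).InIter N σ h univ u Q := fun u x hux =>
        h6 u (hux.mem hnice.trans hv).2.1 x (hux.mem hnice.trans hv).2.2 hux
      refine ⟨hM.handled_succ hD.2.1 hQ hU hprog hv hvD hvQ hi hi' h5 h7,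
        fun u' hu' x' _ hux' => ?_⟩
      obtain ⟨u, x, hux⟩ := hvQ.2.2.2 _ _ _ _ hi' hux'
      refine hM.inIter_of_lt hN hΛ' (by omega) (fun D hD => hbase D hD.1) (h7 u x hux) hu'
        ⟨(hvQ.1 _ _ _ hux').2.1, (hvQ.1 _ _ _ hux).2.1, hvQ.2.1 _ _ _ _ _ _ hi' hux hux'⟩
  rw [hM.inIter_iff hN hΛ]
  refine ⟨hU, hv, hQb.1, hQb.2.2, fun w hw hwv => ?_⟩
  obtain ⟨hwd, -, i, hi, hat⟩ := hwv
  -- A predecessor that differs from `v` at `i` is covered by handledness below any bound exceeding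
  -- `i`: `i + 1` if that is at least `m`, and otherwise `m`.
  obtain ⟨i', hi'⟩ := hM.exists_succ hi
  have hfin : ∀ l, S.Handled N σ h (elts Q) v l → i ε l →
      S.Refl (elts Q) (S.InIter N σ (h + 1) univ w) := fun l hl hil =>
    (hM.handled_iff hQb.2.1).1 hl w hw hwd ⟨i, hil, hat⟩
  have hni' := hi.succ hi'
  rcases hM.nat_trichotomy hm hni' with h1 | h1 | h1
  · exact hfin i' (key i' hni' (hnice.nat _ hni') (.inl h1)).1 hi'.1
  · exact hfin i' (key i' hni' (hnice.nat _ hni') (.inr h1)).1 hi'.1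
  · exact hfin m hH (hm.trans h1 hi'.1)

/-- The passage to the lower level. Reflecting the higher property with parameter `⟨b, ⟨v, m⟩⟩` into
the iterate of the exponent at `m` gives a universe satisfying the lower `psi` and still handling
`v` below `m`. By `inIter_of_handled` it lies in the lower iterate of `v`. -/
theorem KPModel.refl_inIter (hM : KPModel N M) (hN : 3 ≤ N)
    (hσ : ∀ i, 2 ≤ i → i ≤ N - 1 → IsSigma 1 (σ i)) (hΛ : IsLevel Λ S k) (hk : 2 ≤ k)
    (hh : h + 1 ≤ N - 3) (hbase : ∀ D, S.base D → Base N σ D) (hnice : NiceClass D)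
    (hD : (S.next N σ h).base D)
    (hDr : (S.next N σ h).Refl D fun Q => (S.next N σ h).base (elts Q))
    (hprog : ∀ Q ∈ D, Universe Q → S.Progress N σ h Q) {v m : M} (hv : v ∈ D)
    (hvD : Dom N σ D (h + 1) v) (hm : Natural m) (hH : S.Handled N σ h D v m)
    (hent : ∀ u x, Ent v m u x → (S.next N σ h).Refl D ((S.next N σ h).InIter N σ h univ u)) :
    S.Refl D (S.InIter N σ (h + 1) univ v) := by
  intro b hb hψ
  obtain ⟨q, hq, hqp⟩ := (hbase D hD.1).pair v hv m (hnice.nat m hm)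
  obtain ⟨p, hp, hpp⟩ := (hbase D hD.1).pair b hb q hq
  have hψ' : (S.next N σ h).psi D p := by
    refine ⟨hD, fun b' q' t' m' h1 h2 => ?_⟩
    obtain ⟨rfl, rfl⟩ := hpp.inj h1
    obtain ⟨rfl, rfl⟩ := hqp.inj h2
    exact ⟨hψ, hH, hvD⟩
  -- If `v` has no entry at `m`, no condition on exponents remains and plain reflection to the next
  -- `base` is enough.
  obtain ⟨Q, hQ, hU, hpQ, hψQ, hQe⟩ : ∃ Q ∈ D, Universe Q ∧ p ε Q ∧ (S.next N σ h).psi (elts Q) p ∧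
      ∀ u x, Ent v m u x → (S.next N σ h).InIter N σ h univ u Q := by
    by_cases hex : ∃ u x, Ent v m u x
    · obtain ⟨u, x, hux⟩ := hex
      obtain ⟨Q, hQ, hU, h1, h2, h3⟩ := hent u x hux p hp hψ'
      refine ⟨Q, hQ, hU, h1, h2, fun u' x' hux' => ?_⟩
      obtain ⟨rfl, rfl⟩ := hvD.2.2.1 _ _ _ _ _ hux hux'
      exact h3
    · push Not at hex
      obtain ⟨Q, hQ, hU, h1, h2, -⟩ := hDr p hp hψ'
      exact ⟨Q, hQ, hU, h1, h2, fun u x hux => absurd hux (hex u x)⟩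
  obtain ⟨hQb, hQψ⟩ := hψQ
  obtain ⟨h1, h2, h3⟩ := hQψ b q v m hpp hqp
  have hvQ : v ε Q := hqp.left_mem hU.transClass (hpp.right_mem hU.transClass hpQ)
  exact ⟨Q, hQ, hU, hpp.left_mem hU.transClass hpQ, h1,
    hM.inIter_of_handled hN hσ hΛ hk hh hbase hD hQ hU hQb (hprog Q hQ hU) hvQ hvD h3 hm h2 hQe⟩

/-- `∈`-induction on `Q`, interlocked with `refl_inIter`: the latter is applied with `Q` in the role
of `D`, and so needs progress only for the universes in `Q`. -/
theorem KPModel.progress (hM : KPModel N M) (hN : 3 ≤ N)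
    (hσ : ∀ i, 2 ≤ i → i ≤ N - 1 → IsSigma 1 (σ i)) (hΛ : IsLevel Λ S k) (hk : 2 ≤ k)
    (hh : h + 1 ≤ N - 3) (hbase : ∀ D, S.base D → Base N σ D) (Q : M) (hU : Universe Q) :
    S.Progress N σ h Q := by
  have hΛ' := hΛ.next hM hN hσ hk hh
  revert hU
  refine hM.mem_induction (A := fun Q => Universe Q → S.Progress N σ h Q) ⟨IsUniverse 0 ⟶ᶠ
    FAll fun s => s ∊ 0 ⟶ᶠ FAll fun u => u ∊ 0 ⟶ᶠ FAll fun i => IsNat i ⟶ᶠ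
      (Λ.next N σ h).InIter N σ h u 0 ⟶ᶠ Sat 0 (Λ.Handled N σ h s i) ⟶ᶠ FAll fun y => y ∊ 0 ⟶ᶠ
        Sat 0 (Λ.Unhandled N σ h s u i y) ⟶ᶠ FEx fun y' => y' ∊ 0 ⋏
          Sat 0 (Λ.Unhandled N σ h s u i y') ⋏ Sat 0 (Rel (σ (N - 1 - (h + 1))) y' y),
    0, env Q [], fun Q => ?_⟩ ?_ Q
  · simp (disch := omega) only [ev_Imp, ev_And, ev_All, ev_Ex, ev_Mem, ev_IsUniverse, ev_IsNat,
      ev_Sat, univ_inter, up_self, up_lt, sUniv_univ, sNat_univ, mem_univ, true_imp_iff, true_and]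
    refine imp_congr_right fun hU => forall_congr' fun s => imp_congr_right fun hs =>
      forall_congr' fun u => imp_congr_right fun hu => forall_congr' fun i =>
        imp_congr_right fun hi => imp_congr ?_ (imp_congr ?_ (forall_congr' fun y =>
          imp_congr_right fun hy => imp_congr ?_ (exists_congr fun y' => and_congr_right fun hy' =>
            and_congr ?_ ?_)))
    · rw [hΛ'.ev_InIter hM transClass_univ (by omega) (by omega) (mem_univ _) (mem_univ _)]
      simp (disch := omega) only [up_self, up_lt]
    all_goals have hnice := hM.niceClass hU
    all_goals have hiQ := hnice.nat i hi
    · rw [hΛ.ev_Handled hM hnice (by omega) (by omega)]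
      all_goals simp (disch := omega) only [up_self, up_lt]; try assumption
    · rw [hΛ.ev_Unhandled hM hnice (by omega) (by omega) (by omega) (by omega)]
      all_goals simp (disch := omega) only [up_self, up_lt]; try assumption
    · rw [hΛ.ev_Unhandled hM hnice (by omega) (by omega) (by omega) (by omega)]
      all_goals simp (disch := omega) only [up_self, up_lt]; try assumption
    · rw [ev_Rel hnice.trans _ (by omega) (by omega)]
      all_goals simp (disch := omega) only [up_self, up_lt]; try assumption
  intro Q ih hU s hs u hu i hi huQ hH y hy hyu
  have hnice := hM.niceClass hU
  obtain ⟨-, -, hb, hbr, hlow⟩ := (hM.inIter_iff hN hΛ').1 huQ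
  obtain ⟨s', hs', m, hm, hag, hent, hs'd, hmi, hnh⟩ := hyu
  unfold Level.Handled at hnh
  push Not at hnh
  obtain ⟨v, hv, hvd, ⟨l, hl, hvs⟩, hnr⟩ := hnh
  -- A difference below `i` is impossible, since `s'` agrees there with `s`, which is handled.
  rcases hmi.2.2 l hl with hli | rfl
  · exact absurd (hH v hv hvd (LtBelow.agr_right ⟨l, hli, hvs⟩ hi hag)) hnr
  obtain ⟨u', y', hent', hagv, hc⟩ := hvs
  obtain ⟨rfl, rfl⟩ := hs'd.2.2.1 _ _ _ _ _ hent hent'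
  have hvl : S.Handled N σ h (elts Q) v l := hH.agr hi (hagv.trans hag)
  -- `Q` does not reflect into the iterate of `v`. Hence `v` cannot be handled below a place where
  -- it has no exponent or one smaller than `u`: `Q` is in the higher iterate of `u`, and
  -- `refl_inIter` would apply.
  have hno : ∀ m₀, Natural m₀ → S.Handled N σ h (elts Q) v m₀ →
      (∀ u₃ x₃, Ent v m₀ u₃ x₃ → LtDom N σ (elts Q) h u₃ u) → False := by
    intro m₀ hm₀ hvm hlt
    refine hnr ((hM.refl_inIter hN hσ hΛ hk hh hbase hnice hb hbr (fun Q' hQ' hU' => ih Q' hQ' hU')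
      hv hvd hm₀ hvm fun u₃ x₃ h₃ => hlow u₃ (h₃.mem hnice.trans hv).2.1 (hlt u₃ x₃ h₃)).mono ?_)
    exact fun Q' hQ' _ hv' => (hM.inIter_iff_of_closure hb.2.1 hQ').2 hv'
  have hud := (hs'd.1 _ _ _ hent).2.1
  -- At the place of difference, `v` either ends, or has a smaller exponent, or has the same
  -- exponent and a smaller coefficient. The first two cases are excluded by `hno`.
  rcases hc with hc | ⟨u₂, x₁, h1, h2 | ⟨rfl, h2⟩⟩
  · exact (hno l hi hvl fun u₃ x₃ h₃ => absurd hc h₃.not_noEnt).elim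
  · refine (hno l hi hvl fun u₃ x₃ h₃ => ?_).elim
    obtain ⟨rfl, rfl⟩ := hvd.2.2.1 _ _ _ _ _ h1 h₃
    exact ⟨(hvd.1 _ _ _ h1).2.1, hud, h2⟩
  -- If `v` were handled below the next place as well, `hno` would apply there, because exponents
  -- decrease strictly. So `v` is unhandled, and its coefficient is the required smaller one.
  · by_cases hvm : S.Handled N σ h (elts Q) v m
    · refine (hno m (hi.succ hmi) hvm fun u₃ x₃ h₃ => ?_).elim
      exact ⟨(hvd.1 _ _ _ h₃).2.1, hud, hvd.2.1 _ _ _ _ _ _ hmi h1 h₃⟩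
    · exact ⟨x₁, (h1.mem hnice.trans hv).2.2, ⟨v, hv, m, hm, hagv.trans hag, h1, hvd, hmi, hvm⟩, h2⟩

end Descent

/-! ## The universe of discourse -/

section Main

variable {M : Type} [setLang.Structure M] {N : ℕ} {σ : ℕ → setLang.Formula (Fin 2)}

/-- All exponents of `α` are below `a`, hereditarily. -/
def ExpBelow (N : ℕ) (σ : ℕ → setLang.Formula (Fin 2)) (a : M) : ℕ → M → Prop
  | 0 => fun α => NatRel (σ (N - 1)) univ α a
  | h + 1 => fun α => ∀ n u x, Ent α n u x → ExpBelow N σ a h u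

theorem level_base_imp {j : ℕ} {D : Set M} (hD : (level M N σ j).base D) : Base N σ D := by
  induction j with
  | zero => exact hD
  | succ j ih => exact ih hD.1

/-- Induction on the height, with `h + j` constant: the induction hypothesis, one level up and one
height lower, gives reflection into the iterates of the exponents, and `refl_inIter` converts it. -/
theorem KPModel.refl_expBelow (hM : KPModel N M) (hN : 3 ≤ N)
    (hσ : ∀ i, 2 ≤ i → i ≤ N - 1 → IsSigma 1 (σ i)) (hB : Base N σ (univ : Set M)) {a : M}
    (htop : ∀ α, NatRel (σ (N - 1)) univ α a →
      (level M N σ (N - 3)).Refl univ ((level M N σ (N - 3)).InIter N σ 0 univ α))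
    {h j : ℕ} (hj : h + j = N - 3) {α : M} (hα : Dom N σ univ h α) (hαa : ExpBelow N σ a h α) :
    (level M N σ j).Refl univ ((level M N σ j).InIter N σ h univ α) := by
  induction h generalizing j α with
  | zero =>
    obtain rfl : j = N - 3 := by omega
    exact htop α hαa
  | succ h ih =>
    have hΛ := isLevel hM hN hσ (j := j) (by omega)
    have hlev : level M N σ (j + 1) = (level M N σ j).next N σ h := by
      rw [level, show N - 3 - (j + 1) = h by omega]
    have hb := hM.level_base hN hσ hB (j := j + 1) (by omega)
    have hr := hM.refl_base (isLevel hM hN hσ (j := j + 1) (by omega)) (by omega) hb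
    have ih' := fun {u : M} => ih (j := j + 1) (α := u) (by omega)
    rw [hlev] at hb hr ih'
    -- The starting place is `0`, below which everything is handled vacuously; so only the leading
    -- exponent is needed.
    obtain ⟨o, ho⟩ := hM.exists_emp
    refine hM.refl_inIter hN hσ hΛ (by omega) (by omega) (fun D => level_base_imp) niceClass_univ
      hb hr (fun Q _ hU => hM.progress hN hσ hΛ (by omega) (by omega)
        (fun D => level_base_imp) Q hU)
      trivial hα (natural_emp ho) ?_ fun u x hux => ih' (hα.1 _ _ _ hux).2.1 (hαa _ _ _ hux)
    rintro v - - ⟨i, hi, -⟩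
    exact absurd hi (ho i)

/-- The universe of discourse belongs to the iterate with index `u` of the last level. -/
def TopF (N : ℕ) (σ : ℕ → setLang.Formula (Fin 2)) (u : ℕ) : Fml :=
  FAll fun v => Rel (σ (N - 1)) v u ⟶ᶠ
    (levelF N σ (N - 3)).Refl fun Q => (levelF N σ (N - 3)).InIter N σ 0 v Q

/-- The interpretation of `TopF`. -/
def Top (N : ℕ) (σ : ℕ → setLang.Formula (Fin 2)) (D : Set M) (u : M) : Prop :=
  ∀ v ∈ D, NatRel (σ (N - 1)) D v u →
    (level M N σ (N - 3)).Refl D ((level M N σ (N - 3)).InIter N σ 0 D v)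

theorem hl_levelF (hN : 3 ≤ N) (hσ : ∀ i, 2 ≤ i → i ≤ N - 1 → IsSigma 1 (σ i)) {j : ℕ}
    (hj : j ≤ N - 3) : (∀ {n b : ℕ}, b < n → HasLevy .pi (j + 2) ((levelF N σ j).psi b n)) ∧
      ∀ {n : ℕ}, HasLevy .pi (j + 2) ((levelF N σ j).base n) := by
  induction j with
  | zero => exact ⟨hl_UnivPi2, hl_BaseAx hσ⟩
  | succ j ih =>
    obtain ⟨h1, h2⟩ := ih (by omega)
    exact ⟨LevelF.hl_next_psi hN hσ (by omega) (by omega) h1 h2,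
      LevelF.hl_next_base (by omega) h1 h2⟩

theorem hl_TopF (hN : 3 ≤ N) (hσ : ∀ i, 2 ≤ i → i ≤ N - 1 → IsSigma 1 (σ i)) {n u : ℕ}
    (hu : u < n) : HasLevy .pi N (TopF N σ u n) := by
  obtain ⟨k, rfl⟩ := Nat.exists_eq_add_of_le' hN
  have hl := hl_levelF hN hσ (j := k + 3 - 3) le_rfl
  unfold TopF
  refine hl_All (hl_Imp ((hl_Rel (hσ _ (by omega) le_rfl) (by omega) (by omega)).lt (by omega)) ?_)
  exact LevelF.hl_Refl (k := k + 1) hl.1 LevelF.hl_InIter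

theorem KPModel.ev_TopF (hM : KPModel N M) (hN : 3 ≤ N)
    (hσ : ∀ i, 2 ≤ i → i ≤ N - 1 → IsSigma 1 (σ i)) {D : Set M} (hD : NiceClass D) {n u : ℕ}
    {e : ℕ → M} (hu : u < n) (huD : e u ∈ D) : Ev D (TopF N σ u) n e ↔ Top N σ D (e u) := by
  have hΛ := isLevel hM hN hσ (j := N - 3) le_rfl
  simp only [TopF, Top, ev_All, ev_Imp]
  refine forall₂_congr fun v hv => imp_congr ?_ ?_
  · rw [ev_Rel hD.trans _ (by omega) (by omega)]
    all_goals simp (disch := omega) only [up_self, up_lt]; try assumption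
  · refine hΛ.ev_Refl hM hD fun b hb Q hQ hU => ?_
    rw [hΛ.ev_InIter hM hD.trans (by omega) (by omega)]
    all_goals simp (disch := omega) only [up_self, up_lt]; try assumption

/-- The only place where full `Π_N`-reflection is exhausted. The conjunction of `psi`, `base`,
reflection to `base` and `TopF` is `Π_N`, and a universe satisfying it lies in the iterate of `u` by
the recursive characterization of iterates. -/
theorem KPModel.refl_of_top (hM : KPModel N M) (hN : 3 ≤ N)
    (hσ : ∀ i, 2 ≤ i → i ≤ N - 1 → IsSigma 1 (σ i)) (hB : Base N σ (univ : Set M)) {u : M}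
    (hu : Top N σ univ u) :
    (level M N σ (N - 3)).Refl univ ((level M N σ (N - 3)).InIter N σ 0 univ u) := by
  intro b _ hb
  have hΛ := isLevel hM hN hσ (j := N - 3) le_rfl
  have hLb := hM.level_base hN hσ hB le_rfl
  have hLr := hM.refl_base hΛ (by omega) hLb
  have hsat : ∀ {D : Set M}, NiceClass D → ∀ {n : ℕ} {e : ℕ → M},
      (Ev D ((levelF N σ (N - 3)).Refl fun Q => Sat Q (levelF N σ (N - 3)).base) n e ↔
        (level M N σ (N - 3)).Refl D fun Q => (level M N σ (N - 3)).base (elts Q)) := by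
    intro D hD n e
    refine hΛ.ev_Refl hM hD fun b hb Q hQ hU => ?_
    rw [ev_Sat_mem hD.trans (by omega) (by rwa [up_self]), up_self, hΛ.ev_base (hM.niceClass hU)]
  have hl : HasLevy .pi N (((levelF N σ (N - 3)).psi 0 ⋏ (levelF N σ (N - 3)).base ⋏
      ((levelF N σ (N - 3)).Refl fun Q => Sat Q (levelF N σ (N - 3)).base) ⋏ TopF N σ 1) 2) := by
    refine hl_And ((hΛ.hl_psi (by omega)).le (by omega)) (hl_And (hΛ.hl_base.le (by omega))
      (hl_And ?_ (hl_TopF hN hσ (by omega))))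
    obtain ⟨k, rfl⟩ := Nat.exists_eq_add_of_le' hN
    exact LevelF.hl_Refl (k := k + 1) hΛ.hl_psi (hl_d0 (d0_Sat (by omega) _))
  obtain ⟨Q, hU, hQ, hQe⟩ := hM.reflection _ 2 (env b [u]) hl (by
    rw [ev_And, ev_And, ev_And, hΛ.ev_psi niceClass_univ (by omega) trivial,
      hΛ.ev_base niceClass_univ, hsat niceClass_univ,
      hM.ev_TopF hN hσ niceClass_univ (by omega) trivial]
    exact ⟨hb, hLb, hLr, hu⟩)
  have hbQ : b ε Q := hQ 0 (by omega)
  have huQ : u ε Q := hQ 1 (by omega)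
  have hnice := hM.niceClass hU
  rw [ev_And, ev_And, ev_And, hΛ.ev_psi hnice (by omega) hbQ, hΛ.ev_base hnice, hsat hnice,
    hM.ev_TopF hN hσ hnice (by omega) huQ] at hQe
  obtain ⟨h1, h2, h3, h4⟩ := hQe
  refine ⟨Q, trivial, hU, hbQ, h1, (hM.inIter_iff hN hΛ).2 ⟨hU, huQ, h2, h3, fun w hw hwu => ?_⟩⟩
  exact (h4 w hw hwu.2.2).mono fun Q' _ _ h => h.univ

/-- The property at `u` asks for reflection into the iterates of all `v` below `u`, and each of
these follows from the property at `v`. -/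
theorem KPModel.top_progressive (hM : KPModel N M) (hN : 3 ≤ N)
    (hσ : ∀ i, 2 ≤ i → i ≤ N - 1 → IsSigma 1 (σ i)) (hB : Base N σ (univ : Set M)) {u : M}
    (hu : ∀ v, NatRel (σ (N - 1)) univ v u → Top N σ univ v) : Top N σ univ u :=
  fun v _ hv => hM.refl_of_top hN hσ hB (hu v hv)

/-- A formula with free variable `0` that is equivalent to `TopF`. -/
theorem exists_topFormula (hN : 3 ≤ N) (hσ : ∀ i, 2 ≤ i → i ≤ N - 1 → IsSigma 1 (σ i)) :
    ∃ φ : setLang.Formula (Fin (0 + 1)), IsPi N φ ∧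
      ∀ (M : Type) [setLang.Structure M] (_ : KPModel N M) (n : ℕ) (e : ℕ → M) (p : Fin
        (0 + 1) → ℕ),
        (∀ i, p i < n) → (Ev univ (Inst φ p) n e ↔ Top N σ univ (e (p 0))) := by
  obtain ⟨ψ, hψ, heq⟩ := hl_TopF hN hσ (n := 1) (u := 0) (by omega)
  obtain ⟨φ, hφ, hr⟩ := hψ.rename (freeVars 1)
  refine ⟨φ, hφ, fun M _ hM n e p hp => ?_⟩
  -- The formula exists in context `1` only; it is extended by `⊥` to other contexts just to fit the
  -- format of the renaming lemma.
  have hr' := Renames.freeVars (F := fun n => if h : n = 1 then h ▸ ψ else ⊥) (n := 1) hr M univ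
    (env (e (p 0)) [])
  have hne := hM.nonempty
  rw [ev_Inst _ _ _ _ hp, show (fun i => e (p i)) = fun i : Fin 1 => env (e (p 0)) [] i from
    funext fun i => by rw [env_nil, show i = 0 from Fin.ext (by omega)], hr']
  exact (heq M univ univ_nonempty _ _).trans (hM.ev_TopF hN hσ niceClass_univ (by omega) trivial)

end Main

/-! ## Comparison with the towers of the statement -/

section Literal

variable {M : Type} [setLang.Structure M]

section Notions

variable (D : Set M) {n : ℕ} (e : ℕ → M)

/-- `Entry` with quantifiers restricted to `D`. -/
def sEntry (s k u x : M) : Prop := Ev D (Entry 0 1 2 3) 4 (env s [k, u, x])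

theorem ev_Entry {s k u x : ℕ} (hs : s < n) (hk : k < n) (hu : u < n) (hx : x < n) :
    Ev D (Entry s k u x) n e ↔ sEntry D (e s) (e k) (e u) (e x) := by
  simp (disch := omega) only [sEntry, Entry, ev_Ex, ev_And, ev_IsPair, ev_PairIn, up_self, up_lt,
    env_nil, env_zero, env_succ]

/-- `Agree` with quantifiers restricted to `D`. -/
def sAgree (s t k : M) : Prop := Ev D (Agree 0 1 2) 3 (env s [t, k])

theorem ev_Agree {s t k : ℕ} (hs : s < n) (ht : t < n) (hk : k < n) :
    Ev D (Agree s t k) n e ↔ sAgree D (e s) (e t) (e k) := by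
  simp (disch := omega) only [sAgree, Agree, ev_AllIn, ev_All, ev_Iff, ev_PairIn, up_self, up_lt,
    env_nil, env_zero, env_succ]

/-- `IsSeq` with quantifiers restricted to `D`. -/
def sSeq (s l : M) : Prop := Ev D (IsSeq 0 1) 2 (env s [l])

theorem ev_IsSeq {s l : ℕ} (hs : s < n) (hl : l < n) :
    Ev D (IsSeq s l) n e ↔ sSeq D (e s) (e l) := by
  simp (disch := omega) only [sSeq, IsSeq, ExPair, ev_And, ev_Imp, ev_All, ev_Ex, ev_AllIn, ev_ExIn,
    ev_Mem, ev_Eqv, ev_IsNat, ev_IsPair, ev_PairIn, up_self, up_lt, env_nil, env_zero, env_succ]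

/-- `InWf` with quantifiers restricted to `D`. -/
def sInWf (τ : setLang.Formula (Fin 2)) (x : M) : Prop := Ev D (InWf (Rel τ) 0) 1 (env x [])

theorem ev_InWf (τ : setLang.Formula (Fin 2)) {x : ℕ} (hx : x < n) :
    Ev D (InWf (Rel τ) x) n e ↔ sInWf D τ (e x) := by
  simp (disch := omega) only [sInWf, InWf, IsFunOmega, Rel, ExPair, ev_And, ev_Imp, ev_Neg, ev_All,
    ev_Ex, ev_AllIn, ev_ExIn, ev_Eqv, ev_Inst2, ev_IsNat, ev_IsEmp, ev_IsSucc, ev_IsPair, ev_PairIn,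
    up_self, up_lt, env_nil, env_zero, env_succ]

variable (N : ℕ) (σ : ℕ → setLang.Formula (Fin 2))

/-- The domain of the tower with quantifiers restricted to `D`. -/
def sTowerDom (h : ℕ) (s : M) : Prop := Ev D ((Tower N σ h).1 0) 1 (env s [])

/-- The tower with quantifiers restricted to `D`. -/
def sTower (h : ℕ) (s t : M) : Prop := Ev D ((Tower N σ h).2 0 1) 2 (env s [t])

/-- `TowerDomW` with quantifiers restricted to `D`. -/
def sTowerDomW (h : ℕ) (s : M) : Prop := Ev D (TowerDomW N σ h 0) 1 (env s [])

/-- `TowerLtW` with quantifiers restricted to `D`. -/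
def sTowerLtW (h : ℕ) (s t : M) : Prop := sTower D N σ h s t ∧ sTowerDomW D N σ h s ∧
  sTowerDomW D N σ h t

theorem ev_Tower_both (h : ℕ) :
    (∀ {n s : ℕ} {e : ℕ → M}, s < n → (Ev D ((Tower N σ h).1 s) n e ↔ sTowerDom D N σ h (e s))) ∧
    ∀ {n s t : ℕ} {e : ℕ → M}, s < n → t < n →
      (Ev D ((Tower N σ h).2 s t) n e ↔ sTower D N σ h (e s) (e t)) := by
  induction h with
  | zero =>
    constructor
    · intro n s e hs
      simp (disch := omega) only [sTowerDom, Tower, ev_IsNat, env_nil]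
    · intro n s t e hs ht
      simp (disch := omega) only [sTower, Tower, Rel, ev_And, ev_IsNat, ev_Inst2, env_nil, env_zero,
        env_succ]
  | succ h ih =>
    obtain ⟨ih1, ih2⟩ := ih
    have key : ∀ {n s : ℕ} {e : ℕ → M}, s < n → (Ev D ((Tower N σ (h + 1)).1 s) n e ↔
        sTowerDom D N σ (h + 1) (e s)) := by
      intro n s e hs
      change _ ↔ Ev D ((Tower N σ (h + 1)).1 0) 1 (env (e s) [])
      simp (disch := omega) only [Tower, ExpDom, ev_And, ev_Imp, ev_Ex, ev_All, ev_AllIn, ev_IsSeq,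
        ev_Entry, ev_IsNat, ev_IsSucc, ih1, ih2, up_self, up_lt, env_nil]
    refine ⟨key, ?_⟩
    intro n s t e hs ht
    change _ ↔ Ev D ((Tower N σ (h + 1)).2 0 1) 2 (env (e s) [e t])
    have h2 : ∀ s t, (Tower N σ (h + 1)).2 s t =
        ExpLt (Tower N σ (h + 1)).1 (Tower N σ h).2 (Rel (σ (N - 1 - (h + 1)))) s t :=
      fun _ _ => rfl
    simp (disch := omega) only [h2, ExpLt, Rel, ev_And, ev_Or, ev_Ex, ev_Mem, ev_Eqv, ev_IsSeq,
      ev_Agree, ev_Entry, ev_IsNat, ev_Inst2, key, ih2, up_self, up_lt, env_nil, env_zero, env_succ]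

theorem ev_TowerDomW {h n s : ℕ} {e : ℕ → M} (hs : s < n) :
    Ev D (TowerDomW N σ h s) n e ↔ sTowerDomW D N σ h (e s) := by
  induction h generalizing n s e with
  | zero => simp (disch := omega) only [sTowerDomW, TowerDomW, ev_IsNat, env_nil]
  | succ h ih =>
    have ht := fun {n s t : ℕ} {e : ℕ → M} => (ev_Tower_both D N σ h).2 (n := n) (s := s) (t := t)
      (e := e)
    change _ ↔ Ev D (TowerDomW N σ (h + 1) 0) 1 (env (e s) [])
    simp (disch := omega) only [TowerDomW, ExpDom, ev_And, ev_Imp, ev_Ex, ev_All, ev_AllIn,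
      ev_IsSeq,
      ev_Entry, ev_IsSucc, ev_InWf, ih, ht, up_self, up_lt, env_nil]

theorem ev_TowerLtW {h n s t : ℕ} {e : ℕ → M} (hs : s < n) (ht : t < n) :
    Ev D (TowerLtW N σ h s t) n e ↔ sTowerLtW D N σ h (e s) (e t) := by
  rw [TowerLtW, ev_And, ev_And, (ev_Tower_both D N σ h).2 hs ht, ev_TowerDomW D N σ hs,
    ev_TowerDomW D N σ ht, sTowerLtW]

end Notions

section Comparison

variable {N : ℕ} {σ : ℕ → setLang.Formula (Fin 2)} {D : Set M}

theorem sEntry_iff (hD : TransClass D) {s k u x : M} (hs : s ∈ D) (hk : k ∈ D) (hu : u ∈ D)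
    (hx : x ∈ D) : sEntry D s k u x ↔ Ent s k u x := by
  simp (disch := omega) only [sEntry, Entry, ev_Ex, ev_And, ev_IsPair, ev_PairIn, up_self, up_lt,
    env_nil, env_zero, env_succ]
  constructor
  · rintro ⟨v, hv, h1, h2⟩
    obtain ⟨p, hp, hpv⟩ := (sPairIn_iff hD hs hk hv).1 h2
    exact ⟨p, hp, v, hpv, (sPair_iff hD hv hu hx).1 h1⟩
  · rintro ⟨p, hp, v, hpv, h1⟩
    have hv := hpv.right_mem hD (hD s hs p hp)
    exact ⟨v, hv, (sPair_iff hD hv hu hx).2 h1, (sPairIn_iff hD hs hk hv).2 ⟨p, hp, hpv⟩⟩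

/-- The literal notion compares values, the bounded one compares pairs as sets; uniqueness of pairs,
by extensionality, mediates between them. -/
theorem KPModel.agr_of_sAgree (hM : KPModel N M) (hD : TransClass D) {s t k : M} (hs : s ∈ D)
    (ht : t ∈ D) (hk : k ∈ D) (h : sAgree D s t k) : Agr s t k := by
  simp (disch := omega) only [sAgree, Agree, ev_AllIn, ev_All, ev_Iff, ev_PairIn, up_self, up_lt,
    env_nil, env_zero, env_succ] at h
  intro p i v hp hi
  have hiD := hD k hk i hi
  rw [← hM.oPairIn_iff hp, ← hM.oPairIn_iff hp]
  constructor
  · rintro ⟨q, hq, hqv⟩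
    have hv := hqv.right_mem hD (hD s hs q hq)
    exact (sPairIn_iff hD ht hiD hv).1
      ((h i hiD hi v hv).1 ((sPairIn_iff hD hs hiD hv).2 ⟨q, hq, hqv⟩))
  · rintro ⟨q, hq, hqv⟩
    have hv := hqv.right_mem hD (hD t ht q hq)
    exact (sPairIn_iff hD hs hiD hv).1
      ((h i hiD hi v hv).2 ((sPairIn_iff hD ht hiD hv).2 ⟨q, hq, hqv⟩))

/-- `s` is a function with domain `l`, a natural number. -/
structure FinSeq (s l : M) : Prop where
  nat : Natural l
  dom : ∀ p, p ε s → ∃ n v, OPair p n v ∧ n ε l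
  total : ∀ n, n ε l → ∃ v, OPairIn s n v
  unique : ∀ n v v', n ε l → OPairIn s n v → OPairIn s n v' → v = v'

theorem finSeq_of_sSeq (hD : TransClass D) {s l : M} (hs : s ∈ D) (hl : l ∈ D) (h : sSeq D s l) :
    FinSeq s l := by
  simp (disch := omega) only [sSeq, IsSeq, ExPair, ev_And, ev_Imp, ev_All, ev_Ex, ev_AllIn, ev_ExIn,
    ev_Mem, ev_Eqv, ev_IsNat, ev_IsPair, ev_PairIn, up_self, up_lt, env_nil, env_zero, env_succ,
    sNat_iff hD hl] at h
  obtain ⟨h1, h2, h3⟩ := h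
  have hv : ∀ {n v}, OPairIn s n v → v ∈ D := by
    rintro n v ⟨q, hq, hqv⟩
    exact hqv.right_mem hD (hD s hs q hq)
  refine ⟨h1, fun p hp => ?_, fun n hn => ?_, fun n v v' hn hnv hnv' => ?_⟩
  · obtain ⟨u, hu, -, x, hx, -, v, hv, -, y, hy, -, h4, h5⟩ := h2 p (hD s hs p hp) hp
    exact ⟨x, y, (sPair_iff hD (hD s hs p hp) hx hy).1 h4, h5⟩
  · obtain ⟨v, hv, h4, -⟩ := h3 n (hD l hl n hn) hn
    exact ⟨v, (sPairIn_iff hD hs (hD l hl n hn) hv).1 h4⟩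
  · obtain ⟨w, hw, h4, h5⟩ := h3 n (hD l hl n hn) hn
    have hnD := hD l hl n hn
    rw [h5 v (hv hnv) ((sPairIn_iff hD hs hnD (hv hnv)).2 hnv),
      h5 v' (hv hnv') ((sPairIn_iff hD hs hnD (hv hnv')).2 hnv')]

theorem FinSeq.ent_mem {s l n u x : M} (h : FinSeq s l) (he : Ent s n u x) : n ε l := by
  obtain ⟨p, hp, v, hpv, -⟩ := he
  obtain ⟨m, w, h1, h2⟩ := h.dom p hp
  obtain ⟨rfl, rfl⟩ := hpv.inj h1
  exact h2

theorem FinSeq.ent_unique {s l n u x u' x' : M} (h : FinSeq s l) (he : Ent s n u x)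
    (he' : Ent s n u' x') : u = u' ∧ x = x' := by
  have hn := h.ent_mem he
  obtain ⟨p, hp, v, hpv, hv⟩ := he
  obtain ⟨p', hp', v', hpv', hv'⟩ := he'
  obtain rfl := h.unique n v v' hn ⟨p, hp, hpv⟩ ⟨p', hp', hpv'⟩
  exact hv.inj hv'

/-- Absoluteness in a nice class, by induction on the height. The clause for proper initial segments
turns into a difference at the length of the shorter sequence. -/
theorem KPModel.ltCore_of_sTower (hM : KPModel N M) (hD : NiceClass D) {h : ℕ} {s t : M}
    (hs : s ∈ D) (ht : t ∈ D) (hst : sTower D N σ h s t) : LtCore N σ D h s t := by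
  have hT := hD.trans
  induction h generalizing s t with
  | zero => exact (ev_Rel hT _ (by omega) (by omega) hs ht).1 hst
  | succ h ih =>
    have h2 : ∀ s t, (Tower N σ (h + 1)).2 s t =
        ExpLt (Tower N σ (h + 1)).1 (Tower N σ h).2 (Rel (σ (N - 1 - (h + 1)))) s t :=
      fun _ _ => rfl
    have hdom : sTowerDom D N σ (h + 1) t → ∃ l, FinSeq t l ∧ ∀ n, n ε l → ∃ u x, Ent t n u x := by
      intro hdom
      simp (disch := omega) only [sTowerDom, Tower, ExpDom, ev_And, ev_Imp, ev_Ex, ev_All, ev_AllIn,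
        ev_IsSeq, ev_Entry, up_self, up_lt, env_nil] at hdom
      obtain ⟨⟨l, hl, h3, h4⟩, -⟩ := hdom
      refine ⟨l, finSeq_of_sSeq hT ht hl h3, fun n hn => ?_⟩
      obtain ⟨u, hu, x, hx, h5, -⟩ := h4 n (hT l hl n hn) hn
      exact ⟨u, x, (sEntry_iff hT ht (hT l hl n hn) hu hx).1 h5⟩
    change Ev D ((Tower N σ (h + 1)).2 0 1) 2 (env s [t]) at hst
    simp (disch := omega) only [h2, ExpLt, ev_And, ev_Or, ev_Ex, ev_Mem, ev_Eqv, ev_IsSeq, ev_Agree,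
      ev_Entry, ev_IsNat, (ev_Tower_both D N σ _).1, (ev_Tower_both D N σ _).2, up_self,
      up_lt, env_nil, env_zero, env_succ] at hst
    obtain ⟨-, h3, h4 | h4⟩ := hst
    · obtain ⟨k, hk, h5, h6, u, hu, x, hx, u', hu', x', hx', h7, h8, h9⟩ := h4
      refine ⟨k, (sNat_iff hT hk).1 h5, u', x', (sEntry_iff hT ht hk hu' hx').1 h8,
        hM.agr_of_sAgree hT hs ht hk h6, .inr ⟨u, x, (sEntry_iff hT hs hk hu hx).1 h7, ?_⟩⟩
      refine h9.imp (fun h => ih hu hu' h) (And.imp_right fun h => ?_)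
      rw [ev_Rel hT _ (by omega) (by omega)] at h
      · simpa (disch := omega) only [up_self, up_lt] using h
      all_goals simp (disch := omega) only [up_self, up_lt]; assumption
    · obtain ⟨l, hl, l', hl', h5, h6, h7, h8⟩ := h4
      have hsl := finSeq_of_sSeq hT hs hl h5
      have htl := finSeq_of_sSeq hT ht hl' h6
      obtain ⟨l₁, hl₁, hent⟩ := hdom h3
      -- `t` has a value at the length `l` of `s`; membership of `t` in the domain of the tower
      -- shows that this value is an exponent-coefficient pair.
      obtain ⟨v, p, hp, hpv⟩ := htl.total l h7
      obtain ⟨m, w, h9, h10⟩ := hl₁.dom p hp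
      obtain ⟨rfl, rfl⟩ := hpv.inj h9
      obtain ⟨u, x, hux⟩ := hent l h10
      refine ⟨l, hsl.nat, u, x, hux, hM.agr_of_sAgree hT hs ht hl h8, .inl fun q w hq hqs => ?_⟩
      obtain ⟨m, w', h11, h12⟩ := hsl.dom q hqs
      obtain ⟨rfl, rfl⟩ := hq.inj h11
      exact hM.mem_irrefl _ h12

end Comparison

end Literal

/-! ### Wellfounded parts, domains and hierarchies of the statement -/

section Literal

variable {M : Type} [setLang.Structure M] {N : ℕ} {σ : ℕ → setLang.Formula (Fin 2)} {D : Set M}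

/-- The wellfounded part in terms of functions is contained in the one in terms of sets. -/
theorem KPModel.wf_of_sInWf (hM : KPModel N M) (hD : NiceClass D) {w : M} (hw : Omega w)
    (hwD : w ∈ D) (hB : Base N σ D) {i : ℕ} (hi : 2 ≤ i) (hi' : i ≤ N - 1) (hσ : IsSigma 1 (σ i))
    {x : M} (hx : x ∈ D) (h : sInWf D (σ i) x) : Wf (σ i) D x := by
  have hT := hD.trans
  simp (disch := omega) only [sInWf, InWf, IsFunOmega, ExPair, ev_And, ev_Imp, ev_Neg, ev_All,
    ev_Ex, ev_AllIn, ev_ExIn, ev_Eqv, ev_IsNat, ev_IsEmp, ev_IsSucc, ev_IsPair, ev_PairIn,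
    up_self, up_lt, env_nil, env_zero, env_succ, sNat_iff hT hx] at h
  refine ⟨h.1, ?_⟩
  rintro ⟨X, hX, z, hz, hbad, hxX⟩
  obtain ⟨f, hf, h1, h2, ⟨o, how, ho, hox⟩, h4⟩ := hB.desc i hi hi' w hwD X hX z hz x hw hbad hxX
  have hwN : ∀ {y}, y ε w ↔ Natural y := hM.mem_omega_iff hw
  have hwt : ∀ y, y ε w → y ∈ D := hT w hwD
  have hval : ∀ {n v}, OPairIn f n v → n ε w ∧ v ε w := by
    rintro n v ⟨p, hp, hpv⟩
    obtain ⟨n', v', h5, h6, h7⟩ := h1 p hp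
    obtain ⟨rfl, rfl⟩ := hpv.inj h5
    exact ⟨h6, h7⟩
  obtain ⟨n, hn, m, hm, u, hu, v, hv, g1, g2, g3, g4, g5⟩ := h.2 f hf ⟨⟨by
    intro p hp hpf
    obtain ⟨n, m, h5, h6, h7⟩ := h1 p hpf
    obtain ⟨⟨u, hu, hxu⟩, ⟨v, hv, hyv⟩, -⟩ := id h5
    exact ⟨u, hT p hp u hu, hu, n, hwt n h6, hxu.1, v, hT p hp v hv, hv, m, hwt m h7, hyv.2.1,
      (sPair_iff hT hp (hwt n h6) (hwt m h7)).2 h5, (sNat_iff hT (hwt n h6)).2 (hwN.1 h6),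
      (sNat_iff hT (hwt m h7)).2 (hwN.1 h7)⟩, by
    intro n hn hnn
    rw [sNat_iff hT hn] at hnn
    obtain ⟨m, hm, h5, h6⟩ := h2 n (hwN.2 hnn)
    refine ⟨m, hwt m hm, (sPairIn_iff hT hf hn (hwt m hm)).2 h5, fun m' hm' h7 => ?_⟩
    rw [sPairIn_iff hT hf hn hm'] at h7
    exact h6 m' (hval h7).2 h7⟩, o, hwt o how, (sEmp_iff hT (hwt o how)).2 ho,
    (sPairIn_iff hT hf (hwt o how) hx).2 hox⟩
  rw [sPairIn_iff hT hf hn hu] at g3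
  rw [sPairIn_iff hT hf hm hv] at g4
  rw [sSucc_iff hT hm hn] at g2
  obtain ⟨huz, hvz, hs⟩ := h4 n (hval g3).1 m (hval g4).1 u (hval g3).2 v (hval g4).2 g2 g3 g4
  refine g5 ?_
  rw [ev_Rel hT _ (by omega) (by omega)]
  · simp (disch := omega) only [up_self, up_lt]
    refine ⟨hwN.1 (hval g4).2, hwN.1 (hval g3).2, ?_⟩
    -- Descent is known for the relation evaluated in `z`; since the relation is `Σ₁`, it persists
    -- to `D`, where the literal notion evaluates it.
    refine IsSigma.persistent hσ (fun y hy => hT z hz y hy) hbad.1.transClass _ _ ?_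
      (fun i => i.elim0) hs
    intro i
    fin_cases i
    · exact hvz
    · exact huz
  all_goals simp (disch := omega) only [up_self, up_lt]; assumption

/-- Finite sequences satisfy the local conditions of the bounded domain, and their coefficients pass
from wellfoundedness by functions to wellfoundedness by sets. -/
theorem KPModel.dom_of_sTowerDomW (hM : KPModel N M) (hD : NiceClass D) {w : M} (hw : Omega w)
    (hwD : w ∈ D) (hB : Base N σ D) (hσ : ∀ i, 2 ≤ i → i ≤ N - 1 → IsSigma 1 (σ i)) {h : ℕ}
    (hh : h ≤ N - 3) {s : M} (hs : s ∈ D) (hsd : sTowerDomW D N σ h s) : Dom N σ D h s := by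
  have hT := hD.trans
  induction h generalizing s with
  | zero =>
    simp (disch := omega) only [sTowerDomW, TowerDomW, ev_IsNat, env_nil, sNat_iff hT hs] at hsd
    exact hsd
  | succ h ih =>
    change Ev D (TowerDomW N σ (h + 1) 0) 1 (env s []) at hsd
    simp (disch := omega) only [TowerDomW, ExpDom, ev_And, ev_Imp, ev_Ex, ev_All, ev_AllIn,
      ev_IsSeq,
      ev_Entry, ev_IsSucc, ev_InWf, ev_TowerDomW, (ev_Tower_both D N σ h).2, up_self, up_lt,
      env_nil] at hsd
    obtain ⟨⟨l, hl, h1, h2⟩, h3⟩ := hsd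
    have hseq := finSeq_of_sSeq hT hs hl h1
    have hex : ∀ n, n ε l → ∃ u x, Ent s n u x ∧ Dom N σ D h u ∧ Wf (σ (N - 1 - (h + 1))) D x := by
      intro n hn
      obtain ⟨u, hu, x, hx, h4, h5, h6⟩ := h2 n (hT l hl n hn) hn
      exact ⟨u, x, (sEntry_iff hT hs (hT l hl n hn) hu hx).1 h4, ih (by omega) hu h5,
        hM.wf_of_sInWf hD hw hwD hB (by omega) (by omega) (hσ _ (by omega) (by omega)) hx h6⟩
    refine ⟨fun n u x hux => ?_, fun n m u x u' x' hmn hux hux' => ?_,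
      fun n u x u' x' hux hux' => hseq.ent_unique hux hux', fun n m u' x' hmn hux' => ?_⟩
    · have hn := hseq.ent_mem hux
      obtain ⟨u', x', h4, h5, h6⟩ := hex n hn
      obtain ⟨rfl, rfl⟩ := hseq.ent_unique hux h4
      exact ⟨hseq.nat.mem hn, h5, h6⟩
    · obtain ⟨hn, hu, hx⟩ := hux.mem hT hs
      obtain ⟨hm, hu', hx'⟩ := hux'.mem hT hs
      have := h3 n hn m hm u hu x hx u' hu' x' hx' ⟨(sSucc_iff hT hm hn).2 hmn,
        (sEntry_iff hT hs hn hu hx).2 hux, (sEntry_iff hT hs hm hu' hx').2 hux'⟩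
      exact hM.ltCore_of_sTower hD hu' hu this.1
    · obtain ⟨u, x, h4, -⟩ := hex n (hseq.nat.trans (hseq.ent_mem hux') hmn.1)
      exact ⟨u, x, h4⟩

theorem KPModel.ltDom_of_sTowerLtW (hM : KPModel N M) (hD : NiceClass D) {w : M} (hw : Omega w)
    (hwD : w ∈ D) (hB : Base N σ D) (hσ : ∀ i, 2 ≤ i → i ≤ N - 1 → IsSigma 1 (σ i)) {h : ℕ}
    (hh : h ≤ N - 3) {s t : M} (hs : s ∈ D) (ht : t ∈ D) (hst : sTowerLtW D N σ h s t) :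
    LtDom N σ D h s t :=
  ⟨hM.dom_of_sTowerDomW hD hw hwD hB hσ hh hs hst.2.1,
    hM.dom_of_sTowerDomW hD hw hwD hB hσ hh ht hst.2.2, hM.ltCore_of_sTower hD hs ht hst.1⟩

/-! ## The hierarchy of the statement -/

/-- The recursion step of `IsM2Hierarchy` for `LtTW`. -/
def M2Step (N : ℕ) (σ : ℕ → setLang.Formula (Fin 2)) (P a H : M) : Prop :=
  Universe P ∧ ∀ b, b ε P → sTowerLtW (elts P) N σ (N - 3) b a →
    (level M N σ 0).Refl (elts P) fun Q => b ε Q ∧ OPairIn H Q b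

def M2StepF (N : ℕ) (σ : ℕ → setLang.Formula (Fin 2)) (P a H : ℕ) : Fml :=
  IsUniverse P ⋏ AllIn P fun b => Sat P (LtTW N σ b a) ⟶ᶠ
    InM2 (fun Q => b ∊ Q ⋏ PairIn H Q b) P

def M2Hier (N : ℕ) (σ : ℕ → setLang.Formula (Fin 2)) (D H : M) : Prop :=
  TransSet D ∧ ∀ P, P ε D → Universe P → ∀ a, a ε P → (OPairIn H P a ↔ M2Step N σ P a H)

def InM2Tower (N : ℕ) (σ : ℕ → setLang.Formula (Fin 2)) (a P : M) : Prop :=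
  Universe P ∧ a ε P ∧ ∃ D H, M2Hier N σ D H ∧ P ε D ∧ OPairIn H P a

theorem KPModel.ev_m2Step (hM : KPModel N M) (hN : 3 ≤ N)
    (hσ : ∀ i, 2 ≤ i → i ≤ N - 1 → IsSigma 1 (σ i)) {n P a H : ℕ} {e : ℕ → M} (hP : P < n)
    (ha : a < n) (hH : H < n) (hU : Universe (e P)) :
    Ev univ (AllIn P fun b => Sat P (LtTW N σ b a) ⟶ᶠ
      InM2 (fun Q => b ∊ Q ⋏ PairIn H Q b) P) n e ↔ M2Step N σ (e P) (e a) (e H) := by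
  have hΛ := isLevel hM hN hσ (j := 0) (by omega)
  simp (disch := omega) only [M2Step, ev_AllIn, ev_Imp, ev_Sat, LtTW, ev_TowerLtW, univ_inter,
    up_self, up_lt, mem_univ, true_imp_iff, hU, true_and]
  refine forall_congr' fun b => imp_congr_right fun hb => imp_congr_right fun _ => ?_
  have := hΛ.ev_ReflIn hM transClass_univ (n := n + 1) (e := up e n b) (P := P)
    (X := fun Q => n ∊ Q ⋏ PairIn H Q n) (X' := fun Q => b ε Q ∧ OPairIn (e H) Q b) (by omega)
    (mem_univ _) (by rwa [up_lt _ _ hP]) fun c _ Q _ _ => by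
      simp (disch := omega) only [ev_And, ev_Mem, ev_PairIn, up_self, up_lt, sPairIn_univ]
  rw [up_lt _ _ hP] at this
  exact this

theorem M2Step.of_agree {P a H H' : M}
    (hH : ∀ Q, Q ε P → ∀ b, b ε Q → (OPairIn H Q b ↔ OPairIn H' Q b)) (hs : M2Step N σ P a H) :
    M2Step N σ P a H' := by
  refine ⟨hs.1, fun v hv hva => (hs.2 v hv hva).mono ?_⟩
  rintro Q hQ - ⟨h6, h7⟩
  exact ⟨h6, (hH Q hQ v h6).1 h7⟩

/-- The statement's recursion constrains `H` at universes only. Requiring `P` to be a universe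
within the step makes the recursion total, so that the general existence theorem applies. -/
theorem KPModel.exists_m2Hier (hM : KPModel N M) (hN : 3 ≤ N)
    (hσ : ∀ i, 2 ≤ i → i ≤ N - 1 → IsSigma 1 (σ i)) (x : M) :
    ∃ D H, M2Hier N σ D H ∧ x ε D := by
  obtain ⟨c, hc⟩ := hM.exists_emp
  obtain ⟨D, H, h1, h2⟩ := hM.exists_recursion (S := M2StepF N σ) (Step := M2Step N σ) (k := 1)
    (e₀ := env c []) (ci := 0) hN
    ⟨fun _ hP _ hH => d0_And (d0_IsUniverse hP) (d0_AllIn hP (d0_Imp (d0_Sat (by omega) _)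
        (LevelF.d0_ReflIn (Λ := levelF N σ 0) (by omega)
          (d0_And (d0_Mem _ _) (d0_PairIn (by omega)))))),
      fun {n P a H e} _ hP ha hH _ => by
        rw [M2StepF, ev_And, ev_IsUniverse _ _ hP, sUniv_univ]
        constructor
        · rintro ⟨hU, h⟩
          exact (hM.ev_m2Step hN hσ hP ha hH hU).1 h
        · exact fun h => ⟨h.1, (hM.ev_m2Step hN hσ hP ha hH h.1).2 h⟩⟩ (by omega)
    (fun P a H H' hH hs => hs.of_agree fun Q hQ b hb => hH Q hQ b (.inl hb)) x
  exact ⟨D, H, ⟨h1.1, fun P hP _ a ha => h1.2 P hP a (.inl ha)⟩, h2⟩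

theorem KPModel.ev_InM2Iter (hM : KPModel N M) (hN : 3 ≤ N)
    (hσ : ∀ i, 2 ≤ i → i ≤ N - 1 → IsSigma 1 (σ i)) {n a P : ℕ} {e : ℕ → M} (ha : a < n)
    (hP : P < n) : Ev univ (InM2Iter (LtTW N σ) a P) n e ↔ InM2Tower N σ (e a) (e P) := by
  simp (disch := omega) only [InM2Iter, InM2Tower, IsM2Hierarchy, M2Hier, ev_And, ev_Ex, ev_AllIn,
    ev_Imp, ev_Iff, ev_Mem, ev_IsUniverse, ev_IsTrans, ev_PairIn, up_self, up_lt, sUniv_univ,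
    sTrans_univ, sPairIn_univ, mem_univ, true_imp_iff, true_and]
  refine and_congr Iff.rfl (and_congr Iff.rfl (exists_congr fun D => exists_congr fun H =>
    and_congr (and_congr Iff.rfl (forall_congr' fun Q => imp_congr_right fun hQ =>
      imp_congr_right fun hU => forall_congr' fun b => imp_congr_right fun hb =>
        iff_congr Iff.rfl ?_)) Iff.rfl))
  have key := hM.ev_m2Step hN hσ (n := n + 4) (P := n + 2) (a := n + 3) (H := n + 1)
    (e := up (up (up (up e n D) (n + 1) H) (n + 2) Q) (n + 3) b) (by omega) (by omega) (by omega)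
    (by simpa (disch := omega) only [up_self, up_lt] using hU)
  simpa (disch := omega) only [ev_AllIn, ev_Imp, up_self, up_lt, mem_univ, true_imp_iff] using key

end Literal

/-! ### From the iterates of level zero to the theorem -/

section Literal

variable {M : Type} [setLang.Structure M] {N : ℕ} {σ : ℕ → setLang.Formula (Fin 2)}

/-- `∈`-induction along one hierarchy of the statement. The ordering occurs only in the premise of
the recursion, and the literal ordering of a universe is contained in the bounded one, so fewer
conditions have to be met. -/
theorem KPModel.inM2Tower_of_inIter (hM : KPModel N M) (hN : 3 ≤ N)
    (hσ : ∀ i, 2 ≤ i → i ≤ N - 1 → IsSigma 1 (σ i)) {v Q : M}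
    (hv : (level M N σ 0).InIter N σ (N - 3) univ v Q) : InM2Tower N σ v Q := by
  have hΛ := isLevel hM hN hσ (j := 0) (by omega)
  obtain ⟨D, H, hDH, hQ⟩ := hM.exists_m2Hier hN hσ Q
  have key : ∀ Q, Q ε D → ∀ v, (level M N σ 0).InIter N σ (N - 3) univ v Q → OPairIn H Q v := by
    intro Q
    refine hM.mem_induction (A := fun Q => Q ε D → ∀ v, (level M N σ 0).InIter N σ
      (N - 3) univ v Q →
      OPairIn H Q v) ⟨2 ∊ 0 ⟶ᶠ FAll fun v => (levelF N σ 0).InIter N σ (N - 3) v 2 ⟶ᶠ PairIn 1 2 v,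
        2, env D [H], fun Q => ?_⟩ (fun Q ih hQ v hv => ?_) Q
    · simp (disch := omega) only [ev_Imp, ev_All, ev_Mem, ev_PairIn, up_self, up_lt, env_nil,
        env_zero, env_succ, sPairIn_univ, mem_univ, true_imp_iff]
      refine imp_congr_right fun _ => forall_congr' fun v => imp_congr ?_ Iff.rfl
      rw [hΛ.ev_InIter hM transClass_univ (by omega) (by omega) (mem_univ _) (mem_univ _)]
      simp (disch := omega) only [up_self, up_lt]
    · obtain ⟨hU, hvQ, hb, -, hlow⟩ := (hM.inIter_iff hN hΛ).1 hv
      obtain ⟨w, hwQ, hw⟩ := hU.2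
      refine (hDH.2 Q hQ hU v hvQ).2 ⟨hU, fun b hbQ hbv => ?_⟩
      refine (hlow b hbQ (hM.ltDom_of_sTowerLtW (hM.niceClass hU) hw hwQ hb hσ le_rfl hbQ hvQ
        hbv)).mono fun Q' hQ' _ hb' => ⟨hb'.1, ih Q' hQ' (hDH.1 Q hQ Q' hQ') b hb'⟩
  obtain ⟨hU, hvQ, -⟩ := (hM.inIter_iff hN hΛ).1 hv
  exact ⟨hU, hvQ, D, H, hDH, hQ, key Q hQ v hv⟩

/-- If `α` is in the bounded domain, this is `refl_expBelow` at level zero. Otherwise being outside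
the domain is itself reflected: in the resulting universe `α` has no predecessors in the restricted
ordering, and membership in the iterate is vacuous. -/
theorem KPModel.refl_inM2Tower (hM : KPModel N M) (hN : 3 ≤ N)
    (hσ : ∀ i, 2 ≤ i → i ≤ N - 1 → IsSigma 1 (σ i)) (hB : Base N σ (univ : Set M)) {a α : M}
    (htop : ∀ u, NatRel (σ (N - 1)) univ u a → Top N σ univ u) (hα : ExpBelow N σ a (N - 3) α) :
    (level M N σ 0).Refl univ (InM2Tower N σ α) := by
  have hΛ := isLevel hM hN hσ (j := 0) (by omega)
  by_cases hd : Dom N σ univ (N - 3) α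
  · exact (hM.refl_expBelow hN hσ hB (fun u hu => hM.refl_of_top hN hσ hB (htop u hu))
      (j := 0) (by omega) hd hα).mono fun Q _ _ h => hM.inM2Tower_of_inIter hN hσ h
  intro b _ hb
  -- The domain is `Π₂`, so its negation is `Σ₂` and hence of level `Π_N`, because `N ≥ 3`.
  have hl : HasLevy .pi N (((levelF N σ 0).psi 0 ⋏ (levelF N σ 0).base ⋏
      FNeg (DomB N σ (N - 3) 1)) 2) :=
    hl_And ((hΛ.hl_psi (by omega)).le (by omega)) (hl_And (hΛ.hl_base.le (by omega))
      (hl_Neg ((hl_DomB hN hσ le_rfl (by omega)).lt (by omega))))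
  obtain ⟨Q, hU, hQ, hQe⟩ := hM.reflection _ 2 (env b [α]) hl (by
    rw [ev_And, ev_And, ev_Neg, hΛ.ev_psi niceClass_univ (by omega) trivial,
      hΛ.ev_base niceClass_univ, ev_DomB niceClass_univ (by omega) trivial]
    exact ⟨hb, hB, hd⟩)
  have hbQ : b ε Q := hQ 0 (by omega)
  have hαQ : α ε Q := hQ 1 (by omega)
  have hnice := hM.niceClass hU
  rw [ev_And, ev_And, ev_Neg, hΛ.ev_psi hnice (by omega) hbQ, hΛ.ev_base hnice,
    ev_DomB hnice (by omega) hαQ] at hQe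
  obtain ⟨h1, h2, h3⟩ := hQe
  obtain ⟨D, H, hDH, hQD⟩ := hM.exists_m2Hier hN hσ Q
  obtain ⟨w, hwQ, hw⟩ := hU.2
  refine ⟨Q, trivial, hU, hbQ, h1, hU, hαQ, D, H, hDH, hQD, (hDH.2 Q hQD hU α hαQ).2 ⟨hU, ?_⟩⟩
  exact fun c hc hcα => absurd
    (hM.ltDom_of_sTowerLtW hnice hw hwQ h2 hσ le_rfl hc hαQ hcα).2.1 h3

/-- The formula for `ExpBelow`. -/
def ExpBelowF (N : ℕ) (σ : ℕ → setLang.Formula (Fin 2)) (a : ℕ) : ℕ → ℕ → Fml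
  | 0 => fun α => Rel (σ (N - 1)) α a
  | h + 1 => fun α => FAll fun n => FAll fun u => FAll fun x =>
      EntryB α n u x ⟶ᶠ ExpBelowF N σ a h u

theorem ev_ExpBelowF {a h n α : ℕ} {e : ℕ → M} (ha : a < n) (hα : α < n) :
    Ev univ (ExpBelowF N σ a h α) n e ↔ ExpBelow N σ (e a) h (e α) := by
  induction h generalizing n α e with
  | zero => exact ev_Rel transClass_univ _ hα ha trivial trivial
  | succ h ih =>
    simp (disch := omega) only [ExpBelowF, ExpBelow, ev_All, ev_Imp, ev_EntryB, ih, up_self, up_lt,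
      sEnt_univ, mem_univ, true_imp_iff]

theorem expBelow_of_TowerBelow {a h n α : ℕ} {e : ℕ → M} (ha : a < n) (hα : α < n)
    (h' : Ev univ (TowerBelow N σ h α a) n e) : ExpBelow N σ (e a) h (e α) := by
  induction h generalizing n α e with
  | zero => exact (ev_Rel transClass_univ _ hα ha trivial trivial).1 h'
  | succ h ih =>
    simp (disch := omega) only [TowerBelow, ev_And, ev_All, ev_Imp, ev_Entry, up_self, up_lt,
      mem_univ, true_imp_iff] at h'
    intro k u x hux
    have := ih (by omega) (by omega)
      (h'.2 k u x ((sEntry_iff transClass_univ trivial trivial trivial trivial).2 hux))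
    simpa (disch := omega) only [up_self, up_lt] using this

/-- Exponents of `s` before the place of difference occur in `t`. At that place the exponent is at
most that of `t`, and beyond it the exponents decrease; induction on the height treats strict
decreases. -/
theorem KPModel.expBelow_of_lt (hM : KPModel N M) (hN : 3 ≤ N) (hB : Base N σ (univ : Set M))
    {h : ℕ}
    (hh : h ≤ N - 3) {a s t : M} (hst : LtDom N σ univ h s t) (ht : ExpBelow N σ a h t) :
    ExpBelow N σ a h s := by
  induction h generalizing s t with
  | zero => exact hB.trans _ (by omega) le_rfl _ _ _ hst.2.2 ht
  | succ h ih =>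
    obtain ⟨hs, htd, k, hk, u', x', h1, h2, h3⟩ := hst
    have hat : ∀ n u x, Natural n → (n ε k ∨ n = k) → Ent s n u x → ExpBelow N σ a h u := by
      rintro n u x hn (hnk | rfl) hux
      · exact ht n u x (h2.ent hnk hux)
      · rcases h3 with h3 | ⟨u₁, x₁, h4, h5⟩
        · exact absurd h3 hux.not_noEnt
        obtain ⟨rfl, rfl⟩ := hs.2.2.1 _ _ _ _ _ hux h4
        rcases h5 with h5 | ⟨rfl, -⟩
        · exact ih (by omega) ⟨(hs.1 _ _ _ hux).2.1, (htd.1 _ _ _ h1).2.1, h5⟩ (ht _ _ _ h1)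
        · exact ht _ _ _ h1
    have key : ∀ n, Natural n → ∀ u x, Ent s n u x → ExpBelow N σ a h u := by
      refine hM.nat_induction ⟨FAll fun u => FAll fun x => EntryB 0 2 u x ⟶ᶠ ExpBelowF N σ 1 h u, 2,
        env s [a], fun n => ?_⟩ (fun n hn u x hux => ?_) fun n n' hn hn' IH u x hux => ?_
      · simp (disch := omega) only [ev_All, ev_Imp, ev_EntryB, ev_ExpBelowF, up_self, up_lt,
          env_nil,
          env_zero, env_succ, sEnt_univ, mem_univ, true_imp_iff]
      · exact hat n u x (natural_emp hn) (hM.emp_mem_or_eq hn k hk) hux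
      · have hnn := hn.succ hn'
        rcases hM.nat_trichotomy hnn hk with h4 | h4 | h4
        · exact hat n' u x hnn (.inl h4) hux
        · exact hat n' u x hnn (.inr h4) hux
        · obtain ⟨u₁, x₁, h5⟩ := hs.2.2.2 _ _ _ _ hn' hux
          exact ih (by omega) ⟨(hs.1 _ _ _ hux).2.1, (hs.1 _ _ _ h5).2.1,
            hs.2.1 _ _ _ _ _ _ hn' h5 hux⟩ (IH u₁ x₁ h5)
    exact fun n u x hux => key n (hs.1 _ _ _ hux).1 u x hux

theorem KPModel.base_univ (hM : KPModel N M) (hN : 3 ≤ N) (e : ℕ → M)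
    (htrans : ∀ i, 2 ≤ i → i ≤ N - 1 → Ev univ (Transitivity (Rel (σ i))) 0 e) :
    Base N σ (univ : Set M) := by
  refine ⟨fun i hi hi' => ?_, fun i _ _ w _ X _ z _ x hw hX hx => ?_, fun a _ b _ => ?_⟩
  · have := htrans i hi hi'
    simp (disch := omega) only [Transitivity, Rel, ev_All, ev_Imp, ev_And, ev_IsNat, ev_Inst2,
      up_self, up_lt, sNat_univ, mem_univ, true_imp_iff] at this
    exact this
  · obtain ⟨f, hf⟩ := hM.exists_descends hN hw hX hx
    exact ⟨f, trivial, hf⟩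
  · obtain ⟨p, hp⟩ := hM.exists_oPair a b
    exact ⟨p, trivial, hp⟩

/-- The hypothesis of the induction instance is progressivity of `Top`, which holds outright by
`top_progressive`. -/
theorem KPModel.top_of_TI (hM : KPModel N M) (hN : 3 ≤ N)
    (hσ : ∀ i, 2 ≤ i → i ≤ N - 1 → IsSigma 1 (σ i)) (hB : Base N σ (univ : Set M))
    {φ : setLang.Formula (Fin (0 + 1))}
    (hφ : ∀ (n : ℕ) (e : ℕ → M) (p : Fin (0 + 1) → ℕ), (∀ i, p i < n) →
      (Ev univ (Inst φ p) n e ↔ Top N σ univ (e (p 0)))) {n a : ℕ} {e : ℕ → M} (ha : a < n)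
    (h : Ev univ (TI (Rel (σ (N - 1))) φ a) n e) (u : M) (hu : NatRel (σ (N - 1)) univ u (e a)) :
    Top N σ univ u := by
  have hI : ∀ {n x : ℕ} {e : ℕ → M}, x < n →
      (Ev univ (Inst φ (Fin.cons x Fin.elim0)) n e ↔ Top N σ univ (e x)) := fun {n x e} hx =>
    hφ n e (Fin.cons x Fin.elim0) fun i => by
      rw [show i = 0 from Fin.ext (by omega)]
      exact hx
  have hR : ∀ {n x y : ℕ} {e : ℕ → M}, x < n → y < n →
      (Ev univ (Rel (σ (N - 1)) x y) n e ↔ NatRel (σ (N - 1)) univ (e x) (e y)) := fun hx hy =>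
    ev_Rel transClass_univ _ hx hy trivial trivial
  change Ev univ ((FAll fun x => IsNat x ⟶ᶠ (FAll fun y => Rel (σ (N - 1)) y x ⟶ᶠ
    Inst φ (Fin.cons y Fin.elim0)) ⟶ᶠ Inst φ (Fin.cons x Fin.elim0)) ⟶ᶠ
      FAll fun x => Rel (σ (N - 1)) x a ⟶ᶠ Inst φ (Fin.cons x Fin.elim0)) n e at h
  simp (disch := omega) only [ev_Imp, ev_All, ev_IsNat, hI, hR, up_self, up_lt, sNat_univ, mem_univ,
    true_imp_iff] at h
  exact h (fun x _ hx => hM.top_progressive hN hσ hB hx) u hu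

/-- To derive a consequence from transfinite induction, it is enough to do so in models. -/
theorem provesFromTI_of_models (hN : 3 ≤ N) (hσ : ∀ i, 2 ≤ i → i ≤ N - 1 → IsSigma 1 (σ i))
    (htrans : ∀ i, 2 ≤ i → i ≤ N - 1 → KPPiTheory N ⊨ᵇ Transitivity (Rel (σ i)) 0) {C : ℕ → Fml}
    (hC : ∀ (M : Type) [setLang.Structure M], KPModel N M → Base N σ (univ : Set M) →
      ∀ (a : M), (∀ u, NatRel (σ (N - 1)) univ u a → Top N σ univ u) →
        ∀ {n α : ℕ} {e : ℕ → M}, α < n → ExpBelow N σ a (N - 3) (e α) → Ev univ (C α) n e) :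
    ProvesFromTI N σ C := by
  obtain ⟨φ, hφ, hφe⟩ := exists_topFormula hN hσ
  -- A single parameter-free instance suffices, and the same one serves both assertions.
  refine ⟨[⟨0, φ⟩], by simpa using hφ, ?_⟩
  intro M v xs
  have hmod : ∀ ψ, KPPi N ψ → M ⊨ ψ := fun ψ hψ => M.is_model.realize_of_mem ψ hψ
  have hM := kpModel_of_models hmod
  obtain ⟨x₀⟩ := hM.nonempty
  have hev : ∀ F : Fml, (F 0).Realize v xs ↔ Ev univ F 0 fun _ => x₀ := by
    intro F
    rw [ev_sentence, Subsingleton.elim v default, Subsingleton.elim xs default]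
    rfl
  have hB := hM.base_univ hN (fun _ => x₀) fun i hi hi' => by
    have := htrans i hi hi' M v xs
    rwa [hev] at this
  rw [hev]
  simp (disch := omega) only [ev_All, ev_Imp, ev_IsNat, up_self, mem_univ, true_imp_iff]
  intro a _ α hα hTI
  have hTI' : Ev univ (TI (Rel (σ (N - 1))) φ 0) 2 (up (up (fun _ => x₀) 0 a) 1 α) :=
    (ev_Conj _ _ _).1 hTI _ (by simp)
  have htop := hM.top_of_TI hN hσ hB (fun n e p hp => hφe M hM n e p hp) (by omega) hTI'
  refine hC M hM hB a (fun u hu => htop u ?_) (by omega) ?_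
  · rw [up_lt _ _ (by omega), up_self]
    exact hu
  · have := expBelow_of_TowerBelow (by omega) (by omega) hα
    simpa (disch := omega) only [up_self, up_lt] using this

theorem KPModel.ev_LInM2 (hM : KPModel N M) (hN : 3 ≤ N)
    (hσ : ∀ i, 2 ≤ i → i ≤ N - 1 → IsSigma 1 (σ i)) (hB : Base N σ (univ : Set M)) {a : M}
    (htop : ∀ u, NatRel (σ (N - 1)) univ u a → Top N σ univ u) {n α : ℕ} {e : ℕ → M} (hα : α < n)
    (hαa : ExpBelow N σ a (N - 3) (e α)) : Ev univ (LInM2 (InM2Iter (LtTW N σ) α)) n e := by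
  refine ((isLevel hM hN hσ (j := 0) (by omega)).ev_Refl hM niceClass_univ
    fun b _ Q _ _ => ?_).2 (hM.refl_inM2Tower hN hσ hB htop hαa)
  rw [hM.ev_InM2Iter hN hσ (by omega) (by omega), up_self, up_lt _ _ (by omega),
    up_lt _ _ (by omega)]

/-- Every predecessor `β` of `α` also has its exponents below `a`, so the assertion for `M₂` of an
iterate, applied to `β`, is exactly what the recursion clause demands. -/
theorem KPModel.ev_LInM2Iter (hM : KPModel N M) (hN : 3 ≤ N)
    (hσ : ∀ i, 2 ≤ i → i ≤ N - 1 → IsSigma 1 (σ i)) (hB : Base N σ (univ : Set M)) {a : M}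
    (htop : ∀ u, NatRel (σ (N - 1)) univ u a → Top N σ univ u) {n α : ℕ} {e : ℕ → M} (hα : α < n)
    (hαa : ExpBelow N σ a (N - 3) (e α)) : Ev univ (LInM2Iter (LtTW N σ) α) n e := by
  rw [LInM2Iter, ev_All]
  intro β _
  rw [ev_Imp, LtTW, ev_TowerLtW _ _ _ (by omega) (by omega), up_self, up_lt _ _ hα]
  intro hβ
  obtain ⟨w, hw⟩ := hM.exists_omega
  have hlt := hM.ltDom_of_sTowerLtW niceClass_univ hw trivial hB hσ le_rfl trivial trivial hβ
  refine hM.ev_LInM2 hN hσ hB htop (by omega) ?_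
  rw [up_self]
  exact hM.expBelow_of_lt hN hB le_rfl hlt hαa

end Literal

end PiRefl

theorem theorem4 (N : ℕ) (hN : 3 ≤ N) (σ : ℕ → PiRefl.setLang.Formula (Fin 2))
    (hσ : ∀ i, 2 ≤ i → i ≤ N - 1 → PiRefl.IsSigma 1 (σ i))
    (htrans : ∀ i, 2 ≤ i → i ≤ N - 1 →
      PiRefl.KPPiTheory N ⊨ᵇ PiRefl.Transitivity (PiRefl.Rel (σ i)) 0) :
    PiRefl.ProvesFromTI N σ (PiRefl.LInM2Iter (PiRefl.LtTW N σ)) ∧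
      PiRefl.ProvesFromTI N σ
        (fun α => PiRefl.LInM2 (PiRefl.InM2Iter (PiRefl.LtTW N σ) α)) := by
  exact ⟨PiRefl.provesFromTI_of_models hN hσ htrans fun _ _ hM hB _ htop _ _ _ hα hαa =>
      hM.ev_LInM2Iter hN hσ hB htop hα hαa,
    PiRefl.provesFromTI_of_models hN hσ htrans fun _ _ hM hB _ htop _ _ _ hα hαa =>
      hM.ev_LInM2 hN hσ hB htop hα hαa⟩
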